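/- **Setting.** Let $X$, $Y$ be finite-dimensional Euclidean spaces with $\dim X\le N$, $\dim Y\le M$ ($N,M\ge 1$ integers). Let $A$ be a symmetric positive definite and $J$ an antisymmetric linear operator on $X$, let $H\in C^2(X;\mathbb R)$ with $e^{-H}$ integrable, and $\mu(dx)=Z^{-1}e^{-H(x)}dx$ the associated probability measure. Let $P:X\to Y$ be linear with adjoint $P^t$ and $NPP^t=\mathrm{id}_Y$; put $\bar\mu=P_\sharp\mu$, let $\mu(dx|y)$ be the conditional measures of $\mu$ given $Px=y$, and let $\bar H\in C^2(Y;\mathbb R)$ satisfy $\bar\mu(dy)=e^{-N\bar H(y)}dy$. Define $\bar A$, $\bar J$ on $Y$ by $\bar A^{-1}=PA^{-1}NP^t$ and $\bar J=\bar APA^{-1}NJP^t$. Let $f(t,x)$, $t\ge0$, be a solution of $\partial_t(f\mu)=\operatorname{div}[\mu(A+J)\nabla f]$ with $f(0,\cdot)=f_0$, i.e. each $f(t,\cdot)\geq 0$ is a probability density with respect to $\mu$; $f,\nabla f,D^2f$ exist and are continuous and the equation holds pointwise for $t>0$; $\int_0^T\!\int|\nabla f|\,d\mu\,dt<\infty$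 for all $T>0$; and $f(t,\cdot)\to f_0$ in $L^1(\mu)$ as $t\downarrow0$. Let $\bar f(t,y)=\int f(t,x)\,\mu(dx|y)$. Let $\eta:[0,\infty)\to Y$ solve $\dot\eta=-(\bar A+\bar J)\nabla\bar H(\eta)$, $\eta(0)=\eta_0$. **Assumptions.** Write $\Phi(s)=s\log s$. A probability measure $\nu$ satisfies $\mathrm{LSI}(\rho)$ if $\int\Phi(g)\,d\nu-\Phi(\int g\,d\nu)\le\frac1{2\rho}\int\frac{|\nabla g|^2}{g}\,d\nu$ for all locally Lipschitz $0\le g\in L^1(\nu)$. 1. (i) $\langle \operatorname{Hess}H(x)u,v\rangle\le\kappa$ for all $x\in X$ and unit vectors $u\in\operatorname{Ran}(NP^tP)$, $v\in\operatorname{Ran}(\mathrm{id}_X-NP^tP)$; 2. (ii) $\mu(dx|y)$ satisfies $\mathrm{LSI}(\rho)$ for $\bar\mu$-almost every $y$; 3. (iii) $\lambda\,\mathrm{Id}\le\operatorname{Hess}\bar H\le\Lambda\,\mathrm{Id}$ on $Y$; 4. (iv) $\int|x|^2f(t,x)\,\mu(dx)\le\alpha N$ for all $t\ge0$; 5. (v)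 $\bar H\ge-\beta$ on $Y$; 6. (vi) $|(\mathrm{id}_X-NP^tP)x|^2\le\gamma M^{-2}\langle x,Ax\rangle$ for all $x\in X$; 7. (vii) $\int\Phi(f_0)\,d\mu\le C_1N$ and $\bar H(\eta_0)\le C_2$; 8. (viii) $A\ge\tau\,\mathrm{Id}$ for some $\tau>0$; 9. (ix) $-J^2\le cA$; 10. (x) $JA=AJ$. **Claim.** Consider a sequence, indexed by $\ell$, of such data $(X_\ell,Y_\ell,N_\ell,M_\ell,P_\ell,A_\ell,J_\ell,H_\ell,\bar H_\ell,f_\ell,\eta_\ell)$ satisfying (i)–(x) with constants $\kappa$, $c$, $C_1,C_2\in\mathbb R$ and $\rho,\lambda,\Lambda,\alpha,\beta,\gamma>0$ that do not depend on $\ell$ (the number $\tau=\tau_\ell>0$ in (viii) may depend on $\ell$). Suppose $N_\ell\to\infty$, $M_\ell\to\infty$, $M_\ell/N_\ell\to0$ and $$\lim_{\ell\to\infty}\frac1{N_\ell}\int\big\langle x-N_\ell P_\ell^t\eta_{\ell}(0),\,A_\ell^{-1}(x-N_\ell P_\ell^t\eta_{\ell}(0))\big\rangle f_{\ell}(0,x)\,\mu_\ell(dx)=0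 .$$ Then for every $T>0$: (a) $\displaystyle\lim_{\ell\to\infty}\ \sup_{0\le t\le T}\frac1{N_\ell}\int\big\langle x-N_\ell P_\ell^t\eta_\ell(t),\,A_\ell^{-1}(x-N_\ell P_\ell^t\eta_\ell(t))\big\rangle f_\ell(t,x)\,\mu_\ell(dx)=0$; (b) $\displaystyle\lim_{\ell\to\infty}\int_0^T\!\!\int|y-\eta_\ell(t)|_{Y_\ell}^2\,\bar f_\ell(t,y)\,\bar\mu_\ell(dy)\,dt=0$. -/

import Mathlib

open MeasureTheory Filter Topology Set
open scoped ENNReal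

noncomputable section

namespace TwoScale

section LogSobolev

variable {E : Type*} [NormedAddCommGroup E]

/-- The length `|∇g|(x)` of the gradient of a locally Lipschitz function `g`, as the local Lipschitz
constant `limsup_{y → x, y ≠ x} |g y - g x| / |y - x|`. It equals `‖∇g(x)‖` wherever `g` is
differentiable, and it makes sense everywhere, hence also for measures that are
carried by an affine subspace, such as the conditional measures below. -/
def gradNorm (g : E → ℝ) (x : E) : ℝ≥0∞ :=
  limsup (fun y => edist (g y) (g x) / edist y x) (𝓝[≠] x)

/-- The Fisher information `∫ |∇g|² / g dν`, with `0 / 0 = 0`. -/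
def fisherInfo [MeasurableSpace E] (ν : Measure E) (g : E → ℝ) : ℝ≥0∞ :=
  ∫⁻ x, gradNorm g x ^ 2 / ENNReal.ofReal (g x) ∂ν

/-- The function `Φ(s) = s log s`. -/
def Phi (s : ℝ) : ℝ := s * Real.log s

/-- `ν` satisfies the logarithmic Sobolev inequality with constant `ρ`:
`∫ Φ(g) dν - Φ(∫ g dν) ≤ (1 / 2ρ) ∫ |∇g|² / g dν` for all locally Lipschitz nonnegative
`g ∈ L¹(ν)`; there is nothing to say when the right-hand side is infinite. -/
def LSI [MeasurableSpace E] (ν : Measure E) (ρ : ℝ) : Prop :=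
  ∀ g : E → ℝ, LocallyLipschitz g → (∀ x, 0 ≤ g x) → Integrable g ν → fisherInfo ν g ≠ ∞ →
    Integrable (fun x => Phi (g x)) ν ∧
      ∫ x, Phi (g x) ∂ν - Phi (∫ x, g x ∂ν) ≤ 1 / (2 * ρ) * (fisherInfo ν g).toReal

end LogSobolev

section Setting

variable {X Y : Type*}
  [NormedAddCommGroup X] [InnerProductSpace ℝ X] [FiniteDimensional ℝ X]
  [MeasurableSpace X] [BorelSpace X]
  [NormedAddCommGroup Y] [InnerProductSpace ℝ Y] [FiniteDimensional ℝ Y]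
  [MeasurableSpace Y] [BorelSpace Y]

/-- The Hessian of `H` at `x` as a bilinear form, `⟨Hess H(x) u, v⟩`. -/
def hess (H : X → ℝ) (x u v : X) : ℝ := fderiv ℝ (fderiv ℝ H) x u v

/-- The divergence of a vector field. -/
def divergence (V : X → X) (x : X) : ℝ := LinearMap.trace ℝ X (fderiv ℝ V x : X →ₗ[ℝ] X)

/-- The inverse of a linear operator (used for invertible operators only). -/
def opInv (B : X →ₗ[ℝ] X) : X →ₗ[ℝ] X := Ring.inverse (M₀ := Module.End ℝ X) B

/-- The invariant measure `μ(dx) = Z⁻¹ exp(-H(x)) dx`. -/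
def gibbs (H : X → ℝ) : Measure X := (volume : Measure X).tilted (fun x => -H x)

instance instIsFiniteMeasureGibbs (H : X → ℝ) : IsFiniteMeasure (gibbs H) := by
  unfold gibbs; infer_instance

/-- The law `μ̄ = P_# μ` of the macroscopic variable. -/
def macroMeasure (P : X →ₗ[ℝ] Y) (H : X → ℝ) : Measure Y := (gibbs H).map P

/-- The conditional measures `μ(dx|y)` of `μ` given `Px = y` (determined for `μ̄`-almost all `y`). -/
def condMeasure (P : X →ₗ[ℝ] Y) (H : X → ℝ) (y : Y) : Measure X :=
  ProbabilityTheory.condDistrib (id : X → X) P (gibbs H) y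

/-- The macroscopic density `f̄(y) = ∫_{Px=y} f(x) μ(dx|y)`. -/
def macroDensity (P : X →ₗ[ℝ] Y) (H : X → ℝ) (f : X → ℝ) (y : Y) : ℝ :=
  ∫ x, f x ∂(condMeasure P H y)

/-- The lift `N Pᵗ : Y → X`. -/
def lift (N : ℕ) (P : X →ₗ[ℝ] Y) : Y →ₗ[ℝ] X := (N : ℝ) • LinearMap.adjoint P

/-- `Ā`, defined by `Ā⁻¹ = P A⁻¹ N Pᵗ`. -/
def macroA (N : ℕ) (P : X →ₗ[ℝ] Y) (A : X →ₗ[ℝ] X) : Y →ₗ[ℝ] Y :=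
  opInv (P ∘ₗ opInv A ∘ₗ lift N P)

/-- `J̄ = Ā P A⁻¹ N J Pᵗ`. -/
def macroJ (N : ℕ) (P : X →ₗ[ℝ] Y) (A J : X →ₗ[ℝ] X) : Y →ₗ[ℝ] Y :=
  macroA N P A ∘ₗ P ∘ₗ opInv A ∘ₗ ((N : ℝ) • (J ∘ₗ LinearMap.adjoint P))

/-- `f(t, x)` is a solution of the Fokker-Planck equation `∂ₜ(f μ) = div [μ (A + J) ∇f]`, with
initial datum `f 0`: at each time it is a probability density with respect to `μ`; it is a
classical solution for positive times, has `∇f` integrable with respect to `dt μ(dx)` on bounded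
time intervals, and takes its initial datum in `L¹(μ)`. -/
structure IsMicroSolution (A J : X →ₗ[ℝ] X) (H : X → ℝ) (f : ℝ → X → ℝ) : Prop where
  nonneg : ∀ t, 0 ≤ t → ∀ x, 0 ≤ f t x
  integrable : ∀ t, 0 ≤ t → Integrable (f t) (gibbs H)
  mass : ∀ t, 0 ≤ t → ∫ x, f t x ∂(gibbs H) = 1
  contDiff : ∀ t, 0 < t → ContDiff ℝ 2 (f t)
  continuousOn : ContinuousOn (fun p : ℝ × X => f p.1 p.2) (Ioi 0 ×ˢ univ)
  continuousOn_fderiv :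
    ContinuousOn (fun p : ℝ × X => fderiv ℝ (f p.1) p.2) (Ioi 0 ×ˢ univ)
  continuousOn_fderiv2 :
    ContinuousOn (fun p : ℝ × X => fderiv ℝ (fderiv ℝ (f p.1)) p.2) (Ioi 0 ×ˢ univ)
  equation : ∀ t, 0 < t → ∀ x,
    HasDerivAt (fun s => f s x * Real.exp (-H x))
      (divergence (fun z => Real.exp (-H z) • (A + J) (gradient (f t) z)) x) t
  integrable_gradient : ∀ T : ℝ, 0 < T →
    Integrable (fun p : ℝ × X => gradient (f p.1) p.2)
      (((volume : Measure ℝ).restrict (Ioc 0 T)).prod (gibbs H))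
  initial : Tendsto (fun t => ∫ x, |f t x - f 0 x| ∂(gibbs H)) (𝓝[>] 0) (𝓝 0)

/-- `η` solves `dη/dt = -(Ā + J̄) ∇H̄(η)` on `[0, ∞)`, with initial datum `η 0`. -/
def IsMacroSolution (N : ℕ) (P : X →ₗ[ℝ] Y) (A J : X →ₗ[ℝ] X) (Hbar : Y → ℝ) (η : ℝ → Y) : Prop :=
  ∀ t, 0 ≤ t →
    HasDerivWithinAt η (-(macroA N P A + macroJ N P A J) (gradient Hbar (η t))) (Ici 0) t

/-- The abstract setting: microscopic space `X` (size `N`), macroscopic space `Y` (size `M`),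
coarse-graining operator `P`, operators `A` and `J`, microscopic Hamiltonian `H`, macroscopic
Hamiltonian `Hbar`, and the two evolutions `f` and `η`. -/
structure IsSystem (N M : ℕ) (P : X →ₗ[ℝ] Y) (A J : X →ₗ[ℝ] X) (H : X → ℝ) (Hbar : Y → ℝ)
    (f : ℝ → X → ℝ) (η : ℝ → Y) : Prop where
  N_pos : 0 < N
  M_pos : 0 < M
  finrank_X : Module.finrank ℝ X ≤ N
  finrank_Y : Module.finrank ℝ Y ≤ M
  A_symm : ∀ x z, inner ℝ (A x) z = inner ℝ x (A z)
  A_pos : ∀ x, x ≠ 0 → 0 < inner ℝ (A x) x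
  J_antisymm : ∀ x z, inner ℝ (J x) z = -inner ℝ x (J z)
  coarse : ∀ y, P (lift N P y) = y
  H_contDiff : ContDiff ℝ 2 H
  integrable_exp : Integrable (fun x => Real.exp (-H x)) (volume : Measure X)
  Hbar_contDiff : ContDiff ℝ 2 Hbar
  macro_law : macroMeasure P H =
    (volume : Measure Y).withDensity (fun y => ENNReal.ofReal (Real.exp (-(N * Hbar y))))
  micro_sol : IsMicroSolution A J H f
  macro_sol : IsMacroSolution N P A J Hbar η

/-- The assumptions on a system. The constants `κ, ρ, λ, Λ, α, β, γ, C₁, C₂, c` are parameters, so that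
they can be asked to be the same for all members of a sequence of systems. -/
structure Assumptions (N M : ℕ) (P : X →ₗ[ℝ] Y) (A J : X →ₗ[ℝ] X) (H : X → ℝ) (Hbar : Y → ℝ)
    (f : ℝ → X → ℝ) (η : ℝ → Y) (κ ρ lam Lam α β γ C₁ C₂ c : ℝ) : Prop where
  i : ∀ x u v, u ∈ LinearMap.range (lift N P ∘ₗ P) →
    v ∈ LinearMap.range (LinearMap.id - lift N P ∘ₗ P) → ‖u‖ = 1 → ‖v‖ = 1 → hess H x u v ≤ κ
  ii : ∀ᵐ y ∂(macroMeasure P H), LSI (condMeasure P H y) ρ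
  iii : ∀ y v, lam * ‖v‖ ^ 2 ≤ hess Hbar y v v ∧ hess Hbar y v v ≤ Lam * ‖v‖ ^ 2
  iv : ∀ t, 0 ≤ t → Integrable (fun x => ‖x‖ ^ 2 * f t x) (gibbs H) ∧
    ∫ x, ‖x‖ ^ 2 * f t x ∂(gibbs H) ≤ α * N
  v : ∀ y, -β ≤ Hbar y
  vi : ∀ x, ‖x - lift N P (P x)‖ ^ 2 ≤ γ / (M : ℝ) ^ 2 * inner ℝ x (A x)
  vii_micro : Integrable (fun x => Phi (f 0 x)) (gibbs H) ∧
    ∫ x, Phi (f 0 x) ∂(gibbs H) ≤ C₁ * N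
  vii_macro : Hbar (η 0) ≤ C₂
  viii : ∃ τ : ℝ, 0 < τ ∧ ∀ x, τ * ‖x‖ ^ 2 ≤ inner ℝ (A x) x
  ix : ∀ x, inner ℝ (-(J (J x))) x ≤ c * inner ℝ (A x) x
  x : J ∘ₗ A = A ∘ₗ J

/-- `(1/N) ∫ (x - N Pᵗ y) · A⁻¹ (x - N Pᵗ y) f(x) μ(dx)`. -/
def microDistance (N : ℕ) (P : X →ₗ[ℝ] Y) (A : X →ₗ[ℝ] X) (H : X → ℝ) (f : X → ℝ) (y : Y) :
    ℝ≥0∞ :=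
  (∫⁻ x, ENNReal.ofReal
    (inner ℝ (x - lift N P y) (opInv A (x - lift N P y)) * f x) ∂(gibbs H)) / N

/-- `∫ |y - y₀|² f̄(y) μ̄(dy)`. -/
def macroDistance (P : X →ₗ[ℝ] Y) (H : X → ℝ) (f : X → ℝ) (y₀ : Y) : ℝ≥0∞ :=
  ∫⁻ y, ENNReal.ofReal (‖y - y₀‖ ^ 2 * macroDensity P H f y) ∂(macroMeasure P H)

end Setting

end TwoScale

end

/-!
The proof compares the microscopic law `f(t) μ` with the lift `N Pᵗ η(t)` of the macroscopic
trajectory directly, through the quadratic functional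
`∫ ½ ⟨z, A⁻¹ z⟩ f(t, x) μ(dx)`, `z = x - N Pᵗ η(t)` (`microEnergy`), and shows that it satisfies a
Gronwall inequality whose driving terms are `o(N)`.

Differentiating in time and using the Fokker-Planck equation gives
`∫ ⟨A⁻¹ z, N Pᵗ w⟩ f - ⟨(1 - J A⁻¹) z, ∇f⟩ dμ` with `w = (Ā + J̄) ∇H̄(η)` (`integral_energyRate`).
The part of `∇f` along the range of `N Pᵗ P` is integrated by parts (`integral_exchangeRate`). As
`J A⁻¹` is antisymmetric, the trace that appears is `dim Y ≤ M`, and the force that appears is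
`N P ∇H = N ∇H̄(P x) + G(x)`, with `G` the fluctuation `forceFluct`. The strong convexity of `H̄`
then makes the macroscopic part contract at the rate `N λ |P x - η|²`, and the remaining terms are
estimated pointwise in `drift_le`: the components of `z` and `∇f` along the fibres of `P` cost a
factor `1 / M`, because `|x - N Pᵗ P x|² ≤ γ M⁻² ⟨x, A x⟩`, in exchange for the second moment of `f`
and the dissipation `⟨∇f, A ∇f⟩ / f`; the terms coming from `J` go into the Gronwall constant,
because `-J² ≤ c A`.

Four estimates close the argument.
* The time integral of the dissipation is at most the initial entropy `C₁ N`
  (`lintegral_dissipation_le`). It is obtained from regularised entropies of linear growth, which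
  are continuous along `L¹(μ)` convergence to the initial datum.
* The fluctuation `G` has conditional mean zero and is `κ √N`-Lipschitz along the fibres in each
  unit direction. The logarithmic Sobolev inequality on the fibres yields Gaussian concentration
  (Herbst's argument, `LSI.cgf_le_of_bounded`), and the duality between entropy and exponential
  moments then bounds `∫ |G|² f dμ` by the fibre Fisher information plus a term `O(M N)`
  (`LSI.lintegral_sq_mul_le`, `lintegral_forceFluct_le`).
* Along the macroscopic flow, `∫ c |∇H̄(η)|² + ⟨η', Ā⁻¹ η'⟩ dt` is bounded uniformly (`macro_energy`);
  `J̄` need not be antisymmetric, and its contribution is absorbed by an exponential weight.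
* All integrations by parts are done with cutoff functions in space; the cutoffs are removed by
  dominated convergence, using the second moments, the dissipation and the lower bound on `A`
  (which enters only qualitatively).

Altogether the driving terms per unit of `N` are of order `1 / M + M / N`
(`tendsto_errorBound_div`), which gives both limits at once: the functional itself controls the
microscopic distance, and the contraction term controls the macroscopic one.
-/

set_option linter.unusedSectionVars false

namespace TwoScale

open ProbabilityTheory

/-! ### Local Lipschitz constants -/

section GradNorm

variable {E : Type*} [NormedAddCommGroup E]

lemma lipschitzWith_of_abs_sub_le {g : E → ℝ} {L : ℝ} (hL : 0 ≤ L)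
    (hg : ∀ x y, |g x - g y| ≤ L * ‖x - y‖) : LipschitzWith L.toNNReal g := by
  refine LipschitzWith.of_dist_le_mul fun x y => ?_
  rw [Real.dist_eq, dist_eq_norm, Real.coe_toNNReal _ hL]; exact hg x y

lemma gradNorm_le_of_eventually {g : E → ℝ} {x : E} {C : ℝ}
    (h : ∀ᶠ y in 𝓝 x, |g y - g x| ≤ C * ‖y - x‖) : gradNorm g x ≤ ENNReal.ofReal C := by
  refine limsup_le_of_le (by isBoundedDefault) ?_
  filter_upwards [h.filter_mono nhdsWithin_le_nhds, self_mem_nhdsWithin] with y hy hne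
  have hne' : 0 < ‖y - x‖ := norm_pos_iff.2 (sub_ne_zero.2 hne)
  have hC : 0 ≤ C := by
    by_contra hC
    have := (abs_nonneg _).trans hy
    nlinarith
  refine ENNReal.div_le_of_le_mul ?_
  rw [edist_dist, edist_dist, Real.dist_eq, dist_eq_norm, ← ENNReal.ofReal_mul hC]
  exact ENNReal.ofReal_le_ofReal hy

lemma gradNorm_le_of_forall_gt {g : E → ℝ} {x : E} {C : ℝ}
    (h : ∀ C', C < C' → ∀ᶠ y in 𝓝 x, |g y - g x| ≤ C' * ‖y - x‖) :
    gradNorm g x ≤ ENNReal.ofReal C := by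
  have hlim : Tendsto (fun C' => ENNReal.ofReal C') (𝓝[>] C) (𝓝 (ENNReal.ofReal C)) :=
    (ENNReal.continuous_ofReal.tendsto C).mono_left nhdsWithin_le_nhds
  exact ge_of_tendsto hlim
    (eventually_mem_nhdsWithin.mono fun C' hC' => gradNorm_le_of_eventually (h C' hC'))

lemma gradNorm_le_of_hasFDerivAt [NormedSpace ℝ E] {g : E → ℝ} {g' : E →L[ℝ] ℝ} {x : E}
    (h : HasFDerivAt g g' x) : gradNorm g x ≤ ENNReal.ofReal ‖g'‖ := by
  refine gradNorm_le_of_forall_gt fun C' hC' => ?_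
  filter_upwards [h.isLittleO.def (sub_pos.2 hC')] with y hy
  have h1 : ‖g y - g x‖ ≤ ‖g y - g x - g' (y - x)‖ + ‖g' (y - x)‖ := by
    simpa using norm_add_le (g y - g x - g' (y - x)) (g' (y - x))
  have h2 := g'.le_opNorm (y - x)
  rw [Real.norm_eq_abs] at h1
  nlinarith

lemma gradNorm_exp_mul_le {g : E → ℝ} {L : ℝ} (hL : 0 ≤ L)
    (hg : ∀ x y, |g x - g y| ≤ L * ‖x - y‖) (s : ℝ) (x : E) :
    gradNorm (fun y => Real.exp (s * g y)) x ≤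
      ENNReal.ofReal (|s| * L * Real.exp (s * g x)) := by
  have hcont : Continuous g := by
    refine (LipschitzWith.of_dist_le_mul (K := L.toNNReal) fun x y => ?_).continuous
    rw [Real.dist_eq, dist_eq_norm, Real.coe_toNNReal _ hL]; exact hg x y
  refine gradNorm_le_of_forall_gt fun C' hC' => ?_
  have ht : Tendsto (fun y => |s| * L * max (Real.exp (s * g y)) (Real.exp (s * g x))) (𝓝 x)
      (𝓝 (|s| * L * Real.exp (s * g x))) := by
    have : Continuous fun y => |s| * L * max (Real.exp (s * g y)) (Real.exp (s * g x)) := by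
      fun_prop
    simpa using this.tendsto x
  filter_upwards [ht.eventually (gt_mem_nhds hC')] with y hy
  have key : ∀ a b : ℝ, Real.exp a - Real.exp b ≤ |a - b| * Real.exp a := by
    intro a b
    have h1 := Real.add_one_le_exp (b - a)
    have h2 : Real.exp b = Real.exp (b - a) * Real.exp a := by rw [← Real.exp_add]; ring_nf
    have h3 := le_abs_self (a - b)
    have h4 := Real.exp_pos a
    nlinarith
  have habs : |Real.exp (s * g y) - Real.exp (s * g x)| ≤
      |s * g y - s * g x| * max (Real.exp (s * g y)) (Real.exp (s * g x)) := by
    rw [abs_sub_le_iff]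
    constructor
    · exact (key _ _).trans (mul_le_mul_of_nonneg_left (le_max_left _ _) (abs_nonneg _))
    · rw [abs_sub_comm]
      exact (key _ _).trans (mul_le_mul_of_nonneg_left (le_max_right _ _) (abs_nonneg _))
  have h5 : |s * g y - s * g x| ≤ |s| * (L * ‖y - x‖) := by
    rw [← mul_sub, abs_mul]; exact mul_le_mul_of_nonneg_left (hg y x) (abs_nonneg _)
  calc _ ≤ _ := habs
    _ ≤ |s| * (L * ‖y - x‖) * max (Real.exp (s * g y)) (Real.exp (s * g x)) :=
        mul_le_mul_of_nonneg_right h5 (by positivity)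
    _ = |s| * L * max (Real.exp (s * g y)) (Real.exp (s * g x)) * ‖y - x‖ := by ring
    _ ≤ _ := mul_le_mul_of_nonneg_right hy.le (norm_nonneg _)

end GradNorm

/-! ### Concentration from the logarithmic Sobolev inequality -/

section Herbst

lemma integrable_exp_mul_of_bounded {Ω : Type*} [MeasurableSpace Ω] {ν : Measure Ω}
    [IsFiniteMeasure ν] {g : Ω → ℝ} {B : ℝ} (hm : AEStronglyMeasurable g ν)
    (hB : ∀ x, |g x| ≤ B) (s : ℝ) : Integrable (fun x => Real.exp (s * g x)) ν := by
  refine Integrable.of_bound (C := Real.exp (|s| * B)) ?_ (ae_of_all _ fun x => ?_)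
  · exact Real.continuous_exp.comp_aestronglyMeasurable (hm.const_mul s)
  · rw [Real.norm_eq_abs, Real.abs_exp]
    refine Real.exp_le_exp.2 ((le_abs_self _).trans ?_)
    rw [abs_mul]; exact mul_le_mul_of_nonneg_left (hB x) (abs_nonneg _)

variable {E : Type*} [NormedAddCommGroup E] [MeasurableSpace E] [BorelSpace E]
  {ν : Measure E} [IsProbabilityMeasure ν] {ρ L : ℝ} {g : E → ℝ}

/-- The differential inequality behind Herbst's argument: the logarithmic Sobolev inequality
for `exp (s g)`. -/
lemma LSI.exp_mul_entropy_le (h : LSI ν ρ) (hρ : 0 < ρ) (hL : 0 ≤ L)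
    (hg : ∀ x y, |g x - g y| ≤ L * ‖x - y‖) {B : ℝ} (hB : ∀ x, |g x| ≤ B) (s : ℝ) :
    s * ∫ x, g x * Real.exp (s * g x) ∂ν - mgf g ν s * cgf g ν s ≤
      s ^ 2 * (L ^ 2 / (2 * ρ)) * mgf g ν s := by
  have hcont : Continuous g := (lipschitzWith_of_abs_sub_le hL hg).continuous
  have hint := integrable_exp_mul_of_bounded (ν := ν) hcont.aestronglyMeasurable hB s
  have hmgf : mgf g ν s = ∫ x, Real.exp (s * g x) ∂ν := rfl
  have hfish : fisherInfo ν (fun x => Real.exp (s * g x)) ≤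
      ENNReal.ofReal (s ^ 2 * L ^ 2 * mgf g ν s) := by
    calc fisherInfo ν (fun x => Real.exp (s * g x))
        ≤ ∫⁻ x, ENNReal.ofReal (s ^ 2 * L ^ 2 * Real.exp (s * g x)) ∂ν := by
          refine lintegral_mono fun x => ?_
          have h1 := gradNorm_exp_mul_le hL hg s x
          refine (ENNReal.div_le_div_right (pow_le_pow_left₀ zero_le h1 2) _).trans
            (le_of_eq ?_)
          rw [← ENNReal.ofReal_pow (by positivity), ← ENNReal.ofReal_div_of_pos (Real.exp_pos _)]
          congr 1
          rw [div_eq_iff (Real.exp_pos _).ne', mul_pow, mul_pow, sq_abs]; ring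
      _ = _ := by
          rw [← ofReal_integral_eq_lintegral_ofReal (hint.const_mul _)
            (ae_of_all _ fun x => by positivity), integral_const_mul]; rfl
  have hloc : LocallyLipschitz fun x => Real.exp (s * g x) := by
    have h1 : LocallyLipschitz (fun t : ℝ => Real.exp (s * t)) := by
      have : ContDiff ℝ 1 (fun t : ℝ => Real.exp (s * t)) := by fun_prop
      exact this.locallyLipschitz
    exact h1.comp (lipschitzWith_of_abs_sub_le hL hg).locallyLipschitz
  obtain ⟨-, h2⟩ := h _ hloc (fun x => (Real.exp_pos _).le) hint
    (hfish.trans_lt ENNReal.ofReal_lt_top).ne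
  have h3 : (fisherInfo ν (fun x => Real.exp (s * g x))).toReal ≤ s ^ 2 * L ^ 2 * mgf g ν s :=
    ENNReal.toReal_le_of_le_ofReal (mul_nonneg (by positivity) mgf_nonneg) hfish
  have h4 : ∫ x, Phi (Real.exp (s * g x)) ∂ν = s * ∫ x, g x * Real.exp (s * g x) ∂ν := by
    rw [← integral_const_mul]
    refine integral_congr_ae (ae_of_all _ fun x => ?_)
    simp only [Phi, Real.log_exp]; ring
  rw [h4] at h2
  have h5 : 1 / (2 * ρ) * (fisherInfo ν (fun x => Real.exp (s * g x))).toReal ≤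
      1 / (2 * ρ) * (s ^ 2 * L ^ 2 * mgf g ν s) := mul_le_mul_of_nonneg_left h3 (by positivity)
  have h6 : Phi (∫ x, Real.exp (s * g x) ∂ν) = mgf g ν s * cgf g ν s := by
    rw [← hmgf]; rfl
  rw [h6] at h2
  calc _ ≤ _ := h2.trans h5
    _ = _ := by ring

/-- Herbst's argument for bounded Lipschitz functions. -/
lemma LSI.cgf_le_of_bounded (h : LSI ν ρ) (hρ : 0 < ρ) (hL : 0 ≤ L)
    (hg : ∀ x y, |g x - g y| ≤ L * ‖x - y‖) {B : ℝ} (hB : ∀ x, |g x| ≤ B) {s : ℝ} (hs : 0 ≤ s) :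
    cgf g ν s ≤ s * ∫ x, g x ∂ν + s ^ 2 * (L ^ 2 / (2 * ρ)) := by
  rcases hs.eq_or_lt with rfl | hs
  · simp
  have hcont : Continuous g := (lipschitzWith_of_abs_sub_le hL hg).continuous
  have hset : integrableExpSet g ν = univ := eq_univ_of_forall fun t =>
    integrable_exp_mul_of_bounded (ν := ν) hcont.aestronglyMeasurable hB t
  have hmem : ∀ t, t ∈ interior (integrableExpSet g ν) := fun t => by simp [hset]
  have hd : ∀ t, HasDerivAt (cgf g ν) (deriv (cgf g ν) t) t := fun t =>
    ((analyticAt_cgf (hmem t)).differentiableAt).hasDerivAt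
  set k : ℝ := L ^ 2 / (2 * ρ)
  -- The logarithmic Sobolev inequality says that `cgf t / t - k t` decreases on `(0, ∞)`; its limit
  -- at `0` is the mean of `g`.
  set F : ℝ → ℝ := fun t => cgf g ν t / t - k * t with hF
  have hFd : ∀ t, 0 < t → HasDerivAt F
      ((deriv (cgf g ν) t * t - cgf g ν t * 1) / t ^ 2 - k * 1) t := fun t ht =>
    ((hd t).div (hasDerivAt_id t) ht.ne').sub ((hasDerivAt_id t).const_mul k)
  have hanti : AntitoneOn F (Ioi 0) := by
    refine antitoneOn_of_deriv_nonpos (convex_Ioi 0)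
      (fun t ht => (hFd t ht).continuousAt.continuousWithinAt)
      (fun t ht => ?_) (fun t ht => ?_)
    · rw [interior_Ioi] at ht
      exact (hFd t ht).differentiableAt.differentiableWithinAt
    rw [interior_Ioi] at ht
    rw [(hFd t ht).deriv, deriv_cgf (hmem t), mul_one, mul_one, sub_nonpos, div_le_iff₀ (by
      have : (0 : ℝ) < t := ht
      positivity)]
    have h1 := h.exp_mul_entropy_le hρ hL hg hB t
    have h2 : 0 < mgf g ν t :=
      mgf_pos (integrable_exp_mul_of_bounded hcont.aestronglyMeasurable hB t)
    have h3 : (∫ x, g x * Real.exp (t * g x) ∂ν) / mgf g ν t * t - cgf g ν t =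
        (t * ∫ x, g x * Real.exp (t * g x) ∂ν - mgf g ν t * cgf g ν t) / mgf g ν t := by
      rw [eq_div_iff h2.ne', sub_mul, mul_assoc, mul_comm t, ← mul_assoc, div_mul_cancel₀ _ h2.ne',
        mul_comm _ t, mul_comm (cgf g ν t)]
    rw [h3, div_le_iff₀ h2]
    linarith
  have hlim : Tendsto F (𝓝[>] 0) (𝓝 (∫ x, g x ∂ν)) := by
    have h0 : HasDerivAt (cgf g ν) (∫ x, g x ∂ν) 0 := by
      have := hd 0
      rwa [deriv_cgf_zero (hmem 0), probReal_univ, div_one] at this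
    have h1 := hasDerivAt_iff_tendsto_slope.1 h0
    have h2 : Tendsto (fun t => cgf g ν t / t) (𝓝[>] 0) (𝓝 (∫ x, g x ∂ν)) := by
      refine (h1.mono_left (nhdsWithin_mono _ fun t ht => ne_of_gt ht)).congr fun t => ?_
      rw [slope_def_field]; simp
    have h3 : Tendsto (fun t : ℝ => k * t) (𝓝[>] 0) (𝓝 0) := by
      have : Continuous fun t : ℝ => k * t := by fun_prop
      simpa using (this.tendsto 0).mono_left nhdsWithin_le_nhds
    simpa using h2.sub h3
  have hle : F s ≤ ∫ x, g x ∂ν := by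
    refine ge_of_tendsto hlim ?_
    filter_upwards [Ioo_mem_nhdsGT hs] with t ht
    exact hanti ht.1 hs ht.2.le
  have : cgf g ν s / s ≤ ∫ x, g x ∂ν + k * s := by simp only [hF] at hle; linarith
  rw [div_le_iff₀ hs] at this
  linarith

lemma LSI.integral_exp_le_of_bounded (h : LSI ν ρ) (hρ : 0 < ρ) (hL : 0 ≤ L)
    (hg : ∀ x y, |g x - g y| ≤ L * ‖x - y‖) {B : ℝ} (hB : ∀ x, |g x| ≤ B) (s : ℝ) :
    ∫ x, Real.exp (s * g x) ∂ν ≤ Real.exp (s * ∫ x, g x ∂ν + s ^ 2 * (L ^ 2 / (2 * ρ))) := by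
  have main : ∀ (g : E → ℝ), (∀ x y, |g x - g y| ≤ L * ‖x - y‖) → (∀ x, |g x| ≤ B) → ∀ s, 0 ≤ s →
      ∫ x, Real.exp (s * g x) ∂ν ≤
        Real.exp (s * ∫ x, g x ∂ν + s ^ 2 * (L ^ 2 / (2 * ρ))) := by
    intro g hg hB s hs
    have hcont : Continuous g := (lipschitzWith_of_abs_sub_le hL hg).continuous
    have hi := integrable_exp_mul_of_bounded (ν := ν) hcont.aestronglyMeasurable hB s
    have h1 := h.cgf_le_of_bounded hρ hL hg hB hs
    have h2 : 0 < mgf g ν s := mgf_pos hi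
    exact (Real.log_le_iff_le_exp h2).1 h1
  -- Negative `s` amount to replacing `g` by `-g`.
  rcases le_total 0 s with hs | hs
  · exact main g hg hB s hs
  · have := main (fun x => -g x) (fun x y => by
      rw [abs_sub_comm]; simpa [sub_eq_add_neg, add_comm] using hg x y)
      (fun x => by simpa using hB x) (-s) (by linarith)
    simpa [integral_neg] using this

end Herbst

section Concentration

variable {E : Type*} [NormedAddCommGroup E] [MeasurableSpace E] [BorelSpace E]
  {ν : Measure E} [IsProbabilityMeasure ν] {ρ L : ℝ} {g : E → ℝ}

/-- Truncation of a real number to `[-n, n]`. -/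
def clamp (n : ℕ) (a : ℝ) : ℝ := max (min a n) (-n)

lemma abs_clamp_le (n : ℕ) (a : ℝ) : |clamp n a| ≤ n := by
  have hn : (0 : ℝ) ≤ n := n.cast_nonneg
  rw [clamp, abs_le]
  exact ⟨le_max_right _ _, max_le (min_le_right _ _) (by linarith)⟩

lemma abs_clamp_le_abs (n : ℕ) (a : ℝ) : |clamp n a| ≤ |a| := by
  have hn : (0 : ℝ) ≤ n := n.cast_nonneg
  rw [clamp, abs_le]
  constructor
  · refine le_max_of_le_left (le_min (neg_abs_le a) ?_)
    linarith [abs_nonneg a]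
  · exact max_le ((min_le_left _ _).trans (le_abs_self a)) (by linarith [abs_nonneg a])

lemma abs_clamp_sub_le (n : ℕ) (a b : ℝ) : |clamp n a - clamp n b| ≤ |a - b| := by
  unfold clamp
  refine (abs_max_sub_max_le_abs _ _ _).trans ?_
  have := abs_min_sub_min_le_max a n b n
  simpa using this

lemma clamp_eventually_eq (a : ℝ) : ∀ᶠ n : ℕ in atTop, clamp n a = a := by
  filter_upwards [eventually_ge_atTop ⌈|a|⌉₊] with n hn
  have h1 : |a| ≤ n := (Nat.le_ceil _).trans (by exact_mod_cast hn)
  rw [abs_le] at h1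
  rw [clamp, min_eq_left h1.2, max_eq_left h1.1]

lemma tendsto_clamp (a : ℝ) : Tendsto (fun n : ℕ => clamp n a) atTop (𝓝 a) :=
  tendsto_const_nhds.congr' ((clamp_eventually_eq a).mono fun _ h => h.symm)

/-- The means of the truncations of a Lipschitz function stay bounded under a logarithmic Sobolev
inequality, since the function is bounded on a set of mass at least `1 / 2` and
the truncations concentrate around their means. -/
lemma LSI.exists_abs_integral_clamp_le (h : LSI ν ρ) (hρ : 0 < ρ) (hL : 0 ≤ L)
    (hg : ∀ x y, |g x - g y| ≤ L * ‖x - y‖) :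
    ∃ m₀ : ℝ, ∀ n : ℕ, |∫ x, clamp n (g x) ∂ν| ≤ m₀ := by
  have hcont : Continuous g := (lipschitzWith_of_abs_sub_le hL hg).continuous
  set k : ℝ := L ^ 2 / (2 * ρ)
  obtain ⟨n₀, hn₀⟩ : ∃ n₀ : ℕ, 1 / 2 ≤ ν.real {x | |g x| ≤ n₀} := by
    have hmono : Monotone fun n : ℕ => {x | |g x| ≤ n} := fun a b hab x hx => by
      have : (a : ℝ) ≤ b := by exact_mod_cast hab
      exact le_trans hx this
    have hU : ⋃ n : ℕ, {x | |g x| ≤ n} = univ := eq_univ_of_forall fun x => by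
      obtain ⟨n, hn⟩ := exists_nat_ge |g x|
      exact mem_iUnion.2 ⟨n, hn⟩
    have := tendsto_measure_iUnion_atTop (μ := ν) hmono
    rw [hU, measure_univ] at this
    have h2 := (ENNReal.tendsto_toReal ENNReal.one_ne_top).comp this
    have h3 := h2.eventually (lt_mem_nhds (show (1 / 2 : ℝ) < (1 : ℝ≥0∞).toReal by norm_num))
    obtain ⟨n, hn⟩ := h3.exists
    exact ⟨n, le_of_lt hn⟩
  refine ⟨n₀ + Real.log (4 * Real.exp k), fun n => ?_⟩
  have hlip : ∀ x y, |clamp n (g x) - clamp n (g y)| ≤ L * ‖x - y‖ := fun x y =>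
    (abs_clamp_sub_le n _ _).trans (hg x y)
  have hc : Continuous fun x => clamp n (g x) := (lipschitzWith_of_abs_sub_le hL hlip).continuous
  have hB : ∀ x, |clamp n (g x)| ≤ n := fun x => abs_clamp_le n _
  set m : ℝ := ∫ x, clamp n (g x) ∂ν
  have hexp : ∀ s : ℝ, ∫ x, Real.exp (s * (clamp n (g x) - m)) ∂ν ≤ Real.exp (s ^ 2 * k) := by
    intro s
    have h1 := h.integral_exp_le_of_bounded hρ hL hlip hB s
    have h2 : ∀ x, Real.exp (s * (clamp n (g x) - m)) =
        Real.exp (-(s * m)) * Real.exp (s * clamp n (g x)) := fun x => by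
      rw [← Real.exp_add]; ring_nf
    simp_rw [h2]
    rw [integral_const_mul]
    calc _ ≤ Real.exp (-(s * m)) * Real.exp (s * m + s ^ 2 * k) :=
          mul_le_mul_of_nonneg_left h1 (Real.exp_pos _).le
      _ = _ := by rw [← Real.exp_add]; ring_nf
  have hi : ∀ s : ℝ, Integrable (fun x => Real.exp (s * (clamp n (g x) - m))) ν := fun s =>
    integrable_exp_mul_of_bounded (B := n + |m|) (hc.sub continuous_const).aestronglyMeasurable
      (fun x => (abs_sub _ _).trans (add_le_add (hB x) le_rfl)) s
  have hS : MeasurableSet {x | |g x| ≤ n₀} :=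
    (isClosed_le hcont.abs continuous_const).measurableSet
  have h1 : 1 / 2 * Real.exp (|m| - n₀) ≤ 2 * Real.exp k := by
    calc 1 / 2 * Real.exp (|m| - n₀) ≤ ν.real {x | |g x| ≤ n₀} * Real.exp (|m| - n₀) :=
          mul_le_mul_of_nonneg_right hn₀ (Real.exp_pos _).le
      _ = ∫ x in {x | |g x| ≤ n₀}, Real.exp (|m| - n₀) ∂ν := by simp
      _ ≤ ∫ x in {x | |g x| ≤ n₀}, (Real.exp (1 * (clamp n (g x) - m)) +
            Real.exp (-1 * (clamp n (g x) - m))) ∂ν := by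
          refine setIntegral_mono_on (integrableOn_const (by simp)) ?_ hS fun x hx => ?_
          · exact ((hi 1).add (hi (-1))).integrableOn
          · have h3 : |clamp n (g x)| ≤ n₀ := (abs_clamp_le_abs _ _).trans hx
            have h4 : |m| - n₀ ≤ |clamp n (g x) - m| := by
              have := abs_sub_abs_le_abs_sub m (clamp n (g x))
              rw [abs_sub_comm] at this
              linarith
            have h5 := Real.exp_pos (1 * (clamp n (g x) - m))
            have h6 := Real.exp_pos (-1 * (clamp n (g x) - m))
            have h7 := Real.exp_le_exp.2 h4
            rcases abs_cases (clamp n (g x) - m) with ⟨h8, -⟩ | ⟨h8, -⟩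
            · rw [h8] at h7; rw [one_mul]; linarith
            · rw [h8] at h7; rw [neg_one_mul]; linarith
      _ ≤ ∫ x, (Real.exp (1 * (clamp n (g x) - m)) +
            Real.exp (-1 * (clamp n (g x) - m))) ∂ν :=
          setIntegral_le_integral ((hi 1).add (hi (-1))) (ae_of_all _ fun x => by positivity)
      _ ≤ 2 * Real.exp k := by
          rw [integral_add (hi 1) (hi (-1))]
          have h2 := hexp 1
          have h3 := hexp (-1)
          norm_num at h2 h3 ⊢
          linarith
  have h2 : |m| - n₀ ≤ Real.log (4 * Real.exp k) := by
    rw [Real.le_log_iff_exp_le (by positivity)]; linarith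
  linarith

lemma LSI.integrable_exp_mul (h : LSI ν ρ) (hρ : 0 < ρ) (hL : 0 ≤ L)
    (hg : ∀ x y, |g x - g y| ≤ L * ‖x - y‖) (s : ℝ) :
    Integrable (fun x => Real.exp (s * g x)) ν := by
  have hcont : Continuous g := (lipschitzWith_of_abs_sub_le hL hg).continuous
  obtain ⟨m₀, hm₀⟩ := h.exists_abs_integral_clamp_le hρ hL hg
  set k : ℝ := L ^ 2 / (2 * ρ)
  refine ⟨by fun_prop, ?_⟩
  rw [hasFiniteIntegral_iff_ofReal (ae_of_all _ fun x => (Real.exp_pos _).le)]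
  have hlip : ∀ n : ℕ, ∀ x y, |clamp n (g x) - clamp n (g y)| ≤ L * ‖x - y‖ := fun n x y =>
    (abs_clamp_sub_le n _ _).trans (hg x y)
  have hc : ∀ n : ℕ, Continuous fun x => clamp n (g x) := fun n =>
    (lipschitzWith_of_abs_sub_le hL (hlip n)).continuous
  have hbd : ∀ n : ℕ, ∫⁻ x, ENNReal.ofReal (Real.exp (s * clamp n (g x))) ∂ν ≤
      ENNReal.ofReal (Real.exp (|s| * m₀ + s ^ 2 * k)) := fun n => by
    rw [← ofReal_integral_eq_lintegral_ofReal (integrable_exp_mul_of_bounded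
      (hc n).aestronglyMeasurable (fun x => abs_clamp_le n _) s)
      (ae_of_all _ fun x => (Real.exp_pos _).le)]
    refine ENNReal.ofReal_le_ofReal ((h.integral_exp_le_of_bounded hρ hL (hlip n)
      (fun x => abs_clamp_le n _) s).trans (Real.exp_le_exp.2 ?_))
    refine add_le_add ((le_abs_self _).trans ?_) le_rfl
    rw [abs_mul]
    exact mul_le_mul_of_nonneg_left (hm₀ n) (abs_nonneg _)
  calc ∫⁻ x, ENNReal.ofReal (Real.exp (s * g x)) ∂ν
      = ∫⁻ x, liminf (fun n : ℕ => ENNReal.ofReal (Real.exp (s * clamp n (g x)))) atTop ∂ν := by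
        refine lintegral_congr fun x => ?_
        refine (Tendsto.liminf_eq ?_).symm
        have : Continuous fun a : ℝ => ENNReal.ofReal (Real.exp (s * a)) :=
          ENNReal.continuous_ofReal.comp (by fun_prop)
        exact (this.tendsto _).comp (tendsto_clamp (g x))
    _ ≤ liminf (fun n : ℕ => ∫⁻ x, ENNReal.ofReal (Real.exp (s * clamp n (g x))) ∂ν) atTop :=
        lintegral_liminf_le fun n => by
          have := (hc n).measurable
          fun_prop
    _ ≤ ENNReal.ofReal (Real.exp (|s| * m₀ + s ^ 2 * k)) := by
        refine (liminf_le_liminf (Eventually.of_forall hbd)).trans ?_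
        simp
    _ < ∞ := ENNReal.ofReal_lt_top

lemma integrable_of_integrable_exp {Ω : Type*} [MeasurableSpace Ω] {ν : Measure Ω} {g : Ω → ℝ}
    (hm : AEStronglyMeasurable g ν)
    (h : ∀ s : ℝ, Integrable (fun x => Real.exp (s * g x)) ν) : Integrable g ν := by
  refine ((h 1).add (h (-1))).mono' hm (ae_of_all _ fun x => ?_)
  have h1 := Real.add_one_le_exp (1 * g x)
  have h2 := Real.add_one_le_exp (-1 * g x)
  have h3 := Real.exp_pos (1 * g x)
  have h4 := Real.exp_pos (-1 * g x)
  rw [Real.norm_eq_abs, abs_le, Pi.add_apply]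
  constructor <;> linarith

lemma LSI.integrable (h : LSI ν ρ) (hρ : 0 < ρ) (hL : 0 ≤ L)
    (hg : ∀ x y, |g x - g y| ≤ L * ‖x - y‖) : Integrable g ν :=
  integrable_of_integrable_exp
    (lipschitzWith_of_abs_sub_le hL hg).continuous.aestronglyMeasurable
    (h.integrable_exp_mul hρ hL hg)

/-- Herbst's argument: Gaussian concentration of Lipschitz functions. -/
lemma LSI.lintegral_exp_le (h : LSI ν ρ) (hρ : 0 < ρ) (hL : 0 ≤ L)
    (hg : ∀ x y, |g x - g y| ≤ L * ‖x - y‖) (s : ℝ) :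
    ∫⁻ x, ENNReal.ofReal (Real.exp (s * g x)) ∂ν ≤
      ENNReal.ofReal (Real.exp (s * ∫ x, g x ∂ν + s ^ 2 * (L ^ 2 / (2 * ρ)))) := by
  have hcont : Continuous g := (lipschitzWith_of_abs_sub_le hL hg).continuous
  have hlip : ∀ n : ℕ, ∀ x y, |clamp n (g x) - clamp n (g y)| ≤ L * ‖x - y‖ := fun n x y =>
    (abs_clamp_sub_le n _ _).trans (hg x y)
  have hc : ∀ n : ℕ, Continuous fun x => clamp n (g x) := fun n =>
    (lipschitzWith_of_abs_sub_le hL (hlip n)).continuous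
  have hmean : Tendsto (fun n : ℕ => ∫ x, clamp n (g x) ∂ν) atTop (𝓝 (∫ x, g x ∂ν)) :=
    tendsto_integral_of_dominated_convergence (fun x => |g x|)
      (fun n => (hc n).aestronglyMeasurable) (h.integrable hρ hL hg).abs
      (fun n => ae_of_all _ fun x => abs_clamp_le_abs n _)
      (ae_of_all _ fun x => tendsto_clamp (g x))
  calc ∫⁻ x, ENNReal.ofReal (Real.exp (s * g x)) ∂ν
      = ∫⁻ x, liminf (fun n : ℕ => ENNReal.ofReal (Real.exp (s * clamp n (g x)))) atTop ∂ν := by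
        refine lintegral_congr fun x => ?_
        refine (Tendsto.liminf_eq ?_).symm
        have : Continuous fun a : ℝ => ENNReal.ofReal (Real.exp (s * a)) :=
          ENNReal.continuous_ofReal.comp (by fun_prop)
        exact (this.tendsto _).comp (tendsto_clamp (g x))
    _ ≤ liminf (fun n : ℕ => ∫⁻ x, ENNReal.ofReal (Real.exp (s * clamp n (g x))) ∂ν) atTop :=
        lintegral_liminf_le fun n => by
          have := (hc n).measurable
          fun_prop
    _ ≤ liminf (fun n : ℕ => ENNReal.ofReal
          (Real.exp (s * ∫ x, clamp n (g x) ∂ν + s ^ 2 * (L ^ 2 / (2 * ρ))))) atTop := by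
        refine liminf_le_liminf (Eventually.of_forall fun n => ?_)
        rw [← ofReal_integral_eq_lintegral_ofReal (integrable_exp_mul_of_bounded
          (hc n).aestronglyMeasurable (fun x => abs_clamp_le n _) s)
          (ae_of_all _ fun x => (Real.exp_pos _).le)]
        exact ENNReal.ofReal_le_ofReal (h.integral_exp_le_of_bounded hρ hL (hlip n)
          (fun x => abs_clamp_le n _) s)
    _ = _ := by
        refine Tendsto.liminf_eq ?_
        have : Continuous fun a : ℝ => ENNReal.ofReal
          (Real.exp (s * a + s ^ 2 * (L ^ 2 / (2 * ρ)))) :=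
          ENNReal.continuous_ofReal.comp (by fun_prop)
        exact (this.tendsto _).comp hmean

/-- The square of a Gaussian-concentrated variable is exponentially integrable. The bound comes from
writing `exp (a g²)` as a Gaussian average of the exponentials `exp (2 √a ξ g)`. -/
lemma LSI.lintegral_exp_sq_le (h : LSI ν ρ) (hρ : 0 < ρ) (hL : 0 < L)
    (hg : ∀ x y, |g x - g y| ≤ L * ‖x - y‖) (hmean : ∫ x, g x ∂ν = 0) :
    ∫⁻ x, ENNReal.ofReal (Real.exp (ρ / (4 * L ^ 2) * g x ^ 2)) ∂ν ≤ ENNReal.ofReal (√2) := by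
  have hcont : Continuous g := (lipschitzWith_of_abs_sub_le hL.le hg).continuous
  set a : ℝ := ρ / (4 * L ^ 2) with ha
  have ha0 : 0 ≤ a := by positivity
  have hgauss : ∀ x, ∫⁻ ξ : ℝ, ENNReal.ofReal (Real.exp (-ξ ^ 2) *
      Real.exp (2 * √a * ξ * g x)) = ENNReal.ofReal (√Real.pi) *
        ENNReal.ofReal (Real.exp (a * g x ^ 2)) := fun x => by
    have h1 : ∀ ξ : ℝ, Real.exp (-ξ ^ 2) * Real.exp (2 * √a * ξ * g x) =
        Real.exp (a * g x ^ 2) * Real.exp (-1 * (ξ - √a * g x) ^ 2) := fun ξ => by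
      rw [← Real.exp_add, ← Real.exp_add]
      congr 1
      have := Real.sq_sqrt ha0
      linear_combination (g x) ^ 2 * this
    have hint : Integrable fun ξ : ℝ => Real.exp (-1 * (ξ - √a * g x) ^ 2) :=
      (integrable_exp_neg_mul_sq one_pos).comp_sub_right (√a * g x)
    simp_rw [h1]
    rw [← ofReal_integral_eq_lintegral_ofReal (hint.const_mul _)
      (ae_of_all _ fun ξ => by positivity), integral_const_mul,
      integral_sub_right_eq_self (fun ξ : ℝ => Real.exp (-1 * ξ ^ 2)), integral_gaussian, div_one,
      ENNReal.ofReal_mul (Real.exp_pos _).le, mul_comm]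
  have hpi : (0 : ℝ) < √Real.pi := Real.sqrt_pos.2 Real.pi_pos
  have key : ENNReal.ofReal (√Real.pi) * ∫⁻ x, ENNReal.ofReal (Real.exp (a * g x ^ 2)) ∂ν ≤
      ENNReal.ofReal (√Real.pi) * ENNReal.ofReal (√2) := by
    calc _ = ∫⁻ x, (∫⁻ ξ : ℝ, ENNReal.ofReal (Real.exp (-ξ ^ 2) *
          Real.exp (2 * √a * ξ * g x))) ∂ν := by
          rw [← lintegral_const_mul _ (by fun_prop)]
          exact lintegral_congr fun x => (hgauss x).symm
      _ = ∫⁻ ξ : ℝ, ∫⁻ x, ENNReal.ofReal (Real.exp (-ξ ^ 2) *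
          Real.exp (2 * √a * ξ * g x)) ∂ν := by
          refine lintegral_lintegral_swap (Measurable.aemeasurable ?_)
          have hm := hcont.measurable
          unfold Function.uncurry
          fun_prop
      _ ≤ ∫⁻ ξ : ℝ, ENNReal.ofReal (Real.exp (-(1 / 2) * ξ ^ 2)) := by
          refine lintegral_mono fun ξ => ?_
          have h1 := h.lintegral_exp_le hρ hL.le hg (2 * √a * ξ)
          simp_rw [ENNReal.ofReal_mul (Real.exp_pos (-ξ ^ 2)).le]
          rw [lintegral_const_mul _ (by fun_prop)]
          refine (mul_le_mul_right h1 _).trans (le_of_eq ?_)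
          rw [← ENNReal.ofReal_mul (Real.exp_pos _).le, ← Real.exp_add, hmean, mul_pow, mul_pow,
            Real.sq_sqrt ha0, ha]
          congr 2
          field_simp
          ring
      _ = ENNReal.ofReal (√Real.pi) * ENNReal.ofReal (√2) := by
          rw [← ofReal_integral_eq_lintegral_ofReal
            (integrable_exp_neg_mul_sq (by norm_num : (0 : ℝ) < 1 / 2))
            (ae_of_all _ fun ξ => by positivity), integral_gaussian,
            ← ENNReal.ofReal_mul hpi.le, ← Real.sqrt_mul Real.pi_pos.le]
          congr 2
          ring
  exact (ENNReal.mul_le_mul_iff_right (by simpa using hpi) ENNReal.ofReal_ne_top).1 key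

/-- The second moment of a centred Lipschitz function under a density `h` is controlled by the
Fisher information of `h`; this combines the duality between entropy and exponential integrals
with the Gaussian concentration of the function. -/
lemma LSI.lintegral_sq_mul_le (h : LSI ν ρ) (hρ : 0 < ρ) (hL : 0 < L)
    (hg : ∀ x y, |g x - g y| ≤ L * ‖x - y‖) (hmean : ∫ x, g x ∂ν = 0)
    {u : E → ℝ} (hu : LocallyLipschitz u) (hu0 : ∀ x, 0 ≤ u x) :
    ∫⁻ x, ENNReal.ofReal (g x ^ 2 * u x) ∂ν ≤ ENNReal.ofReal (4 * L ^ 2 / ρ) *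
      (ENNReal.ofReal (1 / (2 * ρ)) * fisherInfo ν u + ∫⁻ x, ENNReal.ofReal (u x) ∂ν) := by
  have hcont : Continuous g := (lipschitzWith_of_abs_sub_le hL.le hg).continuous
  have hpos : 0 < 4 * L ^ 2 / ρ := by positivity
  have hpos2 : 0 < 1 / (2 * ρ) := by positivity
  by_cases hfish : fisherInfo ν u = ∞
  · rw [hfish, ENNReal.mul_top (by simpa using hpos2), top_add,
      ENNReal.mul_top (by simpa using hpos)]
    exact le_top
  by_cases hfin : ∫⁻ x, ENNReal.ofReal (u x) ∂ν = ∞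
  · rw [hfin, add_top, ENNReal.mul_top (by simpa using hpos)]
    exact le_top
  have hui : Integrable u ν := by
    refine ⟨hu.continuous.aestronglyMeasurable, ?_⟩
    rw [hasFiniteIntegral_iff_ofReal (ae_of_all _ hu0)]
    exact lt_top_iff_ne_top.2 hfin
  obtain ⟨hPhi, hent⟩ := h u hu hu0 hui hfish
  set m : ℝ := ∫ x, u x ∂ν with hm
  have hm0 : 0 ≤ m := integral_nonneg hu0
  rcases hm0.eq_or_lt with hm0 | hm0
  · have h1 : u =ᵐ[ν] 0 := (integral_eq_zero_iff_of_nonneg hu0 hui).1 hm0.symm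
    have h2 : ∫⁻ x, ENNReal.ofReal (g x ^ 2 * u x) ∂ν = 0 := by
      rw [lintegral_eq_zero_iff' (by
        have := hu.continuous
        exact (by fun_prop : Measurable _).aemeasurable)]
      filter_upwards [h1] with x hx
      simp [hx]
    rw [h2]; exact zero_le
  set a : ℝ := ρ / (4 * L ^ 2) with ha
  have ha0 : 0 < a := by positivity
  have hexp := h.lintegral_exp_sq_le hρ hL hg hmean
  have hexpi : Integrable (fun x => Real.exp (a * g x ^ 2)) ν := by
    refine ⟨by fun_prop, ?_⟩
    rw [hasFiniteIntegral_iff_ofReal (ae_of_all _ fun x => (Real.exp_pos _).le)]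
    exact hexp.trans_lt ENNReal.ofReal_lt_top
  have hexp' : ∫ x, Real.exp (a * g x ^ 2) ∂ν ≤ √2 := by
    rw [← ofReal_integral_eq_lintegral_ofReal hexpi (ae_of_all _ fun x => (Real.exp_pos _).le)]
      at hexp
    exact (ENNReal.ofReal_le_ofReal_iff (Real.sqrt_nonneg _)).1 hexp
  -- `R` is the right-hand side of Young's inequality `u φ ≤ u log (u / m) - u + m exp φ` for
  -- `φ = a g²`; its integral is bounded by the entropy of `u` and by `m`.
  set R : E → ℝ := fun x => Phi (u x) - Real.log m * u x - u x + m * Real.exp (a * g x ^ 2)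
  have hRi : Integrable R ν :=
    ((hPhi.sub (hui.const_mul _)).sub hui).add (hexpi.const_mul m)
  have hpt : ∀ x, a * (g x ^ 2 * u x) ≤ R x := fun x => by
    rcases (hu0 x).eq_or_lt with hx | hx
    · simp only [R, ← hx, Phi]
      have := Real.exp_pos (a * g x ^ 2)
      simp only [mul_zero, zero_mul, sub_zero, zero_add]
      positivity
    · have h1 := Real.add_one_le_exp (a * g x ^ 2 - Real.log (u x) + Real.log m)
      rw [Real.exp_add, Real.exp_log hm0, Real.exp_sub, Real.exp_log hx] at h1
      have h2 := mul_le_mul_of_nonneg_left h1 hx.le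
      have h3 : u x * (Real.exp (a * g x ^ 2) / u x * m) = m * Real.exp (a * g x ^ 2) := by
        field_simp
      rw [h3] at h2
      simp only [R, Phi]
      linarith
  have hR0 : ∀ x, 0 ≤ R x := fun x =>
    le_trans (mul_nonneg ha0.le (mul_nonneg (sq_nonneg _) (hu0 x))) (hpt x)
  have hRint : ∫ x, R x ∂ν ≤ 1 / (2 * ρ) * (fisherInfo ν u).toReal + m := by
    have h1 : ∫ x, R x ∂ν = ∫ x, Phi (u x) ∂ν - Real.log m * m - m +
        m * ∫ x, Real.exp (a * g x ^ 2) ∂ν := by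
      have h2 := integral_add ((hPhi.sub (hui.const_mul (Real.log m))).sub hui)
        (hexpi.const_mul m)
      have h3 := integral_sub (hPhi.sub (hui.const_mul (Real.log m))) hui
      have h4 := integral_sub hPhi (hui.const_mul (Real.log m))
      rw [integral_const_mul] at h2 h4
      simp only [Pi.sub_apply] at h2 h3
      rw [h3, h4] at h2
      exact h2
    have h2 : √2 ≤ 2 := by
      rw [Real.sqrt_le_left (by norm_num)]; norm_num
    have h3 : m * ∫ x, Real.exp (a * g x ^ 2) ∂ν ≤ m * 2 :=
      mul_le_mul_of_nonneg_left (hexp'.trans h2) hm0.le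
    simp only [Phi] at hent
    rw [h1]
    simp only [Phi]
    linarith
  have hainv : (4 * L ^ 2 / ρ) * a = 1 := by rw [ha]; field_simp
  calc ∫⁻ x, ENNReal.ofReal (g x ^ 2 * u x) ∂ν
      ≤ ∫⁻ x, ENNReal.ofReal (4 * L ^ 2 / ρ) * ENNReal.ofReal (R x) ∂ν := by
        refine lintegral_mono fun x => ?_
        rw [← ENNReal.ofReal_mul hpos.le]
        refine ENNReal.ofReal_le_ofReal ?_
        have h1 := mul_le_mul_of_nonneg_left (hpt x) hpos.le
        rwa [← mul_assoc, hainv, one_mul] at h1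
    _ = ENNReal.ofReal (4 * L ^ 2 / ρ) * ENNReal.ofReal (∫ x, R x ∂ν) := by
        rw [lintegral_const_mul' _ _ ENNReal.ofReal_ne_top,
          ofReal_integral_eq_lintegral_ofReal hRi (ae_of_all _ hR0)]
    _ ≤ ENNReal.ofReal (4 * L ^ 2 / ρ) *
          ENNReal.ofReal (1 / (2 * ρ) * (fisherInfo ν u).toReal + m) :=
        mul_le_mul_right (ENNReal.ofReal_le_ofReal hRint) _
    _ = _ := by
        rw [ENNReal.ofReal_add (by positivity) hm0.le, ENNReal.ofReal_mul hpos2.le,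
          ENNReal.ofReal_toReal hfish, hm,
          ofReal_integral_eq_lintegral_ofReal hui (ae_of_all _ hu0)]

end Concentration

/-! ### Linear algebra of the coarse-graining operator -/

/-- Young's inequality in the form used to absorb the terms that carry a factor `1 / M`. -/
lemma mul_le_half_add {δ a b a2 b2 : ℝ} (hδ : 0 ≤ δ) (h1 : a ^ 2 ≤ a2)
    (h2 : b ^ 2 ≤ b2) : δ * (a * b) ≤ δ / 2 * (a2 + b2) := by
  have h3 : a * b ≤ 1 / 2 * (a2 + b2) := by nlinarith [sq_nonneg (a - b)]
  calc _ ≤ δ * (1 / 2 * (a2 + b2)) := mul_le_mul_of_nonneg_left h3 hδ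
    _ = _ := by ring

section Algebra

variable {X Y : Type*}
  [NormedAddCommGroup X] [InnerProductSpace ℝ X] [FiniteDimensional ℝ X]
  [MeasurableSpace X] [BorelSpace X]
  [NormedAddCommGroup Y] [InnerProductSpace ℝ Y] [FiniteDimensional ℝ Y]
  [MeasurableSpace Y] [BorelSpace Y]
  {N M : ℕ} {P : X →ₗ[ℝ] Y} {A J : X →ₗ[ℝ] X} {H : X → ℝ} {Hbar : Y → ℝ}
  {f : ℝ → X → ℝ} {η : ℝ → Y} {κ ρ lam Lam α β γ C₁ C₂ c : ℝ}

lemma inner_lift (N : ℕ) (P : X →ₗ[ℝ] Y) (y : Y) (x : X) :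
    inner ℝ (lift N P y) x = N * inner ℝ y (P x) := by
  simp [lift, inner_smul_left, LinearMap.adjoint_inner_left]

lemma inner_lift_right (N : ℕ) (P : X →ₗ[ℝ] Y) (x : X) (y : Y) :
    inner ℝ x (lift N P y) = N * inner ℝ (P x) y := by
  rw [real_inner_comm, inner_lift, real_inner_comm]

/-- The inverse `P A⁻¹ N Pᵗ` of `Ā`. -/
noncomputable def macroAInv (N : ℕ) (P : X →ₗ[ℝ] Y) (A : X →ₗ[ℝ] X) : Y →ₗ[ℝ] Y :=
  P ∘ₗ opInv A ∘ₗ lift N P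

lemma inner_macroAInv_mul (y z : Y) :
    N * inner ℝ (macroAInv N P A y) z = inner ℝ (opInv A (lift N P y)) (lift N P z) := by
  rw [inner_lift_right]; rfl

lemma Assumptions.mono (hs : IsSystem N M P A J H Hbar f η)
    (ha : Assumptions N M P A J H Hbar f η κ ρ lam Lam α β γ C₁ C₂ c)
    {κ' c' : ℝ} (hκ : κ ≤ κ') (hc : c ≤ c') :
    Assumptions N M P A J H Hbar f η κ' ρ lam Lam α β γ C₁ C₂ c' where
  i x u v hu hv h1 h2 := (ha.i x u v hu hv h1 h2).trans hκ
  ii := ha.ii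
  iii := ha.iii
  iv := ha.iv
  v := ha.v
  vi := ha.vi
  vii_micro := ha.vii_micro
  vii_macro := ha.vii_macro
  viii := ha.viii
  ix x := (ha.ix x).trans (mul_le_mul_of_nonneg_right hc (by
    rcases eq_or_ne x 0 with rfl | hx
    · simp
    · exact (hs.A_pos x hx).le))
  x := ha.x

namespace IsSystem

variable (hs : IsSystem N M P A J H Hbar f η)
include hs

lemma N_pos' : (0 : ℝ) < N := by exact_mod_cast hs.N_pos

lemma P_lift (y : Y) : P (lift N P y) = y := hs.coarse y

lemma norm_lift_sq (y : Y) : ‖lift N P y‖ ^ 2 = N * ‖y‖ ^ 2 := by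
  rw [← real_inner_self_eq_norm_sq, inner_lift, hs.P_lift, real_inner_self_eq_norm_sq]

lemma norm_lift (y : Y) : ‖lift N P y‖ = √N * ‖y‖ := by
  rw [← Real.sqrt_sq (norm_nonneg (lift N P y)), hs.norm_lift_sq,
    Real.sqrt_mul hs.N_pos'.le, Real.sqrt_sq (norm_nonneg _)]

lemma norm_P_sq_le (x : X) : N * ‖P x‖ ^ 2 ≤ ‖x‖ ^ 2 := by
  have h1 := real_inner_le_norm (lift N P (P x)) x
  rw [inner_lift, real_inner_self_eq_norm_sq] at h1
  have h2 := hs.norm_lift_sq (P x)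
  nlinarith [sq_nonneg (‖lift N P (P x)‖ - ‖x‖)]

lemma inner_perp_left (x z : X) :
    inner ℝ (x - lift N P (P x)) z = inner ℝ x (z - lift N P (P z)) := by
  rw [inner_sub_left, inner_sub_right, inner_lift, inner_lift_right]

lemma P_perp (x : X) : P (x - lift N P (P x)) = 0 := by
  rw [map_sub, hs.P_lift, sub_self]

lemma norm_perp_le (x : X) : ‖x - lift N P (P x)‖ ≤ ‖x‖ := by
  have h1 : ‖x - lift N P (P x)‖ ^ 2 = inner ℝ (x - lift N P (P x)) x := by
    rw [← real_inner_self_eq_norm_sq, hs.inner_perp_left, hs.P_perp, map_zero, sub_zero,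
      ← hs.inner_perp_left]
  have h2 := real_inner_le_norm (x - lift N P (P x)) x
  rw [← h1] at h2
  by_contra! h3
  nlinarith [norm_nonneg x]

lemma finrank_Y_le : (Module.finrank ℝ Y : ℝ) ≤ M := by exact_mod_cast hs.finrank_Y

lemma inner_A_nonneg (x : X) : 0 ≤ inner ℝ (A x) x := by
  rcases eq_or_ne x 0 with rfl | hx
  · simp
  · exact (hs.A_pos x hx).le

lemma isUnit_A : IsUnit (A : Module.End ℝ X) := by
  rw [Module.End.isUnit_iff]
  have hinj : Function.Injective A := by
    rw [injective_iff_map_eq_zero]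
    intro x hx
    by_contra hne
    have := hs.A_pos x hne
    rw [hx, inner_zero_left] at this
    exact lt_irrefl _ this
  exact ⟨hinj, LinearMap.injective_iff_surjective.1 hinj⟩

lemma A_opInv (x : X) : A (opInv A x) = x :=
  LinearMap.congr_fun (Ring.mul_inverse_cancel (M₀ := Module.End ℝ X) A hs.isUnit_A) x

lemma opInv_A (x : X) : opInv A (A x) = x :=
  LinearMap.congr_fun (Ring.inverse_mul_cancel (M₀ := Module.End ℝ X) A hs.isUnit_A) x

lemma inner_opInv_comm (x z : X) : inner ℝ (opInv A x) z = inner ℝ x (opInv A z) := by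
  conv_lhs => rw [← hs.A_opInv z]
  rw [← hs.A_symm, hs.A_opInv]

lemma inner_opInv_nonneg (x : X) : 0 ≤ inner ℝ x (opInv A x) := by
  have := hs.inner_A_nonneg (opInv A x)
  rwa [hs.A_opInv] at this

lemma inner_opInv_sq_le (x z : X) :
    inner ℝ x (opInv A z) ^ 2 ≤ inner ℝ x (opInv A x) * inner ℝ z (opInv A z) := by
  have h := LinearMap.BilinForm.apply_mul_apply_le_of_forall_zero_le
    ((innerₗ X).compl₂ (opInv A)) (fun x => by simpa using hs.inner_opInv_nonneg x) x z
  simp only [LinearMap.compl₂_apply, innerₗ_apply_apply] at h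
  rw [sq]
  have e : inner ℝ z (opInv A x) = inner ℝ x (opInv A z) := by
    rw [← hs.inner_opInv_comm z x, real_inner_comm]
  rwa [e] at h

lemma inner_opInv_le (x z : X) :
    |inner ℝ x (opInv A z)| ≤ √(inner ℝ x (opInv A x)) * √(inner ℝ z (opInv A z)) := by
  rw [← Real.sqrt_mul (hs.inner_opInv_nonneg x)]
  exact Real.abs_le_sqrt (hs.inner_opInv_sq_le x z)

variable (ha : Assumptions N M P A J H Hbar f η κ ρ lam Lam α β γ C₁ C₂ c)
include ha

lemma J_opInv (x : X) : J (opInv A x) = opInv A (J x) := by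
  have h := LinearMap.congr_fun ha.x (opInv A x)
  simp only [LinearMap.comp_apply, hs.A_opInv] at h
  rw [h, hs.opInv_A]

/-- The operator `J A⁻¹` is antisymmetric because `J` and `A` commute. -/
lemma inner_J_opInv (x z : X) : inner ℝ (J (opInv A x)) z = -inner ℝ x (J (opInv A z)) := by
  rw [hs.J_antisymm, hs.inner_opInv_comm, hs.J_opInv ha]

lemma norm_perp_le_sqrt (hγ : 0 ≤ γ) (x : X) :
    ‖x - lift N P (P x)‖ ≤ √γ / M * √(inner ℝ x (A x)) := by
  have h := Real.sqrt_le_sqrt (ha.vi x)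
  rwa [Real.sqrt_sq (norm_nonneg _), Real.sqrt_mul (by positivity), Real.sqrt_div hγ,
    Real.sqrt_sq (by positivity)] at h

/-- The dual form of the smallness of the fluctuations `x - N Pᵗ P x`. -/
lemma sqrt_inner_perp_le (hγ : 0 ≤ γ) (x : X) :
    √(inner ℝ (x - lift N P (P x)) (opInv A (x - lift N P (P x)))) ≤ √γ / M * ‖x‖ := by
  set q := x - lift N P (P x) with hq
  set r := √(inner ℝ q (opInv A q)) with hr
  have h0 := hs.inner_opInv_nonneg q
  have h1 : r ^ 2 ≤ ‖x‖ * (√γ / M * r) := by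
    rw [hr, Real.sq_sqrt h0]
    calc inner ℝ q (opInv A q) = inner ℝ x (opInv A q - lift N P (P (opInv A q))) := by
          conv_lhs => rw [hq]
          rw [hs.inner_perp_left]
      _ ≤ ‖x‖ * ‖opInv A q - lift N P (P (opInv A q))‖ := real_inner_le_norm _ _
      _ ≤ ‖x‖ * (√γ / M * √(inner ℝ (opInv A q) (A (opInv A q)))) :=
          mul_le_mul_of_nonneg_left (hs.norm_perp_le_sqrt ha hγ _) (norm_nonneg _)
      _ = _ := by rw [hs.A_opInv, real_inner_comm]
  have h2 : 0 ≤ r := Real.sqrt_nonneg _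
  by_contra! h3
  have h4 : 0 ≤ √γ / M * ‖x‖ := by positivity
  nlinarith

lemma norm_J_opInv_le (hc : 0 ≤ c) (z : X) :
    ‖J (opInv A z)‖ ≤ √c * √(inner ℝ z (opInv A z)) := by
  rw [← Real.sqrt_mul hc]
  refine Real.le_sqrt_of_sq_le ?_
  have h1 := ha.ix (opInv A z)
  rw [hs.A_opInv, inner_neg_left, hs.J_antisymm, neg_neg, real_inner_self_eq_norm_sq] at h1
  exact h1

lemma sqrt_inner_J_le (hc : 0 ≤ c) (v : X) :
    √(inner ℝ (J v) (opInv A (J v))) ≤ √c * ‖v‖ := by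
  set r := √(inner ℝ (J v) (opInv A (J v))) with hr
  have h1 : r ^ 2 ≤ ‖v‖ * (√c * r) := by
    rw [hr, Real.sq_sqrt (hs.inner_opInv_nonneg _)]
    calc inner ℝ (J v) (opInv A (J v)) = -inner ℝ v (J (opInv A (J v))) := hs.J_antisymm _ _
      _ ≤ ‖v‖ * ‖J (opInv A (J v))‖ :=
          (neg_le_abs _).trans (abs_real_inner_le_norm _ _)
      _ ≤ _ := mul_le_mul_of_nonneg_left (hs.norm_J_opInv_le ha hc _) (norm_nonneg _)
  have h2 : 0 ≤ r := Real.sqrt_nonneg _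
  by_contra! h3
  have h4 : 0 ≤ √c * ‖v‖ := by positivity
  nlinarith

omit ha

lemma inner_macroAInv_eq (y : Y) :
    N * inner ℝ y (macroAInv N P A y) = inner ℝ (lift N P y) (opInv A (lift N P y)) := by
  rw [inner_lift]; rfl

lemma inner_macroAInv_nonneg (y : Y) : 0 ≤ inner ℝ y (macroAInv N P A y) := by
  have h1 := hs.inner_macroAInv_eq y
  have h2 := hs.inner_opInv_nonneg (lift N P y)
  rw [← h1] at h2
  exact nonneg_of_mul_nonneg_right h2 hs.N_pos'

lemma macroAInv_comm (y z : Y) :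
    inner ℝ (macroAInv N P A y) z = inner ℝ y (macroAInv N P A z) := by
  have h1 := inner_macroAInv_mul (N := N) (P := P) (A := A) y z
  have h2 : N * inner ℝ y (macroAInv N P A z) =
      inner ℝ (lift N P y) (opInv A (lift N P z)) := by rw [inner_lift]; rfl
  rw [hs.inner_opInv_comm, ← h2] at h1
  exact mul_left_cancel₀ hs.N_pos'.ne' h1

lemma isUnit_macroAInv : IsUnit (macroAInv N P A : Module.End ℝ Y) := by
  rw [Module.End.isUnit_iff]
  have hinj : Function.Injective (macroAInv N P A) := by
    rw [injective_iff_map_eq_zero]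
    intro y hy
    by_contra hne
    have h1 := hs.inner_macroAInv_eq y
    rw [hy, inner_zero_right, mul_zero] at h1
    have h2 : opInv A (lift N P y) ≠ 0 := fun h => hne (by
      rw [← hs.P_lift y, ← hs.A_opInv (lift N P y), h, map_zero, map_zero])
    have h3 := hs.A_pos _ h2
    rw [hs.A_opInv, ← h1] at h3
    exact lt_irrefl _ h3
  exact ⟨hinj, LinearMap.injective_iff_surjective.1 hinj⟩

lemma macroAInv_macroA (y : Y) : macroAInv N P A (macroA N P A y) = y :=
  LinearMap.congr_fun
    (Ring.mul_inverse_cancel (M₀ := Module.End ℝ Y) (macroAInv N P A) hs.isUnit_macroAInv) y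

lemma macroAInv_velocity (g : Y) :
    macroAInv N P A ((macroA N P A + macroJ N P A J) g) =
      g + (N : ℝ) • P (opInv A (J (LinearMap.adjoint P g))) := by
  rw [LinearMap.add_apply, map_add, hs.macroAInv_macroA]
  congr 1
  have : macroJ N P A J g =
      macroA N P A ((N : ℝ) • P (opInv A (J (LinearMap.adjoint P g)))) := by
    simp [macroJ]
  rw [this, hs.macroAInv_macroA]

include ha

lemma macroAInv_velocity' (g : Y) :
    macroAInv N P A ((macroA N P A + macroJ N P A J) g) =
      g + P (J (opInv A (lift N P g))) := by
  rw [hs.macroAInv_velocity, hs.J_opInv ha]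
  simp [lift]

/-- Dissipation of the macroscopic energy: although `J̄` is not antisymmetric, its contribution is
controlled by the gradient. -/
lemma velocity_energy_le (hc : 0 ≤ c) (g : Y) :
    1 / 2 * inner ℝ ((macroA N P A + macroJ N P A J) g)
        (macroAInv N P A ((macroA N P A + macroJ N P A J) g)) ≤
      inner ℝ ((macroA N P A + macroJ N P A J) g) g + c / 2 * ‖g‖ ^ 2 := by
  set w := (macroA N P A + macroJ N P A J) g with hw
  set e := inner ℝ w (macroAInv N P A w) with he
  have he0 : 0 ≤ e := hs.inner_macroAInv_nonneg w
  have h1 : e = inner ℝ w g + inner ℝ (lift N P w) (opInv A (J (LinearMap.adjoint P g))) := by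
    rw [he, hw, hs.macroAInv_velocity, ← hw, inner_add_right, inner_smul_right, inner_lift]
  have h2 := hs.inner_opInv_le (lift N P w) (J (LinearMap.adjoint P g))
  have h3 := hs.sqrt_inner_J_le ha hc (LinearMap.adjoint P g)
  have h4 : ‖lift N P g‖ = N * ‖LinearMap.adjoint P g‖ := by
    simp [lift, norm_smul]
  have h5 : √N * √N = (N : ℝ) := Real.mul_self_sqrt hs.N_pos'.le
  have h6 : √N * ‖LinearMap.adjoint P g‖ = ‖g‖ := by
    rw [hs.norm_lift] at h4
    nth_rewrite 2 [← h5] at h4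
    rw [mul_assoc] at h4
    exact (mul_left_cancel₀ (Real.sqrt_pos.2 hs.N_pos').ne' h4).symm
  rw [← hs.inner_macroAInv_eq, ← he, Real.sqrt_mul hs.N_pos'.le] at h2
  have h7 : √N * √e * √(inner ℝ (J (LinearMap.adjoint P g))
      (opInv A (J (LinearMap.adjoint P g)))) ≤ √e * (√c * ‖g‖) := by
    calc _ ≤ √N * √e * (√c * ‖LinearMap.adjoint P g‖) :=
          mul_le_mul_of_nonneg_left h3 (by positivity)
      _ = √e * (√c * (√N * ‖LinearMap.adjoint P g‖)) := by ring
      _ = _ := by rw [h6]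
  have h8 := (le_abs_self _).trans (h2.trans h7)
  have h9 := Real.sq_sqrt he0
  have h10 := Real.sq_sqrt hc
  have h11 : (√c * ‖g‖) ^ 2 = c * ‖g‖ ^ 2 := by rw [mul_pow, h10]
  nlinarith [sq_nonneg (√e - √c * ‖g‖)]

lemma trace_drift :
    LinearMap.trace ℝ X (lift N P ∘ₗ P ∘ₗ (LinearMap.id - J ∘ₗ opInv A)) =
      Module.finrank ℝ Y := by
  have h1 : LinearMap.trace ℝ X (lift N P ∘ₗ P) = Module.finrank ℝ Y := by
    rw [LinearMap.trace_comp_comm']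
    have : P ∘ₗ lift N P = LinearMap.id := LinearMap.ext hs.P_lift
    rw [this, LinearMap.trace_id]
  have h2 : LinearMap.trace ℝ X ((lift N P ∘ₗ P) ∘ₗ (J ∘ₗ opInv A)) = 0 := by
    have h3 := LinearMap.trace_comp_comm' (lift N P ∘ₗ P) (J ∘ₗ opInv A)
    have h4 : LinearMap.trace ℝ X ((lift N P ∘ₗ P) ∘ₗ (J ∘ₗ opInv A)) =
        -LinearMap.trace ℝ X ((J ∘ₗ opInv A) ∘ₗ (lift N P ∘ₗ P)) := by
      rw [LinearMap.trace_eq_sum_inner _ (stdOrthonormalBasis ℝ X),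
        LinearMap.trace_eq_sum_inner _ (stdOrthonormalBasis ℝ X), ← Finset.sum_neg_distrib]
      refine Finset.sum_congr rfl fun i _ => ?_
      simp only [LinearMap.comp_apply]
      rw [inner_lift_right, ← inner_lift, real_inner_comm, hs.inner_J_opInv ha, real_inner_comm,
        real_inner_comm, real_inner_comm]
    linarith
  rw [← LinearMap.comp_assoc, LinearMap.comp_sub, map_sub, h2, sub_zero, LinearMap.comp_id, h1]

/-- The algebraic inequality at the heart of the two-scale estimate. The vectors `p`, `h`, `h'` and
`g` stand for the gradients of `f` and `H` at the microscopic state `x` and of the macroscopic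
Hamiltonian at `P x` and at the macroscopic state `e`, and `φ` for the value of `f`. The
left-hand side is the rate of change of the density of
`⟨x - N Pᵗ e, A⁻¹ (x - N Pᵗ e)⟩ / 2`, after an integration by parts in the macroscopic directions.
The leading terms combine into `-N ⟨P x - e, h' - g⟩`, which the convexity of the macroscopic
Hamiltonian makes negative. -/
lemma drift_le (hc : 0 ≤ c) (hγ : 0 ≤ γ) (hlam : 0 < lam)
    (x : X) (e : Y) (g h' : Y) (h p : X) {φ Q : ℝ} (hφ : 0 ≤ φ) (hQ0 : 0 ≤ Q)
    (hQ : inner ℝ p (A p) = φ * Q)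
    (hmono : lam * ‖P x - e‖ ^ 2 ≤ inner ℝ (P x - e) (h' - g))
    (hlip : ‖h' - g‖ ≤ Lam * ‖P x - e‖) :
    -inner ℝ (x - lift N P e - J (opInv A (x - lift N P e))) (p - lift N P (P p)) +
      φ * (Module.finrank ℝ Y -
        inner ℝ (lift N P (P (x - lift N P e - J (opInv A (x - lift N P e))))) h) +
      φ * inner ℝ (opInv A (x - lift N P e)) (lift N P ((macroA N P A + macroJ N P A J) g)) ≤
    φ * (-(N * lam / 2) * ‖P x - e‖ ^ 2 +
      (c * √γ / 2 + lam * c / 4 + c * Lam ^ 2 / lam) *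
        inner ℝ (x - lift N P e) (opInv A (x - lift N P e)) +
      M + 2 / (lam * N) * ‖(N : ℝ) • P h - (N : ℝ) • h'‖ ^ 2 + 3 * (√γ / M) / 2 * ‖x‖ ^ 2 +
      √γ / M / 2 * N * (c * ‖g‖ ^ 2 + inner ℝ ((macroA N P A + macroJ N P A J) g)
        (macroAInv N P A ((macroA N P A + macroJ N P A J) g)))) + √γ / M * Q := by
  set w := (macroA N P A + macroJ N P A J) g with hw
  set z := x - lift N P e with hz
  set k := J (opInv A z) with hk
  set a := inner ℝ z (opInv A z) with haz
  set δ := √γ / (M : ℝ) with hδ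
  set G := (N : ℝ) • P h - (N : ℝ) • h' with hG
  set u := P x - e with hu
  set ew := inner ℝ w (macroAInv N P A w) with hew
  have hM1 : (1 : ℝ) ≤ M := by exact_mod_cast hs.M_pos
  have hN := hs.N_pos'
  have hδ0 : 0 ≤ δ := by positivity
  have hδγ : δ ≤ √γ := div_le_self (Real.sqrt_nonneg _) hM1
  have ha0 : 0 ≤ a := hs.inner_opInv_nonneg z
  have hew0 : 0 ≤ ew := hs.inner_macroAInv_nonneg w
  have hkn : ‖k‖ ≤ √c * √a := hs.norm_J_opInv_le ha hc z
  have hkn2 : ‖k‖ ^ 2 ≤ c * a := by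
    calc _ ≤ (√c * √a) ^ 2 := pow_le_pow_left₀ (norm_nonneg _) hkn 2
      _ = _ := by rw [mul_pow, Real.sq_sqrt hc, Real.sq_sqrt ha0]
  have hPz : P z = u := by rw [hz, map_sub, hs.P_lift]
  -- fluctuation part of the gradient of `f`
  have hpperp : ‖p - lift N P (P p)‖ ≤ δ * √(φ * Q) := by
    have := hs.norm_perp_le_sqrt ha hγ p
    rwa [hQ] at this
  have t1 : -inner ℝ (z - k) (p - lift N P (P p)) ≤
      φ * (δ / 2 * ‖x‖ ^ 2 + δ / 2 * (c * a)) + δ * Q := by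
    have e1 : inner ℝ z (p - lift N P (P p)) = inner ℝ x (p - lift N P (P p)) := by
      rw [hz, inner_sub_left, inner_lift, hs.P_perp, inner_zero_right, mul_zero, sub_zero]
    have e2 : -inner ℝ x (p - lift N P (P p)) ≤ ‖x‖ * (δ * √(φ * Q)) :=
      ((neg_le_abs _).trans (abs_real_inner_le_norm _ _)).trans
        (mul_le_mul_of_nonneg_left hpperp (norm_nonneg _))
    have e3 : inner ℝ k (p - lift N P (P p)) ≤ ‖k‖ * (δ * √(φ * Q)) :=
      (real_inner_le_norm _ _).trans (mul_le_mul_of_nonneg_left hpperp (norm_nonneg _))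
    have e4 : ∀ r : ℝ, r * (δ * √(φ * Q)) = δ * ((√φ * r) * √Q) := fun r => by
      rw [Real.sqrt_mul hφ]; ring
    rw [e4] at e2 e3
    have e5 := mul_le_half_add (a := √φ * ‖x‖) (b := √Q) (a2 := φ * ‖x‖ ^ 2) (b2 := Q) hδ0
      (by rw [mul_pow, Real.sq_sqrt hφ]) (by rw [Real.sq_sqrt hQ0])
    have e6 := mul_le_half_add (a := √φ * ‖k‖) (b := √Q) (a2 := φ * (c * a)) (b2 := Q) hδ0
      (by rw [mul_pow, Real.sq_sqrt hφ]; exact mul_le_mul_of_nonneg_left hkn2 hφ)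
      (by rw [Real.sq_sqrt hQ0])
    rw [inner_sub_left, e1]
    linarith
  -- the macroscopic part of the drift
  set b := u - P k with hb
  have hPk2 : N * ‖P k‖ ^ 2 ≤ c * a := (hs.norm_P_sq_le k).trans hkn2
  have hb2 : N * ‖b‖ ^ 2 ≤ 2 * (N * ‖u‖ ^ 2) + 2 * (c * a) := by
    have e1 : ‖b‖ ≤ ‖u‖ + ‖P k‖ := norm_sub_le _ _
    have e2 : ‖b‖ ^ 2 ≤ 2 * ‖u‖ ^ 2 + 2 * ‖P k‖ ^ 2 := by
      nlinarith [norm_nonneg b, sq_nonneg (‖u‖ - ‖P k‖), norm_nonneg u, norm_nonneg (P k)]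
    nlinarith
  have t2 : -inner ℝ (lift N P (P (z - k))) h = -inner ℝ b G - N * inner ℝ b h' := by
    rw [map_sub, hPz, inner_lift, hG, inner_sub_right, inner_smul_right, inner_smul_right]
    ring
  have t3 : -inner ℝ b G ≤ N * (lam / 8) * ‖b‖ ^ 2 + 2 / (lam * N) * ‖G‖ ^ 2 := by
    have e1 : -inner ℝ b G ≤ ‖b‖ * ‖G‖ := (neg_le_abs _).trans (abs_real_inner_le_norm _ _)
    have e2 : N * (lam / 8) * ‖b‖ ^ 2 + 2 / (lam * N) * ‖G‖ ^ 2 - ‖b‖ * ‖G‖ =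
        2 / (lam * N) * (N * lam / 4 * ‖b‖ - ‖G‖) ^ 2 := by
      field_simp
      ring
    have e3 : 0 ≤ 2 / (lam * N) * (N * lam / 4 * ‖b‖ - ‖G‖) ^ 2 := by positivity
    linarith
  have t4 : -(N * inner ℝ b (h' - g)) ≤ -(N * lam) * ‖u‖ ^ 2 + N * (lam / 4) * ‖u‖ ^ 2 +
      c * Lam ^ 2 / lam * a := by
    have e1 : inner ℝ (P k) (h' - g) ≤ ‖P k‖ * (Lam * ‖u‖) :=
      (real_inner_le_norm _ _).trans (mul_le_mul_of_nonneg_left hlip (norm_nonneg _))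
    have e2 : ‖P k‖ * (Lam * ‖u‖) ≤ lam / 4 * ‖u‖ ^ 2 + Lam ^ 2 / lam * ‖P k‖ ^ 2 := by
      have e3 : lam / 4 * ‖u‖ ^ 2 + Lam ^ 2 / lam * ‖P k‖ ^ 2 - ‖P k‖ * (Lam * ‖u‖) =
          1 / lam * (lam / 2 * ‖u‖ - Lam * ‖P k‖) ^ 2 := by
        field_simp
        ring
      have e4 : 0 ≤ 1 / lam * (lam / 2 * ‖u‖ - Lam * ‖P k‖) ^ 2 := by positivity
      linarith
    have e5 : Lam ^ 2 / lam * (N * ‖P k‖ ^ 2) ≤ Lam ^ 2 / lam * (c * a) :=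
      mul_le_mul_of_nonneg_left hPk2 (by positivity)
    have e6 : Lam ^ 2 / lam * (c * a) = c * Lam ^ 2 / lam * a := by ring
    rw [hb, inner_sub_left]
    have e7 := mul_le_mul_of_nonneg_left (e1.trans e2) hN.le
    have e8 := mul_le_mul_of_nonneg_left hmono hN.le
    linarith
  -- the drift of the macroscopic state, tested with the fluctuations
  set q := x - lift N P (P x) with hq
  have hzq : z = lift N P u + q := by rw [hz, hq, hu, map_sub]; abel
  have hqn : √(inner ℝ q (opInv A q)) ≤ δ * ‖x‖ := hs.sqrt_inner_perp_le ha hγ x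
  have t5 : inner ℝ (opInv A z) (lift N P w) =
      N * inner ℝ b g + inner ℝ (lift N P g) (J (opInv A q)) +
        inner ℝ (lift N P w) (opInv A q) := by
    have e1 : inner ℝ (opInv A z) (lift N P w) =
        inner ℝ (opInv A (lift N P u)) (lift N P w) + inner ℝ (lift N P w) (opInv A q) := by
      rw [hzq, map_add, inner_add_left, real_inner_comm (opInv A q)]
    have e2 : inner ℝ (opInv A (lift N P u)) (lift N P w) =
        N * inner ℝ u g + N * inner ℝ u (P (J (opInv A (lift N P g)))) := by
      rw [← inner_macroAInv_mul, hs.macroAInv_comm, hw, hs.macroAInv_velocity' ha,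
        inner_add_right, mul_add]
    have e3 : N * inner ℝ u (P (J (opInv A (lift N P g)))) =
        -(N * inner ℝ (P k) g) + inner ℝ (lift N P g) (J (opInv A q)) := by
      have e4 : k = J (opInv A (lift N P u)) + J (opInv A q) := by
        rw [hk, hzq, map_add, map_add]
      have e5 : N * inner ℝ (P k) g = inner ℝ k (lift N P g) := by rw [inner_lift_right]
      rw [← inner_lift, e5, e4, inner_add_left, hs.inner_J_opInv ha,
        real_inner_comm (lift N P g)]
      ring
    have e4 : inner ℝ b g = inner ℝ u g - inner ℝ (P k) g := inner_sub_left _ _ _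
    rw [e1, e2, e3, e4]
    ring
  have t6 : inner ℝ (lift N P g) (J (opInv A q)) ≤ δ / 2 * (‖x‖ ^ 2 + N * (c * ‖g‖ ^ 2)) := by
    have e1 : inner ℝ (lift N P g) (J (opInv A q)) ≤ ‖lift N P g‖ * (√c * (δ * ‖x‖)) :=
      (real_inner_le_norm _ _).trans (mul_le_mul_of_nonneg_left
        ((hs.norm_J_opInv_le ha hc q).trans (mul_le_mul_of_nonneg_left hqn (Real.sqrt_nonneg _)))
        (norm_nonneg _))
    have e2 := mul_le_half_add (a := ‖x‖) (b := √c * ‖lift N P g‖) (a2 := ‖x‖ ^ 2)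
      (b2 := N * (c * ‖g‖ ^ 2)) hδ0 le_rfl
      (by rw [mul_pow, Real.sq_sqrt hc, hs.norm_lift_sq]; linarith)
    linarith
  have t7 : inner ℝ (lift N P w) (opInv A q) ≤ δ / 2 * (‖x‖ ^ 2 + N * ew) := by
    have e1 := (le_abs_self _).trans (hs.inner_opInv_le (lift N P w) q)
    rw [← hs.inner_macroAInv_eq, ← hew] at e1
    have e2 := e1.trans (mul_le_mul_of_nonneg_left hqn (Real.sqrt_nonneg _))
    have e3 := mul_le_half_add (a := ‖x‖) (b := √(N * ew)) (a2 := ‖x‖ ^ 2)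
      (b2 := N * ew) hδ0 le_rfl (Real.sq_sqrt (by positivity)).le
    linarith
  have t8 : δ / 2 * (c * a) ≤ c * √γ / 2 * a := by
    have := mul_le_mul_of_nonneg_right hδγ (mul_nonneg hc ha0)
    linarith
  have t9 : (Module.finrank ℝ Y : ℝ) ≤ M := hs.finrank_Y_le
  have t10 : lam / 8 * (N * ‖b‖ ^ 2) ≤ lam / 8 * (2 * (N * ‖u‖ ^ 2) + 2 * (c * a)) :=
    mul_le_mul_of_nonneg_left hb2 (by positivity)
  have t11 : inner ℝ b (h' - g) = inner ℝ b h' - inner ℝ b g := inner_sub_right _ _ _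
  have key : (δ / 2 * ‖x‖ ^ 2 + δ / 2 * (c * a)) + (Module.finrank ℝ Y -
      inner ℝ (lift N P (P (z - k))) h) + inner ℝ (opInv A z) (lift N P w) ≤
      -(N * lam / 2) * ‖u‖ ^ 2 + (c * √γ / 2 + lam * c / 4 + c * Lam ^ 2 / lam) * a +
      M + 2 / (lam * N) * ‖G‖ ^ 2 + 3 * δ / 2 * ‖x‖ ^ 2 + δ / 2 * N * (c * ‖g‖ ^ 2 + ew) := by
    rw [t11] at t4
    linarith
  have key2 := mul_le_mul_of_nonneg_left key hφ
  linarith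

end IsSystem
end Algebra

/-! ### The macroscopic Hamiltonian and its flow -/

section Macro

section Convexity

variable {Y : Type*} [NormedAddCommGroup Y] [InnerProductSpace ℝ Y] [FiniteDimensional ℝ Y]
  {Hbar : Y → ℝ} {lam Lam β : ℝ}

lemma inner_gradient (y v : Y) : inner ℝ (gradient Hbar y) v = fderiv ℝ Hbar y v := by
  simp [gradient]

lemma continuous_gradient (hH : ContDiff ℝ 2 Hbar) : Continuous (gradient Hbar) := by
  have h1 : Continuous (fderiv ℝ Hbar) := hH.continuous_fderiv (by norm_num)
  exact (InnerProductSpace.toDual ℝ Y).symm.continuous.comp h1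

lemma hasFDerivAt_fderiv (hH : ContDiff ℝ 2 Hbar) (y : Y) :
    HasFDerivAt (fderiv ℝ Hbar) (fderiv ℝ (fderiv ℝ Hbar) y) y :=
  ((hH.fderiv_right (m := 1) (by norm_num)).differentiable (by norm_num) y).hasFDerivAt

lemma norm_hess_le (hH : ContDiff ℝ 2 Hbar) (hLam : 0 ≤ Lam)
    (hlow : ∀ y v, 0 ≤ hess Hbar y v v) (hup : ∀ y v, hess Hbar y v v ≤ Lam * ‖v‖ ^ 2) (y : Y) :
    ‖fderiv ℝ (fderiv ℝ Hbar) y‖ ≤ Lam := by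
  set B : LinearMap.BilinForm ℝ Y := LinearMap.mk₂ ℝ (fun u v => hess Hbar y u v)
    (by simp [hess]) (by simp [hess]) (by simp [hess]) (by simp [hess])
  have hsymm : ∀ u v, hess Hbar y u v = hess Hbar y v u := fun u v =>
    (hH.contDiffAt.isSymmSndFDerivAt (by simp)).eq u v
  have hB : ∀ u v, hess Hbar y u v ^ 2 ≤ hess Hbar y u u * hess Hbar y v v := fun u v => by
    have := LinearMap.BilinForm.apply_mul_apply_le_of_forall_zero_le B (fun v => hlow y v) u v
    change hess Hbar y u v * hess Hbar y v u ≤ _ at this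
    rw [hsymm v u] at this
    rw [sq]; exact this
  refine ContinuousLinearMap.opNorm_le_bound _ hLam fun u => ?_
  refine ContinuousLinearMap.opNorm_le_bound _ (by positivity) fun v => ?_
  rw [Real.norm_eq_abs]
  refine abs_le_of_sq_le_sq ?_ (by positivity)
  calc hess Hbar y u v ^ 2 ≤ hess Hbar y u u * hess Hbar y v v := hB u v
    _ ≤ (Lam * ‖u‖ ^ 2) * (Lam * ‖v‖ ^ 2) :=
        mul_le_mul (hup y u) (hup y v) (hlow y v) (by positivity)
    _ = _ := by ring

lemma norm_gradient_sub_le (hH : ContDiff ℝ 2 Hbar) (hLam : 0 ≤ Lam)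
    (hlow : ∀ y v, 0 ≤ hess Hbar y v v) (hup : ∀ y v, hess Hbar y v v ≤ Lam * ‖v‖ ^ 2)
    (y z : Y) : ‖gradient Hbar y - gradient Hbar z‖ ≤ Lam * ‖y - z‖ := by
  have h1 : gradient Hbar y - gradient Hbar z =
      (InnerProductSpace.toDual ℝ Y).symm (fderiv ℝ Hbar y - fderiv ℝ Hbar z) := by
    simp [gradient]
  rw [h1, LinearIsometryEquiv.norm_map]
  exact convex_univ.norm_image_sub_le_of_norm_fderiv_le
    (fun w _ => (hasFDerivAt_fderiv hH w).differentiableAt)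
    (fun w _ => norm_hess_le hH hLam hlow hup w) (mem_univ _) (mem_univ _)

lemma le_inner_gradient_sub (hH : ContDiff ℝ 2 Hbar)
    (hlow : ∀ y v, lam * ‖v‖ ^ 2 ≤ hess Hbar y v v) (y z : Y) :
    lam * ‖y - z‖ ^ 2 ≤ inner ℝ (y - z) (gradient Hbar y - gradient Hbar z) := by
  set v := y - z with hv
  have hd : ∀ t : ℝ, HasDerivAt (fun t : ℝ => fderiv ℝ Hbar (z + t • v) v)
      (hess Hbar (z + t • v) v v) t := fun t => by
    have h1 : HasDerivAt (fun t : ℝ => z + t • v) v t := by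
      simpa using ((hasDerivAt_id t).smul_const v).const_add z
    have h2 := (hasFDerivAt_fderiv hH (z + t • v)).comp_hasDerivAt t h1
    exact (ContinuousLinearMap.apply ℝ ℝ v).hasFDerivAt.comp_hasDerivAt t h2
  have h2 := (convex_univ (𝕜 := ℝ) (E := ℝ)).mul_sub_le_image_sub_of_le_deriv
    (f := fun t : ℝ => fderiv ℝ Hbar (z + t • v) v) (C := lam * ‖v‖ ^ 2)
    (fun t _ => (hd t).continuousAt.continuousWithinAt)
    (fun t _ => (hd t).differentiableAt.differentiableWithinAt)
    (fun t _ => by rw [(hd t).deriv]; exact hlow _ _) 0 (mem_univ _) 1 (mem_univ _) zero_le_one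
  simp only [sub_zero, mul_one, one_smul, zero_smul, add_zero] at h2
  have h3 : z + v = y := by rw [hv]; abel
  rw [h3] at h2
  rw [inner_sub_right, real_inner_comm, real_inner_comm (gradient Hbar z), inner_gradient,
    inner_gradient]
  exact h2

/-- A convex function with Hessian at most `Λ` and infimum at least `-β` satisfies
`|∇H|² ≤ 2Λ(H + β)`: compare with a gradient step of length `1 / Λ`. -/
lemma norm_gradient_sq_le (hH : ContDiff ℝ 2 Hbar) (hLam : 0 < Lam)
    (hlow : ∀ y v, 0 ≤ hess Hbar y v v) (hup : ∀ y v, hess Hbar y v v ≤ Lam * ‖v‖ ^ 2)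
    (hβ : ∀ y, -β ≤ Hbar y) (y : Y) : ‖gradient Hbar y‖ ^ 2 ≤ 2 * Lam * (Hbar y + β) := by
  set g := gradient Hbar y with hg
  -- A gradient step of length `1 / Λ` lowers `Hbar` by at least `|∇Hbar|² / (2 Λ)`, and the value
  -- after the step is still at least `-β`.
  set v : Y := -(1 / Lam) • g with hv
  set ψ : ℝ → ℝ := fun t => Hbar (y + t • v) - t * inner ℝ g v - Lam / 2 * t ^ 2 * ‖v‖ ^ 2
  have hd : ∀ t : ℝ, HasDerivAt ψ (inner ℝ (gradient Hbar (y + t • v) - g) v -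
      Lam * t * ‖v‖ ^ 2) t := fun t => by
    have h1 : HasDerivAt (fun t : ℝ => y + t • v) v t := by
      simpa using ((hasDerivAt_id t).smul_const v).const_add y
    have h2 := ((hH.differentiable (by norm_num) (y + t • v)).hasFDerivAt).comp_hasDerivAt t h1
    have h3 : HasDerivAt (fun t : ℝ => t * inner ℝ g v) (inner ℝ g v) t := by
      simpa using (hasDerivAt_id t).mul_const (inner ℝ g v)
    have h4 : HasDerivAt (fun t : ℝ => Lam / 2 * t ^ 2 * ‖v‖ ^ 2) (Lam * t * ‖v‖ ^ 2) t := by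
      have := (((hasDerivAt_pow 2 t).const_mul (Lam / 2)).mul_const (‖v‖ ^ 2))
      have h : Lam * t * ‖v‖ ^ 2 = Lam / 2 * ((2 : ℕ) * t ^ (2 - 1)) * ‖v‖ ^ 2 := by
        rw [show (2 : ℕ) - 1 = 1 from rfl, pow_one]; push_cast; ring
      rw [h]; exact this
    rw [inner_sub_left, inner_gradient]
    exact (h2.sub h3).sub h4
  have hanti : AntitoneOn ψ (Ici 0) := by
    refine antitoneOn_of_deriv_nonpos (convex_Ici 0)
      (fun t _ => (hd t).continuousAt.continuousWithinAt)
      (fun t _ => (hd t).differentiableAt.differentiableWithinAt) (fun t ht => ?_)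
    rw [interior_Ici] at ht
    have ht0 : (0 : ℝ) < t := ht
    rw [(hd t).deriv]
    have h1 := norm_gradient_sub_le hH hLam.le hlow hup (y + t • v) y
    rw [add_sub_cancel_left, norm_smul, Real.norm_eq_abs, abs_of_pos ht0] at h1
    have h2 := (real_inner_le_norm (gradient Hbar (y + t • v) - g) v).trans
      (mul_le_mul_of_nonneg_right h1 (norm_nonneg _))
    linarith [h2, sq ‖v‖]
  have h1 := hanti (mem_Ici.2 le_rfl) (mem_Ici.2 zero_le_one) zero_le_one
  simp only [ψ, one_smul, zero_smul, add_zero, zero_mul, sub_zero, one_mul, one_pow, mul_one,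
    mul_zero, ne_eq, OfNat.ofNat_ne_zero, not_false_eq_true, zero_pow] at h1
  have h2 := hβ (y + v)
  have h3 : inner ℝ g v = -(1 / Lam) * ‖g‖ ^ 2 := by
    rw [hv, inner_smul_right, real_inner_self_eq_norm_sq]
  have h4 : ‖v‖ ^ 2 = (1 / Lam) ^ 2 * ‖g‖ ^ 2 := by
    rw [hv, norm_smul, mul_pow, norm_neg, Real.norm_eq_abs, sq_abs]
  rw [h3, h4] at h1
  have h5 : Lam / 2 * ((1 / Lam) ^ 2 * ‖g‖ ^ 2) = 1 / (2 * Lam) * ‖g‖ ^ 2 := by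
    field_simp
  have h6 : 1 / Lam * ‖g‖ ^ 2 = 2 * (1 / (2 * Lam) * ‖g‖ ^ 2) := by
    field_simp
  have h7 : 1 / (2 * Lam) * ‖g‖ ^ 2 ≤ Hbar y + β := by linarith
  have h8 := mul_le_mul_of_nonneg_left h7 (by positivity : 0 ≤ 2 * Lam)
  have h9 : 2 * Lam * (1 / (2 * Lam) * ‖g‖ ^ 2) = ‖g‖ ^ 2 := by field_simp
  linarith

end Convexity

section Flow

variable {X Y : Type*}
  [NormedAddCommGroup X] [InnerProductSpace ℝ X] [FiniteDimensional ℝ X]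
  [MeasurableSpace X] [BorelSpace X]
  [NormedAddCommGroup Y] [InnerProductSpace ℝ Y] [FiniteDimensional ℝ Y]
  [MeasurableSpace Y] [BorelSpace Y]
  {N M : ℕ} {P : X →ₗ[ℝ] Y} {A J : X →ₗ[ℝ] X} {H : X → ℝ} {Hbar : Y → ℝ}
  {f : ℝ → X → ℝ} {η : ℝ → Y} {κ ρ lam Lam α β γ C₁ C₂ c : ℝ}

/-- The velocity `(Ā + J̄) ∇H̄(y)` of the reversed macroscopic flow. -/
noncomputable def velocity (N : ℕ) (P : X →ₗ[ℝ] Y) (A J : X →ₗ[ℝ] X) (Hbar : Y → ℝ) (y : Y) : Y :=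
  (macroA N P A + macroJ N P A J) (gradient Hbar y)

/-- The dissipation `⟨w, Ā⁻¹ w⟩` of the macroscopic flow, together with the multiple `c |∇H̄|²`
of the squared gradient, at a macroscopic state. -/
noncomputable def macroDissipation (N : ℕ) (P : X →ₗ[ℝ] Y) (A J : X →ₗ[ℝ] X) (Hbar : Y → ℝ) (c : ℝ)
    (y : Y) : ℝ :=
  c * ‖gradient Hbar y‖ ^ 2 +
    inner ℝ (velocity N P A J Hbar y) (macroAInv N P A (velocity N P A J Hbar y))

/-- A bound for the time integral of `macroDissipation`, uniform in the system. -/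
noncomputable def dissipationBound (Lam β C₂ c T : ℝ) : ℝ :=
  (2 * Lam * c * T + 2) * (Real.exp (c * Lam * T) * (C₂ + β))

namespace IsSystem

variable (hs : IsSystem N M P A J H Hbar f η)
include hs

lemma continuous_velocity : Continuous (velocity N P A J Hbar) :=
  (LinearMap.continuous_of_finiteDimensional _).comp (continuous_gradient hs.Hbar_contDiff)

lemma continuous_macroDissipation (c : ℝ) : Continuous (macroDissipation N P A J Hbar c) := by
  have h1 := hs.continuous_velocity
  have h2 := continuous_gradient hs.Hbar_contDiff
  have h3 : Continuous (macroAInv N P A) := LinearMap.continuous_of_finiteDimensional _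
  unfold macroDissipation
  exact (continuous_const.mul (h2.norm.pow 2)).add (h1.inner (h3.comp h1))

lemma macroDissipation_nonneg (hc : 0 ≤ c) (y : Y) : 0 ≤ macroDissipation N P A J Hbar c y :=
  add_nonneg (mul_nonneg hc (sq_nonneg _)) (hs.inner_macroAInv_nonneg _)

lemma continuousOn_η : ContinuousOn η (Ici 0) := fun t ht =>
  (hs.macro_sol t ht).continuousWithinAt

variable (ha : Assumptions N M P A J H Hbar f η κ ρ lam Lam α β γ C₁ C₂ c)
include ha

lemma hess_nonneg (hlam : 0 < lam) (y v : Y) : 0 ≤ hess Hbar y v v :=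
  le_trans (by positivity) (ha.iii y v).1

/-- The macroscopic flow stays in a region of bounded energy, and its dissipation is bounded, on
bounded time intervals. The weight `exp (-c Λ t)` absorbs the contribution of `J̄`. -/
lemma macro_energy (hc : 0 ≤ c) (hlam : 0 < lam) (hLam : 0 < Lam) {T t : ℝ} (ht : 0 ≤ t)
    (htT : t ≤ T) : ∫ s in Ioc 0 t, macroDissipation N P A J Hbar c (η s) ≤
      dissipationBound Lam β C₂ c T := by
  have hH := hs.Hbar_contDiff
  have hgrad : ∀ y, ‖gradient Hbar y‖ ^ 2 ≤ 2 * Lam * (Hbar y + β) :=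
    norm_gradient_sq_le hH hLam (hs.hess_nonneg ha hlam) (fun y v => (ha.iii y v).2) ha.v
  set E : ℝ → ℝ := fun s => Real.exp (-(c * Lam) * s) * (Hbar (η s) + β) with hE
  set e : ℝ → ℝ := fun s =>
    inner ℝ (velocity N P A J Hbar (η s)) (macroAInv N P A (velocity N P A J Hbar (η s)))
  have he0 : ∀ s, 0 ≤ e s := fun s => hs.inner_macroAInv_nonneg _
  have hd : ∀ s, 0 ≤ s → HasDerivWithinAt E
      (Real.exp (-(c * Lam) * s) * (-(c * Lam)) * (Hbar (η s) + β) +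
        Real.exp (-(c * Lam) * s) * -inner ℝ (velocity N P A J Hbar (η s))
          (gradient Hbar (η s))) (Ici 0) s := fun s hs0 => by
    have h1 : HasDerivAt (fun s : ℝ => Real.exp (-(c * Lam) * s))
        (Real.exp (-(c * Lam) * s) * (-(c * Lam))) s := by
      simpa using ((hasDerivAt_id s).const_mul (-(c * Lam))).exp
    have h2 := ((hH.differentiable (by norm_num) (η s)).hasFDerivAt).comp_hasDerivWithinAt s
      (hs.macro_sol s hs0)
    have h3 : fderiv ℝ Hbar (η s) (-(macroA N P A + macroJ N P A J) (gradient Hbar (η s))) =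
        -inner ℝ (velocity N P A J Hbar (η s)) (gradient Hbar (η s)) := by
      rw [← inner_gradient, inner_neg_right, real_inner_comm]; rfl
    rw [h3] at h2
    exact h1.hasDerivWithinAt.mul (h2.add_const β)
  have hder : ∀ s, Real.exp (-(c * Lam) * s) * (-(c * Lam)) * (Hbar (η s) + β) +
        Real.exp (-(c * Lam) * s) * -inner ℝ (velocity N P A J Hbar (η s))
          (gradient Hbar (η s)) ≤ -(Real.exp (-(c * Lam) * s) * (e s / 2)) := fun s => by
    have h1 := hs.velocity_energy_le ha hc (gradient Hbar (η s))
    change 1 / 2 * e s ≤ inner ℝ (velocity N P A J Hbar (η s)) _ + _ at h1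
    have h2 := mul_le_mul_of_nonneg_left (hgrad (η s)) hc
    have h3 : e s / 2 - c * Lam * (Hbar (η s) + β) ≤
      inner ℝ (velocity N P A J Hbar (η s)) (gradient Hbar (η s)) := by linarith
    have h4 := mul_le_mul_of_nonneg_left h3 (Real.exp_pos (-(c * Lam) * s)).le
    linarith
  have hecont : ContinuousOn e (Ici 0) := by
    have h1 := hs.continuous_velocity.comp_continuousOn hs.continuousOn_η
    have h3 : Continuous (macroAInv N P A) := LinearMap.continuous_of_finiteDimensional _
    exact h1.inner (h3.comp_continuousOn h1)
  have hcontE : ∀ a b : ℝ, 0 ≤ a → ContinuousOn E (Icc a b) := fun a b ha0 s hs' =>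
    ((hd s (ha0.trans hs'.1)).continuousWithinAt).mono fun r hr => ha0.trans hr.1
  have hphi : ContinuousOn (fun s => Real.exp (-(c * Lam) * s) * (e s / 2)) (Ici 0) :=
    ContinuousOn.mul (by fun_prop) (hecont.div_const 2)
  have hineq : ∀ s, 0 ≤ s →
      ∫ r in 0..s, Real.exp (-(c * Lam) * r) * (e r / 2) ≤ E 0 - E s := fun s hs0 => by
    have := intervalIntegral.integral_le_sub_of_hasDeriv_right_of_le (g := fun r => -E r)
      (φ := fun r => Real.exp (-(c * Lam) * r) * (e r / 2)) hs0 (hcontE 0 s le_rfl).neg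
      (fun r hr => ((hd r hr.1.le).mono (fun q hq => hr.1.le.trans (le_of_lt hq))).neg)
      ((hphi.mono fun r hr => hr.1).integrableOn_Icc) (fun r hr => by linarith [hder r])
    linarith
  have hEbd : ∀ s, 0 ≤ s → E s ≤ C₂ + β := fun s hs0 => by
    have h1 := hineq s hs0
    have h2 : 0 ≤ ∫ r in 0..s, Real.exp (-(c * Lam) * r) * (e r / 2) :=
      intervalIntegral.integral_nonneg hs0 fun r _ =>
        mul_nonneg (Real.exp_pos _).le (by linarith [he0 r])
    have h3 : E 0 = Hbar (η 0) + β := by simp [hE]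
    linarith [ha.vii_macro]
  have hE0 : ∀ s, 0 ≤ E s := fun s =>
    mul_nonneg (Real.exp_pos _).le (by linarith [ha.v (η s)])
  have hCβ : 0 ≤ C₂ + β := (hE0 0).trans (hEbd 0 le_rfl)
  set K := Real.exp (c * Lam * T) with hK
  have hexp : ∀ s ∈ Icc 0 t, 1 ≤ K * Real.exp (-(c * Lam) * s) := fun s hs' => by
    rw [hK, ← Real.exp_add]
    refine Real.one_le_exp ?_
    have : 0 ≤ c * Lam * (T - s) := mul_nonneg (by positivity) (by linarith [hs'.2])
    linarith
  have hK0 : 0 ≤ K := (Real.exp_pos _).le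
  have hpt : ∀ s ∈ Icc 0 t, macroDissipation N P A J Hbar c (η s) ≤
      2 * Lam * c * (K * (C₂ + β)) + 2 * K * (Real.exp (-(c * Lam) * s) * (e s / 2)) := by
    intro s hs'
    have h1 : Hbar (η s) + β ≤ K * (C₂ + β) := by
      have h2 : 1 * (Hbar (η s) + β) ≤ K * Real.exp (-(c * Lam) * s) * (Hbar (η s) + β) :=
        mul_le_mul_of_nonneg_right (hexp s hs') (by linarith [ha.v (η s)])
      have h3 := mul_le_mul_of_nonneg_left (hEbd s hs'.1) hK0
      simp only [hE] at h3
      linarith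
    have h2 : c * ‖gradient Hbar (η s)‖ ^ 2 ≤ c * (2 * Lam * (K * (C₂ + β))) :=
      mul_le_mul_of_nonneg_left ((hgrad _).trans
        (mul_le_mul_of_nonneg_left h1 (by positivity))) hc
    have h3 := mul_le_mul_of_nonneg_right (hexp s hs') (he0 s)
    change c * ‖gradient Hbar (η s)‖ ^ 2 + e s ≤ _
    linarith
  have hint1 : IntervalIntegrable (fun s => Real.exp (-(c * Lam) * s) * (e s / 2)) volume 0 t :=
    (hphi.mono (by rw [uIcc_of_le ht]; exact fun r hr => hr.1)).intervalIntegrable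
  have hint2 : IntervalIntegrable (fun s => macroDissipation N P A J Hbar c (η s)) volume 0 t :=
    (((hs.continuous_macroDissipation c).comp_continuousOn hs.continuousOn_η).mono
      (by rw [uIcc_of_le ht]; exact fun r hr => hr.1)).intervalIntegrable
  rw [← intervalIntegral.integral_of_le ht]
  calc ∫ s in 0..t, macroDissipation N P A J Hbar c (η s)
      ≤ ∫ s in 0..t, (2 * Lam * c * (K * (C₂ + β)) +
          2 * K * (Real.exp (-(c * Lam) * s) * (e s / 2))) :=
        intervalIntegral.integral_mono_on ht hint2
          (intervalIntegrable_const.add (hint1.const_mul _)) hpt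
    _ = t * (2 * Lam * c * (K * (C₂ + β))) +
          2 * K * ∫ s in 0..t, Real.exp (-(c * Lam) * s) * (e s / 2) := by
        rw [intervalIntegral.integral_add intervalIntegrable_const (hint1.const_mul _),
          intervalIntegral.integral_const, intervalIntegral.integral_const_mul, sub_zero,
          smul_eq_mul]
    _ ≤ T * (2 * Lam * c * (K * (C₂ + β))) + 2 * K * (C₂ + β) := by
        refine add_le_add (mul_le_mul_of_nonneg_right htT (by positivity))
          (mul_le_mul_of_nonneg_left ?_ (by positivity))
        have h1 := hineq t ht
        have h2 := hEbd 0 le_rfl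
        linarith [hE0 t]
    _ = _ := by rw [dissipationBound]; ring

end IsSystem
end Flow
end Macro

/-! ### Conditional measures and the macroscopic force -/

section Fiber

variable {X Y : Type*}
  [NormedAddCommGroup X] [InnerProductSpace ℝ X] [FiniteDimensional ℝ X]
  [MeasurableSpace X] [BorelSpace X]
  [NormedAddCommGroup Y] [InnerProductSpace ℝ Y] [FiniteDimensional ℝ Y]
  [MeasurableSpace Y] [BorelSpace Y]
  {N M : ℕ} {P : X →ₗ[ℝ] Y} {A J : X →ₗ[ℝ] X} {H : X → ℝ} {Hbar : Y → ℝ}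
  {f : ℝ → X → ℝ} {η : ℝ → Y} {κ ρ lam Lam α β γ C₁ C₂ c : ℝ}

instance instIsFiniteMeasureMacroMeasure (P : X →ₗ[ℝ] Y) (H : X → ℝ) :
    IsFiniteMeasure (macroMeasure P H) := by
  unfold macroMeasure; infer_instance

instance instIsProbabilityMeasureCondMeasure (P : X →ₗ[ℝ] Y) (H : X → ℝ) (y : Y) :
    IsProbabilityMeasure (condMeasure P H y) := by
  unfold condMeasure; infer_instance

lemma measurable_linear (P : X →ₗ[ℝ] Y) : Measurable P :=
  P.continuous_of_finiteDimensional.measurable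

lemma compProd_condMeasure (P : X →ₗ[ℝ] Y) (H : X → ℝ) :
    (macroMeasure P H).compProd (ProbabilityTheory.condDistrib (id : X → X) P (gibbs H)) =
      (gibbs H).map fun x => (P x, x) :=
  ProbabilityTheory.compProd_map_condDistrib aemeasurable_id

/-- Disintegration of the Gibbs measure along the coarse-graining operator. -/
lemma lintegral_condMeasure (P : X →ₗ[ℝ] Y) (H : X → ℝ) {F : Y × X → ℝ≥0∞} (hF : Measurable F) :
    ∫⁻ y, ∫⁻ x, F (y, x) ∂(condMeasure P H y) ∂(macroMeasure P H) =
      ∫⁻ x, F (P x, x) ∂(gibbs H) := by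
  have h := compProd_condMeasure P H
  have hP := measurable_linear P
  calc _ = ∫⁻ p, F p ∂((macroMeasure P H).compProd
        (ProbabilityTheory.condDistrib (id : X → X) P (gibbs H))) :=
        (Measure.lintegral_compProd hF).symm
    _ = _ := by rw [h, lintegral_map hF (by fun_prop)]

lemma ae_condMeasure_fiber (P : X →ₗ[ℝ] Y) (H : X → ℝ) :
    ∀ᵐ y ∂(macroMeasure P H), ∀ᵐ x ∂(condMeasure P H y), P x = y := by
  have hP := measurable_linear P
  have hset : MeasurableSet {p : Y × X | P p.2 = p.1} :=
    measurableSet_eq_fun (by fun_prop) (by fun_prop)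
  have h : ∀ᵐ p ∂((macroMeasure P H).compProd
      (ProbabilityTheory.condDistrib (id : X → X) P (gibbs H))), P p.2 = p.1 := by
    rw [compProd_condMeasure, ae_map_iff (by fun_prop) hset]
    exact ae_of_all _ fun x => rfl
  exact Measure.ae_ae_of_ae_compProd h

/-- The projection of `X` onto the fibre of `P` over `y`. -/
noncomputable def fiberProj (N : ℕ) (P : X →ₗ[ℝ] Y) (y : Y) (x : X) : X :=
  x - lift N P (P x) + lift N P y

lemma fiberProj_of_eq {y : Y} {x : X} (h : P x = y) : fiberProj N P y x = x := by
  rw [fiberProj, h, sub_add_cancel]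

lemma fiberProj_sub (y : Y) (x z : X) : fiberProj N P y x - fiberProj N P y z =
    (x - z) - lift N P (P (x - z)) := by
  simp only [fiberProj, map_sub]; abel

/-- The orthogonal projection `id - N Pᵗ P` as a continuous linear map. -/
noncomputable def perpCLM (N : ℕ) (P : X →ₗ[ℝ] Y) : X →L[ℝ] X :=
  LinearMap.toContinuousLinearMap (LinearMap.id - lift N P ∘ₗ P)

lemma perpCLM_apply (x : X) : perpCLM N P x = x - lift N P (P x) := rfl

lemma hasFDerivAt_fiberProj (y : Y) (x : X) :
    HasFDerivAt (fiberProj N P y) (perpCLM N P) x :=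
  (perpCLM N P).hasFDerivAt.add_const _

lemma contDiff_fiberProj (y : Y) : ContDiff ℝ 1 (fiberProj N P y) :=
  (perpCLM N P).contDiff.add contDiff_const

namespace IsSystem

variable (hs : IsSystem N M P A J H Hbar f η)
include hs

lemma isProbabilityMeasure_gibbs : IsProbabilityMeasure (gibbs H) :=
  isProbabilityMeasure_tilted hs.integrable_exp

lemma partition_pos : 0 < ∫ x, Real.exp (-H x) := integral_exp_pos hs.integrable_exp

lemma continuous_H : Continuous H := hs.H_contDiff.continuous

lemma lintegral_gibbs {F : X → ℝ≥0∞} (hF : Measurable F) :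
    ∫⁻ x, F x ∂(gibbs H) =
      ∫⁻ x, ENNReal.ofReal (Real.exp (-H x) / ∫ x, Real.exp (-H x)) * F x := by
  have hH := hs.continuous_H.measurable
  rw [gibbs, Measure.tilted, lintegral_withDensity_eq_lintegral_mul _ (by fun_prop) hF]
  rfl

lemma lintegral_macroMeasure {F : Y → ℝ≥0∞} (hF : Measurable F) :
    ∫⁻ y, F y ∂(macroMeasure P H) =
      ∫⁻ y, ENNReal.ofReal (Real.exp (-(N * Hbar y))) * F y := by
  have hH := hs.Hbar_contDiff.continuous.measurable
  rw [hs.macro_law, lintegral_withDensity_eq_lintegral_mul _ (by fun_prop) hF]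
  rfl

/-- The ratio of the partition functions of two fibres as an exponential moment on one of them;
this follows from the translation invariance of Lebesgue measure and needs no integrability. -/
lemma lintegral_condMeasure_exp_sub (v : Y) :
    ∀ᵐ y ∂(macroMeasure P H),
      ∫⁻ x, ENNReal.ofReal (Real.exp (H x - H (x + lift N P v))) ∂(condMeasure P H y) =
        ENNReal.ofReal (Real.exp (N * Hbar y - N * Hbar (y + v))) := by
  have hP := measurable_linear P
  have hHc := hs.continuous_H
  have hHb := hs.Hbar_contDiff.continuous
  have hH := hHc.measurable
  have hHbm := hHb.measurable
  have hm1 : Measurable fun x => ENNReal.ofReal (Real.exp (H x - H (x + lift N P v))) := by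
    fun_prop
  have hm2 : Measurable fun y => ENNReal.ofReal (Real.exp (N * Hbar y - N * Hbar (y + v))) := by
    fun_prop
  refine ae_eq_of_forall_setLIntegral_eq_of_sigmaFinite ?_ hm2 fun S hS _ => ?_
  · exact Measurable.lintegral_kernel
      (κ := ProbabilityTheory.condDistrib (id : X → X) P (gibbs H)) hm1
  set ξ : Y → ℝ≥0∞ := S.indicator 1 with hξ
  have hξm : Measurable ξ := measurable_one.indicator hS
  have hl : ∫⁻ y in S, ∫⁻ x, ENNReal.ofReal (Real.exp (H x - H (x + lift N P v)))
      ∂(condMeasure P H y) ∂(macroMeasure P H) =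
      ∫⁻ x, ξ (P x) * ENNReal.ofReal (Real.exp (H x - H (x + lift N P v))) ∂(gibbs H) := by
    rw [← lintegral_condMeasure P H (F := fun p => ξ p.1 *
      ENNReal.ofReal (Real.exp (H p.2 - H (p.2 + lift N P v)))) (by fun_prop),
      ← lintegral_indicator hS]
    refine lintegral_congr fun y => ?_
    dsimp only
    rw [lintegral_const_mul _ hm1]
    by_cases hy : y ∈ S <;> simp [hξ, hy]
  have hr : ∫⁻ y in S, ENNReal.ofReal (Real.exp (N * Hbar y - N * Hbar (y + v)))
      ∂(macroMeasure P H) =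
      ∫⁻ y, ξ y * ENNReal.ofReal (Real.exp (N * Hbar y - N * Hbar (y + v)))
        ∂(macroMeasure P H) := by
    rw [← lintegral_indicator hS]
    refine lintegral_congr fun y => ?_
    by_cases hy : y ∈ S <;> simp [hξ, hy]
  rw [hl, hr, hs.lintegral_gibbs (by fun_prop), hs.lintegral_macroMeasure (by fun_prop)]
  have hZ := hs.partition_pos
  calc ∫⁻ x, ENNReal.ofReal (Real.exp (-H x) / ∫ x, Real.exp (-H x)) *
        (ξ (P x) * ENNReal.ofReal (Real.exp (H x - H (x + lift N P v))))
      = ∫⁻ x, ENNReal.ofReal (Real.exp (-H (x + lift N P v)) / ∫ x, Real.exp (-H x)) *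
          ξ (P (x + lift N P v) - v) := by
        refine lintegral_congr fun x => ?_
        have e1 : P (x + lift N P v) - v = P x := by rw [map_add, hs.P_lift]; abel
        rw [e1, mul_left_comm, mul_comm _ (ξ (P x)), ← ENNReal.ofReal_mul (by positivity),
          div_mul_eq_mul_div, ← Real.exp_add]
        congr 5
        ring
    _ = ∫⁻ x, ENNReal.ofReal (Real.exp (-H x) / ∫ x, Real.exp (-H x)) * ξ (P x - v) :=
        lintegral_add_right_eq_self (fun x => ENNReal.ofReal
          (Real.exp (-H x) / ∫ x, Real.exp (-H x)) * ξ (P x - v)) (lift N P v)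
    _ = ∫⁻ x, ξ (P x - v) ∂(gibbs H) := (hs.lintegral_gibbs (by fun_prop)).symm
    _ = ∫⁻ y, ξ (y - v) ∂(macroMeasure P H) := by
        rw [macroMeasure, lintegral_map (by fun_prop) hP]
    _ = ∫⁻ y, ENNReal.ofReal (Real.exp (-(N * Hbar y))) * ξ (y - v) :=
        hs.lintegral_macroMeasure (by fun_prop)
    _ = ∫⁻ y, ENNReal.ofReal (Real.exp (-(N * Hbar (y + v)))) * ξ (y + v - v) :=
        (lintegral_add_right_eq_self (fun y => ENNReal.ofReal
          (Real.exp (-(N * Hbar y))) * ξ (y - v)) v).symm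
    _ = _ := by
        refine lintegral_congr fun y => ?_
        rw [add_sub_cancel_right, mul_left_comm, mul_comm _ (ξ y),
          ← ENNReal.ofReal_mul (by positivity), ← Real.exp_add]
        congr 3
        ring

variable (ha : Assumptions N M P A J H Hbar f η κ ρ lam Lam α β γ C₁ C₂ c)
include ha

/-- The bound on the mixed second derivatives is one-sided; replacing `d` by `-d` makes it
two-sided. The factor `√N` is the norm of `N Pᵗ`. -/
lemma abs_hess_le (x d : X) (v : Y) (hd : P d = 0) :
    |hess H x d (lift N P v)| ≤ κ * √N * ‖v‖ * ‖d‖ := by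
  have main : ∀ d : X, P d = 0 → hess H x d (lift N P v) ≤ κ * √N * ‖v‖ * ‖d‖ := by
    intro d hd
    rcases eq_or_ne d 0 with rfl | hd0
    · simp [hess]
    rcases eq_or_ne v 0 with rfl | hv0
    · simp [hess]
    have hsymm : hess H x d (lift N P v) = hess H x (lift N P v) d :=
      (hs.H_contDiff.contDiffAt.isSymmSndFDerivAt (by simp)).eq _ _
    have hn := hs.norm_lift v
    have hl0 : 0 < ‖lift N P v‖ := by
      rw [hn]
      exact mul_pos (Real.sqrt_pos.2 hs.N_pos') (norm_pos_iff.2 hv0)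
    have hd0' : 0 < ‖d‖ := norm_pos_iff.2 hd0
    have h1 := ha.i x (‖lift N P v‖⁻¹ • lift N P v) (‖d‖⁻¹ • d)
      (Submodule.smul_mem _ _ ⟨lift N P v, by simp [hs.P_lift]⟩)
      (Submodule.smul_mem _ _ ⟨d, by simp [hd]⟩)
      (by rw [norm_smul, norm_inv, norm_norm, inv_mul_cancel₀ hl0.ne'])
      (by rw [norm_smul, norm_inv, norm_norm, inv_mul_cancel₀ hd0'.ne'])
    have h2 : hess H x (‖lift N P v‖⁻¹ • lift N P v) (‖d‖⁻¹ • d) =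
        ‖lift N P v‖⁻¹ * (‖d‖⁻¹ * hess H x (lift N P v) d) := by
      simp only [hess, map_smul, _root_.smul_apply, smul_eq_mul]
      ring
    rw [h2, inv_mul_le_iff₀ hl0, inv_mul_le_iff₀ hd0', hn] at h1
    rw [hsymm]
    linarith
  rw [abs_le]
  constructor
  · have h1 := main (-d) (by rw [map_neg, hd, neg_zero])
    have h2 : hess H x (-d) (lift N P v) = -hess H x d (lift N P v) := by simp [hess]
    rw [h2, norm_neg] at h1
    linarith
  · exact main d hd

lemma abs_fderiv_sub_le (x z : X) (v : Y) (h : P x = P z) :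
    |fderiv ℝ H x (lift N P v) - fderiv ℝ H z (lift N P v)| ≤ κ * √N * ‖v‖ * ‖x - z‖ := by
  set d := x - z with hd
  have hPd : P d = 0 := by rw [hd, map_sub, h, sub_self]
  have hder : ∀ t : ℝ, HasDerivAt (fun t : ℝ => fderiv ℝ H (z + t • d) (lift N P v))
      (hess H (z + t • d) d (lift N P v)) t := fun t => by
    have h1 : HasDerivAt (fun t : ℝ => z + t • d) d t := by
      simpa using ((hasDerivAt_id t).smul_const d).const_add z
    have h2 := (hasFDerivAt_fderiv hs.H_contDiff (z + t • d)).comp_hasDerivAt t h1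
    exact (ContinuousLinearMap.apply ℝ ℝ (lift N P v)).hasFDerivAt.comp_hasDerivAt t h2
  have h1 := (convex_univ (𝕜 := ℝ) (E := ℝ)).norm_image_sub_le_of_norm_hasDerivWithin_le
    (fun t _ => (hder t).hasDerivWithinAt)
    (fun t _ => hs.abs_hess_le ha (z + t • d) d v hPd) (mem_univ 0) (mem_univ 1)
  simp only [one_smul, zero_smul, add_zero, sub_zero, norm_one, mul_one] at h1
  have h3 : z + d = x := by rw [hd]; abel
  rw [h3] at h1
  exact h1

lemma abs_fderiv_fiberProj_sub_le (hκ : 0 ≤ κ) (y v : Y) (x z : X) :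
    |fderiv ℝ H (fiberProj N P y x) (lift N P v) - fderiv ℝ H (fiberProj N P y z) (lift N P v)| ≤
      κ * √N * ‖v‖ * ‖x - z‖ := by
  have hP : ∀ x, P (fiberProj N P y x) = y := fun x => by
    rw [fiberProj, map_add, hs.P_perp, hs.P_lift, zero_add]
  refine (hs.abs_fderiv_sub_le ha _ _ v (by rw [hP, hP])).trans ?_
  rw [fiberProj_sub]
  exact mul_le_mul_of_nonneg_left (hs.norm_perp_le _) (by positivity)

/-- The microscopic force, averaged over a fibre, is the macroscopic force. This is the derivative
at `v = 0` of `lintegral_condMeasure_exp_sub`, taken along the sequence `v / (n + 1)`; the difference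
quotients are dominated because the force grows at most linearly along the fibre and exponentials
of Lipschitz functions are integrable there. -/
lemma integral_force_eq (hκ : 0 ≤ κ) (hρ : 0 < ρ) (v : Y) :
    ∀ᵐ y ∂(macroMeasure P H), ∫ x, fderiv ℝ H x (lift N P v) ∂(condMeasure P H y) =
      N * inner ℝ (gradient Hbar y) v := by
  have hHc := hs.continuous_H
  have hH1 : Continuous (fderiv ℝ H) := hs.H_contDiff.continuous_fderiv (by norm_num)
  set δ : ℕ → ℝ := fun n => 1 / ((n : ℝ) + 1) with hδ
  have hδpos : ∀ n, 0 < δ n := fun n => by positivity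
  have hδle : ∀ n, δ n ≤ 1 := fun n => by
    rw [hδ]; exact (div_le_one (by positivity)).2 (by linarith [n.cast_nonneg (α := ℝ)])
  have hδlim : Tendsto δ atTop (𝓝[≠] 0) :=
    tendsto_nhdsWithin_iff.2 ⟨tendsto_one_div_add_atTop_nhds_zero_nat,
      Eventually.of_forall fun n => (hδpos n).ne'⟩
  filter_upwards [ha.ii, ae_condMeasure_fiber P H,
    ae_all_iff.2 fun n => hs.lintegral_condMeasure_exp_sub (δ n • v)] with y hlsi hfib hexp
  set ν := condMeasure P H y
  set Δ : ℕ → X → ℝ := fun n x => H x - H (x + δ n • lift N P v) with hΔ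
  have hΔc : ∀ n, Continuous (Δ n) := fun n => by simp only [hΔ]; fun_prop
  simp only [map_smul] at hexp
  -- a bound for the difference quotients on the fibre
  obtain ⟨C, hC⟩ : ∃ C, ∀ s ∈ Icc (0 : ℝ) 1,
      |fderiv ℝ H (lift N P (y + s • v)) (lift N P v)| ≤ C := by
    have hlc : Continuous (lift N P) := LinearMap.continuous_of_finiteDimensional _
    have : Continuous fun s : ℝ => fderiv ℝ H (lift N P (y + s • v)) (lift N P v) :=
      (hH1.comp (hlc.comp (by fun_prop))).clm_apply continuous_const
    obtain ⟨C, hC⟩ := isCompact_Icc.exists_bound_of_continuousOn (this.continuousOn (s := Icc 0 1))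
    exact ⟨C, hC⟩
  have hC0 : 0 ≤ C := (abs_nonneg _).trans (hC 0 ⟨le_rfl, zero_le_one⟩)
  set r : X → ℝ := fun x => ‖x - lift N P (P x)‖ with hr
  have hrlip : ∀ x z, |r x - r z| ≤ 1 * ‖x - z‖ := fun x z => by
    rw [one_mul]
    refine (abs_norm_sub_norm_le _ _).trans ?_
    have : x - lift N P (P x) - (z - lift N P (P z)) = (x - z) - lift N P (P (x - z)) := by
      simp only [map_sub]; abel
    rw [this]
    exact hs.norm_perp_le _
  set B : X → ℝ := fun x => C + κ * √N * ‖v‖ * r x with hB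
  have hB0 : ∀ x, 0 ≤ B x := fun x => by
    simp only [hB, hr]; positivity
  have hforce : ∀ x, P x = y → ∀ s ∈ Icc (0 : ℝ) 1,
      |fderiv ℝ H (x + s • lift N P v) (lift N P v)| ≤ B x := fun x hx s hs' => by
    have h1 := hs.abs_fderiv_sub_le ha (x + s • lift N P v) (lift N P (y + s • v)) v (by
      rw [map_add, map_smul, hs.P_lift, hs.P_lift, hx])
    have h2 : x + s • lift N P v - lift N P (y + s • v) = x - lift N P (P x) := by
      rw [map_add, map_smul, hx]; abel
    rw [h2] at h1
    have h3 := hC s hs'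
    have h4 := abs_sub_abs_le_abs_sub (fderiv ℝ H (x + s • lift N P v) (lift N P v))
      (fderiv ℝ H (lift N P (y + s • v)) (lift N P v))
    simp only [hB, hr]
    linarith
  have hline : ∀ x (s : ℝ), HasDerivAt (fun s : ℝ => H (x + s • lift N P v))
      (fderiv ℝ H (x + s • lift N P v) (lift N P v)) s := fun x s => by
    have h1 : HasDerivAt (fun t : ℝ => x + t • lift N P v) (lift N P v) s := by
      simpa using ((hasDerivAt_id s).smul_const (lift N P v)).const_add x
    exact ((hs.H_contDiff.differentiable (by norm_num) _).hasFDerivAt).comp_hasDerivAt s h1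
  have hΔle : ∀ n x, P x = y → |Δ n x| ≤ δ n * B x := fun n x hx => by
    have h1 := (convex_Icc (0 : ℝ) 1).norm_image_sub_le_of_norm_hasDerivWithin_le
      (fun s _ => (hline x s).hasDerivWithinAt) (fun s hs' => hforce x hx s hs')
      (⟨(hδpos n).le, hδle n⟩ : δ n ∈ Icc (0 : ℝ) 1)
      (⟨le_rfl, zero_le_one⟩ : (0 : ℝ) ∈ Icc (0 : ℝ) 1)
    simp only [zero_smul, add_zero, zero_sub, norm_neg, Real.norm_eq_abs,
      abs_of_pos (hδpos n)] at h1
    simp only [hΔ]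
    linarith
  have hexp_int : ∀ n, Integrable (fun x => Real.exp (Δ n x)) ν := fun n => by
    have := hΔc n
    refine ⟨by fun_prop, ?_⟩
    rw [hasFiniteIntegral_iff_ofReal (ae_of_all _ fun x => (Real.exp_pos _).le)]
    simp only [hΔ]
    rw [hexp n]
    exact ENNReal.ofReal_lt_top
  have hexp_eq : ∀ n, ∫ x, Real.exp (Δ n x) ∂ν =
      Real.exp (N * Hbar y - N * Hbar (y + δ n • v)) := fun n => by
    rw [integral_eq_lintegral_of_nonneg_ae (ae_of_all _ fun x => (Real.exp_pos _).le)
      (hexp_int n).aestronglyMeasurable]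
    simp only [hΔ]
    rw [hexp n, ENNReal.toReal_ofReal (Real.exp_pos _).le]
  have hdom : Integrable (fun x => Real.exp (2 * B x)) ν := by
    have h1 := (hlsi.integrable_exp_mul hρ zero_le_one hrlip (2 * (κ * √N * ‖v‖))).const_mul
      (Real.exp (2 * C))
    refine h1.congr (ae_of_all _ fun x => ?_)
    simp only [hB]
    rw [← Real.exp_add]
    ring_nf
  have hlim1 : Tendsto (fun n => ∫ x, (δ n)⁻¹ * (Real.exp (Δ n x) - 1) ∂ν) atTop
      (𝓝 (∫ x, -fderiv ℝ H x (lift N P v) ∂ν)) := by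
    refine tendsto_integral_of_dominated_convergence (fun x => Real.exp (2 * B x))
      (fun n => ?_) hdom (fun n => ?_) (ae_of_all _ fun x => ?_)
    · have := hΔc n
      exact (by fun_prop : Continuous _).aestronglyMeasurable
    · filter_upwards [hfib] with x hx
      have h1 := hΔle n x hx
      have h2 : |Real.exp (Δ n x) - 1| ≤ |Δ n x| * Real.exp |Δ n x| := by
        have h3 := Real.add_one_le_exp (Δ n x)
        have h4 := Real.add_one_le_exp (-Δ n x)
        have h5 : Real.exp (Δ n x) * Real.exp (-Δ n x) = 1 := by rw [← Real.exp_add]; simp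
        have h6 := Real.exp_pos (Δ n x)
        have h7 : 1 ≤ Real.exp |Δ n x| := Real.one_le_exp (abs_nonneg _)
        have h8 : Real.exp (Δ n x) - 1 ≤ Δ n x * Real.exp (Δ n x) := by nlinarith
        rcases abs_cases (Δ n x) with ⟨h9, h10⟩ | ⟨h9, h10⟩
        · rw [h9, abs_of_nonneg (by linarith)]; exact h8
        · rw [h9] at h7 ⊢
          rw [abs_of_nonpos (by nlinarith [h8]), neg_sub]
          nlinarith
      rw [Real.norm_eq_abs, abs_mul, abs_inv, abs_of_pos (hδpos n), inv_mul_le_iff₀ (hδpos n)]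
      have h3 : Real.exp |Δ n x| ≤ Real.exp (B x) :=
        Real.exp_le_exp.2 (h1.trans (mul_le_of_le_one_left (hB0 x) (hδle n)))
      have h4 : B x ≤ Real.exp (B x) := by linarith [Real.add_one_le_exp (B x)]
      calc _ ≤ |Δ n x| * Real.exp |Δ n x| := h2
        _ ≤ (δ n * B x) * Real.exp (B x) := mul_le_mul h1 h3 (Real.exp_pos _).le
            (mul_nonneg (hδpos n).le (hB0 x))
        _ ≤ (δ n * Real.exp (B x)) * Real.exp (B x) :=
            mul_le_mul_of_nonneg_right (mul_le_mul_of_nonneg_left h4 (hδpos n).le)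
              (Real.exp_pos _).le
        _ = δ n * Real.exp (2 * B x) := by rw [mul_assoc, ← Real.exp_add, two_mul]
    · have h1 : HasDerivAt (fun s : ℝ => Real.exp (H x - H (x + s • lift N P v)))
          (-fderiv ℝ H x (lift N P v)) 0 := by
        have := ((hline x 0).const_sub (H x)).exp
        simpa using this
      have h2 := h1.tendsto_slope_zero.comp hδlim
      refine h2.congr fun n => ?_
      simp [hΔ]
  have hlim2 : Tendsto (fun n => (δ n)⁻¹ * (Real.exp (N * Hbar y - N * Hbar (y + δ n • v)) - 1))
      atTop (𝓝 (-(N * inner ℝ (gradient Hbar y) v))) := by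
    have h0 : HasDerivAt (fun t : ℝ => y + t • v) v 0 := by
      simpa using ((hasDerivAt_id (0 : ℝ)).smul_const v).const_add y
    have h0' := ((hs.Hbar_contDiff.differentiable (by norm_num) (y + (0 : ℝ) • v)).hasFDerivAt
      ).comp_hasDerivAt (0 : ℝ) h0
    have h1 : HasDerivAt (fun s : ℝ => Real.exp (N * Hbar y - N * Hbar (y + s • v)))
        (-(N * inner ℝ (gradient Hbar y) v)) 0 := by
      have := ((h0'.const_mul (N : ℝ)).const_sub (N * Hbar y)).exp
      simpa [inner_gradient] using this
    have h2 := h1.tendsto_slope_zero.comp hδlim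
    refine h2.congr fun n => ?_
    simp
  have heq : ∀ n, ∫ x, (δ n)⁻¹ * (Real.exp (Δ n x) - 1) ∂ν =
      (δ n)⁻¹ * (Real.exp (N * Hbar y - N * Hbar (y + δ n • v)) - 1) := fun n => by
    rw [integral_const_mul, integral_sub (hexp_int n) (integrable_const _), hexp_eq n]
    simp
  have := tendsto_nhds_unique (hlim1.congr heq) hlim2
  rw [integral_neg] at this
  linarith

end IsSystem
end Fiber

section ForceFluctuation

variable {X Y : Type*}
  [NormedAddCommGroup X] [InnerProductSpace ℝ X] [FiniteDimensional ℝ X]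
  [MeasurableSpace X] [BorelSpace X]
  [NormedAddCommGroup Y] [InnerProductSpace ℝ Y] [FiniteDimensional ℝ Y]
  [MeasurableSpace Y] [BorelSpace Y]
  {N M : ℕ} {P : X →ₗ[ℝ] Y} {A J : X →ₗ[ℝ] X} {H : X → ℝ} {Hbar : Y → ℝ}
  {f : ℝ → X → ℝ} {η : ℝ → Y} {κ ρ lam Lam α β γ C₁ C₂ c : ℝ}

/-- The fluctuation of the microscopic force: the difference between `N P ∇H` and its conditional
mean `N ∇H̄(P x)`. -/
noncomputable def forceFluct (N : ℕ) (P : X →ₗ[ℝ] Y) (H : X → ℝ) (Hbar : Y → ℝ) (x : X) : Y :=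
  (N : ℝ) • P (gradient H x) - (N : ℝ) • gradient Hbar (P x)

/-- The density `⟨∇u, A ∇u⟩ / u` of the entropy dissipation, with `0 / 0 = 0`. -/
noncomputable def dissipation (A : X →ₗ[ℝ] X) (u : X → ℝ) (x : X) : ℝ≥0∞ :=
  ENNReal.ofReal (inner ℝ (gradient u x) (A (gradient u x))) / ENNReal.ofReal (u x)

namespace IsSystem

variable (hs : IsSystem N M P A J H Hbar f η)
include hs

lemma continuous_forceFluct : Continuous (forceFluct N P H Hbar) := by
  have h1 := continuous_gradient hs.H_contDiff
  have h2 := continuous_gradient hs.Hbar_contDiff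
  have h3 : Continuous P := P.continuous_of_finiteDimensional
  exact ((h3.comp h1).const_smul _).sub ((h2.comp h3).const_smul _)

lemma inner_forceFluct (x : X) (v : Y) : inner ℝ (forceFluct N P H Hbar x) v =
    fderiv ℝ H x (lift N P v) - N * inner ℝ (gradient Hbar (P x)) v := by
  rw [forceFluct, inner_sub_left, real_inner_smul_left, real_inner_smul_left, ← inner_lift_right,
    inner_gradient]

lemma norm_comp_perpCLM (p : X) (l : X →L[ℝ] ℝ) (hl : ∀ v, l v = inner ℝ p v) :
    ‖l.comp (perpCLM N P)‖ ≤ ‖p - lift N P (P p)‖ := by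
  refine ContinuousLinearMap.opNorm_le_bound _ (norm_nonneg _) fun v => ?_
  rw [ContinuousLinearMap.comp_apply, hl, perpCLM_apply, ← hs.inner_perp_left]
  exact abs_real_inner_le_norm _ _

variable (ha : Assumptions N M P A J H Hbar f η κ ρ lam Lam α β γ C₁ C₂ c)
include ha

/-- On almost every fibre the Fisher information of `u` in the directions of the fibre is smaller
than the entropy dissipation by the factor `γ / M²`. The logarithmic Sobolev inequality involves the
full gradient; composition with the projection onto the fibre removes its transversal part without
changing `u` on the fibre. -/
lemma fisherInfo_fiber_le (hγ : 0 ≤ γ) {u : X → ℝ} (hu : ContDiff ℝ 1 u) {y : Y}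
    (hfib : ∀ᵐ x ∂(condMeasure P H y), P x = y) :
    fisherInfo (condMeasure P H y) (u ∘ fiberProj N P y) ≤
      ENNReal.ofReal (γ / (M : ℝ) ^ 2) * ∫⁻ x, dissipation A u x ∂(condMeasure P H y) := by
  rw [← lintegral_const_mul' _ _ ENNReal.ofReal_ne_top]
  refine lintegral_mono_ae ?_
  filter_upwards [hfib] with x hx
  have h1 : HasFDerivAt (u ∘ fiberProj N P y) ((fderiv ℝ u x).comp (perpCLM N P)) x := by
    have h2 : HasFDerivAt u (fderiv ℝ u x) (fiberProj N P y x) := by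
      rw [fiberProj_of_eq hx]
      exact (hu.differentiable (by norm_num) x).hasFDerivAt
    exact h2.comp x (hasFDerivAt_fiberProj y x)
  have h2 := gradNorm_le_of_hasFDerivAt h1
  have h3 := hs.norm_comp_perpCLM (gradient u x) (fderiv ℝ u x) fun v => (inner_gradient x v).symm
  have h4 : gradNorm (u ∘ fiberProj N P y) x ^ 2 ≤
      ENNReal.ofReal (γ / (M : ℝ) ^ 2) *
        ENNReal.ofReal (inner ℝ (gradient u x) (A (gradient u x))) := by
    calc _ ≤ ENNReal.ofReal ‖(fderiv ℝ u x).comp (perpCLM N P)‖ ^ 2 :=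
          pow_le_pow_left₀ zero_le h2 2
      _ = ENNReal.ofReal (‖(fderiv ℝ u x).comp (perpCLM N P)‖ ^ 2) :=
          (ENNReal.ofReal_pow (norm_nonneg _) 2).symm
      _ ≤ ENNReal.ofReal (γ / (M : ℝ) ^ 2 * inner ℝ (gradient u x) (A (gradient u x))) :=
          ENNReal.ofReal_le_ofReal ((pow_le_pow_left₀ (norm_nonneg _) h3 2).trans (ha.vi _))
      _ = _ := ENNReal.ofReal_mul (by positivity)
  rw [dissipation, ← mul_div_assoc, Function.comp_apply, fiberProj_of_eq hx]
  exact ENNReal.div_le_div_right h4 _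

/-- The fluctuations of the microscopic force are of order `√(N M)` in mean square, up to a
contribution of the entropy dissipation. -/
lemma lintegral_forceFluct_le (hκ : 0 < κ) (hρ : 0 < ρ) (hγ : 0 ≤ γ) {u : X → ℝ}
    (hu : ContDiff ℝ 1 u) (hu0 : ∀ x, 0 ≤ u x) :
    ∫⁻ x, ENNReal.ofReal (‖forceFluct N P H Hbar x‖ ^ 2 * u x) ∂(gibbs H) ≤
      ENNReal.ofReal (M * (4 * (κ ^ 2 * N) / ρ)) *
        (ENNReal.ofReal (1 / (2 * ρ) * (γ / (M : ℝ) ^ 2)) * ∫⁻ x, dissipation A u x ∂(gibbs H) +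
          ∫⁻ x, ENNReal.ofReal (u x) ∂(gibbs H)) := by
  have hN := hs.N_pos'
  have huc := hu.continuous
  have hGc := hs.continuous_forceFluct
  have hgu : Continuous (gradient u) :=
    (InnerProductSpace.toDual ℝ X).symm.continuous.comp (hu.continuous_fderiv (by norm_num))
  have hAc : Continuous A := A.continuous_of_finiteDimensional
  have hdm : Measurable (dissipation A u) := by
    have h1 : Continuous fun x => inner ℝ (gradient u x) (A (gradient u x)) :=
      hgu.inner (hAc.comp hgu)
    have h2 := h1.measurable
    have h3 := huc.measurable
    unfold dissipation
    fun_prop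
  set b := stdOrthonormalBasis ℝ Y with hb
  have hfiber : ∀ᵐ y ∂(macroMeasure P H),
      ∫⁻ x, ENNReal.ofReal (‖forceFluct N P H Hbar x‖ ^ 2 * u x) ∂(condMeasure P H y) ≤
      ENNReal.ofReal (M * (4 * (κ ^ 2 * N) / ρ)) *
        (ENNReal.ofReal (1 / (2 * ρ) * (γ / (M : ℝ) ^ 2)) *
          ∫⁻ x, dissipation A u x ∂(condMeasure P H y) +
          ∫⁻ x, ENNReal.ofReal (u x) ∂(condMeasure P H y)) := by
    filter_upwards [ha.ii, ae_condMeasure_fiber P H,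
      ae_all_iff.2 fun i => hs.integral_force_eq ha hκ.le hρ (b i)] with y hlsi hfib hmean
    set ν := condMeasure P H y
    set R : ℝ≥0∞ := ENNReal.ofReal (1 / (2 * ρ) * (γ / (M : ℝ) ^ 2)) *
      ∫⁻ x, dissipation A u x ∂ν + ∫⁻ x, ENNReal.ofReal (u x) ∂ν with hR
    have hcomp : ∀ i, ∫⁻ x, ENNReal.ofReal (inner ℝ (forceFluct N P H Hbar x) (b i) ^ 2 * u x) ∂ν ≤
        ENNReal.ofReal (4 * (κ ^ 2 * N) / ρ) * R := fun i => by
      set g : X → ℝ := fun x => fderiv ℝ H (fiberProj N P y x) (lift N P (b i)) -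
        N * inner ℝ (gradient Hbar y) (b i) with hg
      have hbi : ‖b i‖ = 1 := b.orthonormal.1 i
      have hL : 0 < κ * √N := mul_pos hκ (Real.sqrt_pos.2 hN)
      have hglip : ∀ x z, |g x - g z| ≤ κ * √N * ‖x - z‖ := fun x z => by
        have h1 := hs.abs_fderiv_fiberProj_sub_le ha hκ.le y (b i) x z
        rw [hbi, mul_one] at h1
        simpa [hg] using h1
      have hae : ∀ᵐ x ∂ν, fderiv ℝ H (fiberProj N P y x) (lift N P (b i)) =
          fderiv ℝ H x (lift N P (b i)) := by
        filter_upwards [hfib] with x hx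
        rw [fiberProj_of_eq hx]
      have hgi : Integrable (fun x => fderiv ℝ H (fiberProj N P y x) (lift N P (b i))) ν :=
        ((hlsi.integrable hρ hL.le hglip).add (integrable_const
          (N * inner ℝ (gradient Hbar y) (b i)))).congr (ae_of_all _ fun x => by simp [hg])
      have hg0 : ∫ x, g x ∂ν = 0 := by
        simp only [hg]
        rw [integral_sub hgi (integrable_const _), integral_congr_ae hae, hmean i]
        simp
      have h1 := hlsi.lintegral_sq_mul_le hρ hL hglip hg0 (u := u ∘ fiberProj N P y)
        (hu.comp (contDiff_fiberProj y)).locallyLipschitz (fun x => hu0 _)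
      have h2 : (κ * √N) ^ 2 = κ ^ 2 * N := by rw [mul_pow, Real.sq_sqrt hN.le]
      rw [h2] at h1
      calc ∫⁻ x, ENNReal.ofReal (inner ℝ (forceFluct N P H Hbar x) (b i) ^ 2 * u x) ∂ν
          = ∫⁻ x, ENNReal.ofReal (g x ^ 2 * (u ∘ fiberProj N P y) x) ∂ν := by
            refine lintegral_congr_ae ?_
            filter_upwards [hfib] with x hx
            simp only [hg, Function.comp_apply, fiberProj_of_eq hx, hs.inner_forceFluct, hx]
        _ ≤ _ := h1
        _ ≤ ENNReal.ofReal (4 * (κ ^ 2 * N) / ρ) * R := by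
            refine mul_le_mul_right (add_le_add ?_ (le_of_eq ?_)) _
            · rw [ENNReal.ofReal_mul (by positivity), mul_assoc]
              exact mul_le_mul_right (hs.fisherInfo_fiber_le ha hγ hu hfib) _
            · refine lintegral_congr_ae ?_
              filter_upwards [hfib] with x hx
              simp only [Function.comp_apply, fiberProj_of_eq hx]
    calc ∫⁻ x, ENNReal.ofReal (‖forceFluct N P H Hbar x‖ ^ 2 * u x) ∂ν
        = ∫⁻ x, ∑ i, ENNReal.ofReal (inner ℝ (forceFluct N P H Hbar x) (b i) ^ 2 * u x) ∂ν := by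
          refine lintegral_congr fun x => ?_
          rw [← ENNReal.ofReal_sum_of_nonneg fun i _ => mul_nonneg (sq_nonneg _) (hu0 x),
            ← Finset.sum_mul, ← b.sum_sq_inner_left]
      _ = ∑ i, ∫⁻ x, ENNReal.ofReal (inner ℝ (forceFluct N P H Hbar x) (b i) ^ 2 * u x) ∂ν := by
          refine lintegral_finsetSum _ fun i _ => ?_
          have h1 : Continuous fun x => inner ℝ (forceFluct N P H Hbar x) (b i) ^ 2 * u x :=
            ((hGc.inner continuous_const).pow 2).mul huc
          exact h1.measurable.ennreal_ofReal
      _ ≤ ∑ _i : Fin (Module.finrank ℝ Y), ENNReal.ofReal (4 * (κ ^ 2 * N) / ρ) * R :=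
          Finset.sum_le_sum fun i _ => hcomp i
      _ = (Module.finrank ℝ Y : ℝ≥0∞) * (ENNReal.ofReal (4 * (κ ^ 2 * N) / ρ) * R) := by simp
      _ ≤ (M : ℝ≥0∞) * (ENNReal.ofReal (4 * (κ ^ 2 * N) / ρ) * R) :=
          mul_le_mul_left (by exact_mod_cast hs.finrank_Y) _
      _ = _ := by
          rw [ENNReal.ofReal_mul (Nat.cast_nonneg M), ENNReal.ofReal_natCast, mul_assoc]
  have hGm := hGc.measurable
  have hum := huc.measurable
  have hdis : ∀ F : X → ℝ≥0∞, Measurable F → ∫⁻ x, F x ∂(gibbs H) =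
      ∫⁻ y, ∫⁻ x, F x ∂(condMeasure P H y) ∂(macroMeasure P H) := fun F hF =>
    (lintegral_condMeasure P H (F := fun p => F p.2) (by fun_prop)).symm
  have hkm : ∀ F : X → ℝ≥0∞, Measurable F →
      Measurable fun y => ∫⁻ x, F x ∂(condMeasure P H y) := fun F hF =>
    Measurable.lintegral_kernel
      (κ := ProbabilityTheory.condDistrib (id : X → X) P (gibbs H)) hF
  have hum' : Measurable fun x => ENNReal.ofReal (u x) := hum.ennreal_ofReal
  rw [hdis _ (by fun_prop), hdis _ hdm, hdis _ hum']
  refine (lintegral_mono_ae hfiber).trans (le_of_eq ?_)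
  rw [lintegral_const_mul' _ _ ENNReal.ofReal_ne_top,
    lintegral_add_left ((hkm _ hdm).const_mul _), lintegral_const_mul' _ _ ENNReal.ofReal_ne_top]

end IsSystem
end ForceFluctuation

/-! ### Cutoff functions and integration by parts -/

section Cutoff

variable {X : Type*}
  [NormedAddCommGroup X] [InnerProductSpace ℝ X] [FiniteDimensional ℝ X]
  [MeasurableSpace X] [BorelSpace X]

variable (X) in
/-- A fixed smooth bump function, equal to `1` on the unit ball and supported in the ball of
radius `2`. -/
noncomputable def bump : ContDiffBump (0 : X) := ⟨1, 2, one_pos, one_lt_two⟩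

/-- Smooth cutoff functions, equal to `1` on the ball of radius `k + 1`. -/
noncomputable def cutoff (k : ℕ) (x : X) : ℝ := bump X (((k : ℝ) + 1)⁻¹ • x)

lemma cutoff_contDiff (k : ℕ) : ContDiff ℝ 1 (cutoff (X := X) k) :=
  (bump X).contDiff.comp (by fun_prop)

lemma cutoff_continuous (k : ℕ) : Continuous (cutoff (X := X) k) := (cutoff_contDiff k).continuous

lemma cutoff_nonneg (k : ℕ) (x : X) : 0 ≤ cutoff k x := (bump X).nonneg

lemma cutoff_le_one (k : ℕ) (x : X) : cutoff k x ≤ 1 := (bump X).le_one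

lemma cutoff_eventually_eq_one (x : X) : ∀ᶠ k : ℕ in atTop, cutoff k x = 1 := by
  filter_upwards [eventually_ge_atTop ⌈‖x‖⌉₊] with k hk
  refine (bump X).one_of_mem_closedBall ?_
  have h1 : ‖x‖ ≤ k := (Nat.le_ceil _).trans (by exact_mod_cast hk)
  rw [mem_closedBall_zero_iff, norm_smul, norm_inv, Real.norm_of_nonneg (by positivity)]
  change _ ≤ (1 : ℝ)
  rw [inv_mul_le_iff₀ (by positivity)]
  linarith

lemma cutoff_eq_zero {k : ℕ} {x : X} (hx : x ∉ Metric.closedBall (0 : X) (2 * ((k : ℝ) + 1))) :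
    cutoff k x = 0 := by
  refine (bump X).zero_of_le_dist ?_
  rw [mem_closedBall_zero_iff, not_le] at hx
  rw [dist_zero_right, norm_smul, norm_inv, Real.norm_of_nonneg (by positivity)]
  change (2 : ℝ) ≤ _
  rw [le_inv_mul_iff₀ (by positivity)]
  linarith

lemma cutoff_fderiv_eq_zero {k : ℕ} {x : X}
    (hx : x ∉ Metric.closedBall (0 : X) (2 * ((k : ℝ) + 1))) :
    fderiv ℝ (cutoff (X := X) k) x = 0 := by
  have : cutoff (X := X) k =ᶠ[𝓝 x] fun _ => 0 := by
    filter_upwards [Metric.isClosed_closedBall.isOpen_compl.mem_nhds hx] with z hz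
    exact cutoff_eq_zero hz
  rw [this.fderiv_eq]; simp

lemma hasFDerivAt_cutoff (k : ℕ) (x : X) :
    HasFDerivAt (cutoff k) (fderiv ℝ (cutoff (X := X) k) x) x :=
  ((cutoff_contDiff k).differentiable (by norm_num) x).hasFDerivAt

lemma continuous_fderiv_cutoff (k : ℕ) : Continuous (fderiv ℝ (cutoff (X := X) k)) :=
  (cutoff_contDiff k).continuous_fderiv (by norm_num)

variable (X) in
lemma exists_cutoff_bound : ∃ B : ℝ, 0 ≤ B ∧
    (∀ (k : ℕ) (x : X), ‖fderiv ℝ (cutoff (X := X) k) x‖ ≤ B / ((k : ℝ) + 1)) ∧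
    ∀ (k : ℕ) (x : X), (1 + ‖x‖) * ‖fderiv ℝ (cutoff (X := X) k) x‖ ≤ 3 * B := by
  have hc : Continuous (fderiv ℝ (bump X)) := (bump X).contDiff.continuous_fderiv one_ne_zero
  have hcs : HasCompactSupport (fderiv ℝ (bump X)) := (bump X).hasCompactSupport.fderiv ℝ
  obtain ⟨B, hB⟩ := hcs.exists_bound_of_continuous hc
  have hB0 : 0 ≤ B := (norm_nonneg _).trans (hB 0)
  have h1 : ∀ (k : ℕ) (x : X), ‖fderiv ℝ (cutoff (X := X) k) x‖ ≤ B / ((k : ℝ) + 1) := by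
    intro k x
    have hk : (0 : ℝ) < (k : ℝ) + 1 := by positivity
    have : fderiv ℝ (cutoff (X := X) k) x =
        ((k : ℝ) + 1)⁻¹ • fderiv ℝ (bump X) (((k : ℝ) + 1)⁻¹ • x) :=
      fderiv_comp_smul _
    rw [this, norm_smul, norm_inv, Real.norm_of_nonneg hk.le, inv_mul_le_iff₀ hk,
      mul_div_cancel₀ _ hk.ne']
    exact hB _
  refine ⟨B, hB0, h1, fun k x => ?_⟩
  have hk : (0 : ℝ) < (k : ℝ) + 1 := by positivity
  by_cases hx : x ∈ Metric.closedBall (0 : X) (2 * ((k : ℝ) + 1))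
  · rw [mem_closedBall_zero_iff] at hx
    calc _ ≤ (3 * ((k : ℝ) + 1)) * (B / ((k : ℝ) + 1)) :=
          mul_le_mul (by linarith [k.cast_nonneg (α := ℝ)]) (h1 k x) (norm_nonneg _) (by positivity)
      _ = 3 * B := by field_simp
  · rw [cutoff_fderiv_eq_zero hx, norm_zero, mul_zero]; positivity

/-- Integration by parts against a compactly supported function. -/
lemma integral_mul_divergence {ψ : X → ℝ} {ψ' : X → X →L[ℝ] ℝ} (hψ : ∀ x, HasFDerivAt ψ (ψ' x) x)
    (hψ' : Continuous ψ') (hs : HasCompactSupport ψ) {V : X → X} (hV : ContDiff ℝ 1 V) :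
    ∫ x, ψ x * divergence V x = -∫ x, ψ' x (V x) := by
  have hψc : Continuous ψ := continuous_iff_continuousAt.2 fun x => (hψ x).continuousAt
  have hVc := hV.continuous
  have hVd : Continuous (fderiv ℝ V) := hV.continuous_fderiv (by norm_num)
  set b := stdOrthonormalBasis ℝ X
  have hψeq : ψ' = fderiv ℝ ψ := funext fun x => (hψ x).fderiv.symm
  have hs' : HasCompactSupport ψ' := by rw [hψeq]; exact hs.fderiv ℝ
  have hVi : ∀ i x, HasFDerivAt (fun x => inner ℝ (b i) (V x))
      ((innerSL ℝ (b i)).comp (fderiv ℝ V x)) x := fun i x =>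
    (innerSL ℝ (b i)).hasFDerivAt.comp x (hV.differentiable (by norm_num) x).hasFDerivAt
  have hi1 : ∀ i, Integrable (fun x => ψ' x (b i) * inner ℝ (b i) (V x)) := fun i => by
    refine Continuous.integrable_of_hasCompactSupport (by fun_prop) ?_
    refine (hs'.mono (f' := fun x => ψ' x (b i) * inner ℝ (b i) (V x)) fun x hx => ?_)
    intro h0
    exact hx (by simp only; rw [h0]; simp)
  have hi2 : ∀ i, Integrable (fun x => ψ x * inner ℝ (b i) (fderiv ℝ V x (b i))) := fun i => by
    refine Continuous.integrable_of_hasCompactSupport (by fun_prop) ?_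
    exact hs.mul_right
  have hi3 : ∀ i, Integrable (fun x => ψ x * inner ℝ (b i) (V x)) := fun i => by
    refine Continuous.integrable_of_hasCompactSupport (by fun_prop) ?_
    exact hs.mul_right
  have hibp : ∀ i, ∫ x, ψ x * inner ℝ (b i) (fderiv ℝ V x (b i)) =
      -∫ x, ψ' x (b i) * inner ℝ (b i) (V x) := fun i =>
    integral_bilinear_hasFDerivAt_right_eq_neg_left_of_integrable
      (B := ContinuousLinearMap.mul ℝ ℝ) (v := b i) (hi1 i) (hi2 i) (hi3 i)
      (fun x _ => hψ x) (fun x _ => hVi i x)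
  have hdiv : ∀ x, ψ x * divergence V x = ∑ i, ψ x * inner ℝ (b i) (fderiv ℝ V x (b i)) := by
    intro x
    rw [divergence, LinearMap.trace_eq_sum_inner _ b, Finset.mul_sum]
    rfl
  have hsum : ∀ x, ψ' x (V x) = ∑ i, ψ' x (b i) * inner ℝ (b i) (V x) := by
    intro x
    conv_lhs => rw [← b.sum_repr' (V x)]
    rw [map_sum]
    refine Finset.sum_congr rfl fun i _ => ?_
    rw [map_smul, smul_eq_mul, mul_comm]
  simp_rw [hdiv, hsum]
  rw [integral_finsetSum _ fun i _ => hi2 i, integral_finsetSum _ fun i _ => hi1 i,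
    ← Finset.sum_neg_distrib]
  exact Finset.sum_congr rfl fun i _ => hibp i

end Cutoff

/-! ### The weak formulation of the Fokker-Planck equation -/

section Weak

variable {X Y : Type*}
  [NormedAddCommGroup X] [InnerProductSpace ℝ X] [FiniteDimensional ℝ X]
  [MeasurableSpace X] [BorelSpace X]
  [NormedAddCommGroup Y] [InnerProductSpace ℝ Y] [FiniteDimensional ℝ Y]
  [MeasurableSpace Y] [BorelSpace Y]
  {N M : ℕ} {P : X →ₗ[ℝ] Y} {A J : X →ₗ[ℝ] X} {H : X → ℝ} {Hbar : Y → ℝ}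
  {f : ℝ → X → ℝ} {η : ℝ → Y} {κ ρ lam Lam α β γ C₁ C₂ c : ℝ}

/-- The product of Lebesgue measure on the time interval `(s, t]` with the Gibbs measure. -/
noncomputable def spaceTime (H : X → ℝ) (s t : ℝ) : Measure (ℝ × X) :=
  ((volume : Measure ℝ).restrict (Ioc s t)).prod (gibbs H)

/-- The flux `exp (-H) (A + J) ∇f` of the Fokker-Planck equation. -/
noncomputable def flux (A J : X →ₗ[ℝ] X) (H : X → ℝ) (u : X → ℝ) (x : X) : X :=
  Real.exp (-H x) • (A + J) (gradient u x)

lemma spaceTime_eq_restrict (H : X → ℝ) (s t : ℝ) :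
    spaceTime H s t = ((volume : Measure ℝ).prod (gibbs H)).restrict (Ioc s t ×ˢ univ) := by
  rw [spaceTime, ← Measure.prod_restrict, Measure.restrict_univ]

lemma ae_spaceTime (H : X → ℝ) (s t : ℝ) : ∀ᵐ p ∂(spaceTime H s t), p.1 ∈ Ioc s t := by
  rw [spaceTime_eq_restrict]
  filter_upwards [ae_restrict_mem (measurableSet_Ioc.prod MeasurableSet.univ)] with p hp
  exact hp.1

lemma aestronglyMeasurable_spaceTime {E : Type*} [NormedAddCommGroup E]
    [SecondCountableTopologyEither (ℝ × X) E] {F : ℝ × X → E} {s t : ℝ}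
    (hF : ContinuousOn F (Ioc s t ×ˢ univ)) : AEStronglyMeasurable F (spaceTime H s t) := by
  rw [spaceTime_eq_restrict]
  exact hF.aestronglyMeasurable (measurableSet_Ioc.prod MeasurableSet.univ)

/-- Continuous functions with compact support in space are integrable over bounded time
intervals. -/
lemma integrable_prod_of_support {ν : Measure X} [IsFiniteMeasureOnCompacts ν] [SFinite ν]
    {F : ℝ × X → ℝ} {s t : ℝ} {K : Set X} (hK : IsCompact K)
    (hF : ContinuousOn F (Icc s t ×ˢ univ)) (h0 : ∀ p : ℝ × X, p.2 ∉ K → F p = 0) :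
    Integrable F (((volume : Measure ℝ).restrict (Ioc s t)).prod ν) := by
  have h1 : IntegrableOn F (Icc s t ×ˢ K) ((volume : Measure ℝ).prod ν) :=
    (hF.mono (prod_mono le_rfl (subset_univ _))).integrableOn_compact (isCompact_Icc.prod hK)
  have h2 : IntegrableOn F (Ioc s t ×ˢ univ) ((volume : Measure ℝ).prod ν) := by
    refine (h1.mono_set (prod_mono Ioc_subset_Icc_self le_rfl)).of_forall_sdiff_eq_zero
      (measurableSet_Ioc.prod MeasurableSet.univ) fun p hp => h0 p fun hpK => hp.2 ⟨hp.1.1, hpK⟩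
  have h3 : ((volume : Measure ℝ).restrict (Ioc s t)).prod ν =
      ((volume : Measure ℝ).prod ν).restrict (Ioc s t ×ˢ univ) := by
    rw [← Measure.prod_restrict, Measure.restrict_univ]
  rw [h3]
  exact h2

variable (X) in
/-- The Riesz isomorphism as a continuous linear map. -/
noncomputable def riesz : (X →L[ℝ] ℝ) →L[ℝ] X :=
  LinearMap.toContinuousLinearMap
    { toFun := fun l => (InnerProductSpace.toDual ℝ X).symm l
      map_add' := fun l l' => by simp
      map_smul' := fun r l => by simp }

lemma hasFDerivAt_gradient {u : X → ℝ} (hu : ContDiff ℝ 2 u) (x : X) :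
    HasFDerivAt (gradient u)
      ((riesz X).comp (fderiv ℝ (fderiv ℝ u) x)) x :=
  (riesz X).hasFDerivAt.comp x (hasFDerivAt_fderiv hu x)

namespace IsSystem

variable (hs : IsSystem N M P A J H Hbar f η)
include hs

lemma integral_gibbs (F : X → ℝ) : ∫ x, F x ∂(gibbs H) =
    (∫ x, Real.exp (-H x))⁻¹ * ∫ x, F x * Real.exp (-H x) := by
  rw [gibbs, integral_tilted, ← integral_const_mul]
  refine integral_congr_ae (ae_of_all _ fun x => ?_)
  simp only [smul_eq_mul]
  ring

lemma hasFDerivAt_flux {t : ℝ} (ht : 0 < t) (x : X) :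
    HasFDerivAt (flux A J H (f t))
      (Real.exp (-H x) • ((A + J).toContinuousLinearMap.comp
        ((riesz X).comp (fderiv ℝ (fderiv ℝ (f t)) x))) +
        (Real.exp (-H x) • -fderiv ℝ H x).smulRight ((A + J) (gradient (f t) x))) x := by
  have h1 : HasFDerivAt (fun x => (A + J) (gradient (f t) x)) _ x :=
    (A + J).toContinuousLinearMap.hasFDerivAt.comp x
      (hasFDerivAt_gradient (hs.micro_sol.contDiff t ht) x)
  have h2 : HasFDerivAt (fun x => Real.exp (-H x)) (Real.exp (-H x) • -fderiv ℝ H x) x :=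
    ((hs.H_contDiff.differentiable (by norm_num) x).hasFDerivAt.neg).exp
  exact h2.smul h1

lemma continuousOn_gradient :
    ContinuousOn (fun p : ℝ × X => gradient (f p.1) p.2) (Ioi 0 ×ˢ univ) :=
  (InnerProductSpace.toDual ℝ X).symm.continuous.comp_continuousOn hs.micro_sol.continuousOn_fderiv

lemma continuousOn_fderiv_flux :
    ContinuousOn (fun p : ℝ × X => fderiv ℝ (flux A J H (f p.1)) p.2) (Ioi 0 ×ˢ univ) := by
  have hH1 : Continuous (fderiv ℝ H) := hs.H_contDiff.continuous_fderiv (by norm_num)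
  have hHc := hs.continuous_H
  have h1 := hs.continuousOn_gradient
  have h2 := hs.micro_sol.continuousOn_fderiv2
  have hAJ : Continuous (A + J) := LinearMap.continuous_of_finiteDimensional _
  have h3 : ContinuousOn (fun p : ℝ × X => (A + J) (gradient (f p.1) p.2)) (Ioi 0 ×ˢ univ) :=
    hAJ.comp_continuousOn h1
  have h4 : Continuous fun p : ℝ × X => Real.exp (-H p.2) := by fun_prop
  have h5 : Continuous fun p : ℝ × X => Real.exp (-H p.2) • -fderiv ℝ H p.2 :=
    h4.smul (hH1.comp continuous_snd).neg
  refine ContinuousOn.congr (f := fun p : ℝ × X =>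
    Real.exp (-H p.2) • ((A + J).toContinuousLinearMap.comp
        ((riesz X).comp (fderiv ℝ (fderiv ℝ (f p.1)) p.2))) +
        (Real.exp (-H p.2) • -fderiv ℝ H p.2).smulRight ((A + J) (gradient (f p.1) p.2)))
    ?_ fun p hp => (hs.hasFDerivAt_flux hp.1 p.2).fderiv
  refine (h4.continuousOn.smul ((continuousOn_const.clm_comp
    (continuousOn_const.clm_comp h2)))).add ?_
  exact (ContinuousLinearMap.smulRightL ℝ X X).isBoundedBilinearMap.continuous.comp_continuousOn
    (h5.continuousOn.prodMk h3)

lemma contDiff_flux {t : ℝ} (ht : 0 < t) : ContDiff ℝ 1 (flux A J H (f t)) := by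
  rw [contDiff_one_iff_fderiv]
  refine ⟨fun x => (hs.hasFDerivAt_flux ht x).differentiableAt, ?_⟩
  have h := hs.continuousOn_fderiv_flux.comp_continuous (f := fun x : X => (t, x)) (by fun_prop)
    fun x => ⟨ht, mem_univ _⟩
  exact h

lemma continuousOn_divergence_flux :
    ContinuousOn (fun p : ℝ × X => divergence (flux A J H (f p.1)) p.2) (Ioi 0 ×ˢ univ) := by
  set tr : (X →L[ℝ] X) →ₗ[ℝ] ℝ := (LinearMap.trace ℝ X).comp
    (ContinuousLinearMap.coeLM ℝ) with htr
  have : Continuous tr := LinearMap.continuous_of_finiteDimensional _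
  exact this.comp_continuousOn hs.continuousOn_fderiv_flux

lemma continuousOn_f {s t : ℝ} (hst : 0 < s) :
    ContinuousOn (fun p : ℝ × X => f p.1 p.2) (Icc s t ×ˢ univ) :=
  hs.micro_sol.continuousOn.mono (prod_mono (fun _ h => lt_of_lt_of_le hst h.1) le_rfl)

/-- The Fokker-Planck equation tested on `(s, t] × X`. The function `U` is the quantity
whose change is computed, `ψ` the multiplier of the equation in `∂ₜ U`, and `e` the part of
`∂ₜ U` that does not come from the equation. -/
lemma weak_identity {s t : ℝ} (hs0 : 0 < s) (hst : s ≤ t) {U ψ e : ℝ → X → ℝ}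
    {ψ' : ℝ → X → X →L[ℝ] ℝ} {K : Set X} (hK : IsCompact K)
    (hU : ∀ τ ∈ Icc s t, ∀ x, HasDerivAt (fun r => U r x * Real.exp (-H x))
      (ψ τ x * divergence (flux A J H (f τ)) x + e τ x * Real.exp (-H x)) τ)
    (hψd : ∀ τ ∈ Icc s t, ∀ x, HasFDerivAt (ψ τ) (ψ' τ x) x)
    (hUc : ∀ τ ∈ Icc s t, Continuous (U τ))
    (hψc : ContinuousOn (fun p : ℝ × X => ψ p.1 p.2) (Icc s t ×ˢ univ))
    (hψ'c : ContinuousOn (fun p : ℝ × X => ψ' p.1 p.2) (Icc s t ×ˢ univ))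
    (hec : ContinuousOn (fun p : ℝ × X => e p.1 p.2) (Icc s t ×ˢ univ))
    (hUK : ∀ τ x, x ∉ K → U τ x = 0) (hψK : ∀ τ x, x ∉ K → ψ τ x = 0)
    (hψ'K : ∀ τ x, x ∉ K → ψ' τ x = 0) (heK : ∀ τ x, x ∉ K → e τ x = 0) :
    Integrable (fun p : ℝ × X => e p.1 p.2 - ψ' p.1 p.2 ((A + J) (gradient (f p.1) p.2)))
        (spaceTime H s t) ∧
      ∫ x, U t x ∂(gibbs H) - ∫ x, U s x ∂(gibbs H) =
        ∫ p, (e p.1 p.2 - ψ' p.1 p.2 ((A + J) (gradient (f p.1) p.2))) ∂(spaceTime H s t) := by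
  have hpos : ∀ τ ∈ Icc s t, 0 < τ := fun τ hτ => hs0.trans_le hτ.1
  have hsub : Icc s t ×ˢ (univ : Set X) ⊆ Ioi 0 ×ˢ univ :=
    prod_mono (fun τ hτ => hpos τ hτ) le_rfl
  have hHc := hs.continuous_H
  have hAJ : Continuous (A + J) := LinearMap.continuous_of_finiteDimensional _
  have hgrad := hs.continuousOn_gradient.mono hsub
  have hEc : ContinuousOn (fun p : ℝ × X => Real.exp (-H p.2)) (Icc s t ×ˢ univ) := by fun_prop
  have hFc : ContinuousOn
      (fun p : ℝ × X => e p.1 p.2 - ψ' p.1 p.2 ((A + J) (gradient (f p.1) p.2)))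
      (Icc s t ×ˢ univ) :=
    hec.sub (hψ'c.clm_apply (hAJ.comp_continuousOn hgrad))
  have hF0 : ∀ p : ℝ × X, p.2 ∉ K →
      e p.1 p.2 - ψ' p.1 p.2 ((A + J) (gradient (f p.1) p.2)) = 0 := fun p hp => by
    rw [heK _ _ hp, hψ'K _ _ hp]; simp
  have hint := integrable_prod_of_support (ν := gibbs H) hK hFc hF0
  refine ⟨hint, ?_⟩
  set D : ℝ × X → ℝ := fun p =>
    ψ p.1 p.2 * divergence (flux A J H (f p.1)) p.2 + e p.1 p.2 * Real.exp (-H p.2)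
  have hDc : ContinuousOn D (Icc s t ×ˢ univ) :=
    (hψc.mul (hs.continuousOn_divergence_flux.mono hsub)).add (hec.mul hEc)
  have hD0 : ∀ p : ℝ × X, p.2 ∉ K → D p = 0 := fun p hp => by
    simp only [D]
    rw [heK _ _ hp, hψK _ _ hp]; simp
  have hDint : Integrable D (((volume : Measure ℝ).restrict (Ioc s t)).prod volume) :=
    integrable_prod_of_support (ν := (volume : Measure X)) hK hDc hD0
  have hUint : ∀ τ ∈ Icc s t, Integrable (fun x => U τ x * Real.exp (-H x)) := fun τ hτ => by
    have := hUc τ hτ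
    refine Continuous.integrable_of_hasCompactSupport (by fun_prop) ?_
    exact HasCompactSupport.intro hK fun x hx => by rw [hUK τ x hx, zero_mul]
  have hftc : ∀ x, U t x * Real.exp (-H x) - U s x * Real.exp (-H x) =
      ∫ τ in Ioc s t, D (τ, x) := fun x => by
    rw [← intervalIntegral.integral_of_le hst]
    have hcx : ContinuousOn (fun τ => D (τ, x)) (Icc s t) :=
      hDc.comp (f := fun τ : ℝ => (τ, x)) (by fun_prop) fun τ hτ => ⟨hτ, mem_univ _⟩
    refine (intervalIntegral.integral_eq_sub_of_hasDerivAt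
      (f := fun r => U r x * Real.exp (-H x)) (fun τ hτ => ?_) ?_).symm
    · rw [uIcc_of_le hst] at hτ
      exact hU τ hτ x
    · exact ContinuousOn.intervalIntegrable (by rwa [uIcc_of_le hst])
  have hx : ∀ τ ∈ Ioc s t, ∫ x, D (τ, x) =
      ∫ x, (e τ x - ψ' τ x ((A + J) (gradient (f τ) x))) * Real.exp (-H x) := fun τ hτ => by
    have hτ' : τ ∈ Icc s t := Ioc_subset_Icc_self hτ
    have hline : Continuous fun x : X => (τ, x) := by fun_prop
    have hψ'cx : Continuous (ψ' τ) :=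
      hψ'c.comp_continuous hline fun x => ⟨hτ', mem_univ _⟩
    have hψcx : Continuous (ψ τ) := hψc.comp_continuous hline fun x => ⟨hτ', mem_univ _⟩
    have hecx : Continuous (e τ) := hec.comp_continuous hline fun x => ⟨hτ', mem_univ _⟩
    have hfl := hs.contDiff_flux (hpos τ hτ')
    have hcs : HasCompactSupport (ψ τ) := HasCompactSupport.intro hK (hψK τ)
    have hibp := integral_mul_divergence (hψd τ hτ') hψ'cx hcs hfl
    have hdivc : Continuous (divergence (flux A J H (f τ))) :=
      hs.continuousOn_divergence_flux.comp_continuous hline fun x => ⟨hpos τ hτ', mem_univ _⟩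
    have h1 : Integrable fun x => ψ τ x * divergence (flux A J H (f τ)) x :=
      Continuous.integrable_of_hasCompactSupport (by fun_prop) hcs.mul_right
    have h2 : Integrable fun x => e τ x * Real.exp (-H x) :=
      Continuous.integrable_of_hasCompactSupport (by fun_prop)
        (HasCompactSupport.intro hK fun x hx => by rw [heK τ x hx, zero_mul])
    have h3 : Integrable fun x => ψ' τ x (flux A J H (f τ) x) := by
      have := hfl.continuous
      exact Continuous.integrable_of_hasCompactSupport (by fun_prop)
        (HasCompactSupport.intro hK fun x hx => by rw [hψ'K τ x hx]; simp)
    simp only [D]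
    have h4 := integral_add h3.neg h2
    simp only [Pi.neg_apply, integral_neg] at h4
    rw [integral_add h1 h2, hibp, ← h4]
    refine integral_congr_ae (ae_of_all _ fun x => ?_)
    simp only [flux, map_smul, smul_eq_mul]
    ring
  have hswap : ∫ x, (∫ τ in Ioc s t, D (τ, x)) = ∫ τ in Ioc s t, ∫ x, D (τ, x) :=
    (integral_integral_swap (f := fun (τ : ℝ) (x : X) => D (τ, x)) hDint).symm
  rw [spaceTime, integral_prod _ hint, hs.integral_gibbs, hs.integral_gibbs, ← mul_sub,
    ← integral_sub (hUint t ⟨hst, le_rfl⟩) (hUint s ⟨le_rfl, hst⟩)]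
  simp_rw [hftc]
  rw [hswap, ← integral_const_mul]
  refine setIntegral_congr_fun measurableSet_Ioc fun τ hτ => ?_
  rw [hx τ hτ, hs.integral_gibbs]

end IsSystem
end Weak

/-! ### Entropy dissipation -/

section Entropy

/-- The derivative of `regEntropy`; it is bounded on `[0, ∞)`. -/
noncomputable def regEntropyDeriv (ε : ℝ) (s : ℝ) : ℝ :=
  Real.log (s + ε) - Real.log (s + ε⁻¹) - (Real.log (1 + ε) - Real.log (1 + ε⁻¹))

/-- A convex function of linear growth below `s log s - s + 1`, with second derivative
`1 / (s + ε) - 1 / (s + 1 / ε)`, normalised to vanish to second order at `s = 1`. -/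
noncomputable def regEntropy (ε : ℝ) (s : ℝ) : ℝ :=
  (s + ε) * Real.log (s + ε) - (s + ε⁻¹) * Real.log (s + ε⁻¹) -
    (Real.log (1 + ε) - Real.log (1 + ε⁻¹)) * s -
    ((1 + ε) * Real.log (1 + ε) - (1 + ε⁻¹) * Real.log (1 + ε⁻¹) -
      (Real.log (1 + ε) - Real.log (1 + ε⁻¹)))

/-- The second derivative of `regEntropy`. -/
noncomputable def regEntropyDeriv2 (ε : ℝ) (s : ℝ) : ℝ := (s + ε)⁻¹ - (s + ε⁻¹)⁻¹

variable {ε s : ℝ}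

lemma hasDerivAt_regEntropy (hε : 0 < ε) (hs : 0 ≤ s) :
    HasDerivAt (regEntropy ε) (regEntropyDeriv ε s) s := by
  have h1 : ∀ a : ℝ, 0 < a → HasDerivAt (fun s => (s + a) * Real.log (s + a))
      (Real.log (s + a) + 1) s := fun a ha => by
    have := (Real.hasDerivAt_mul_log (x := s + a) (by positivity)).comp s
      ((hasDerivAt_id s).add_const a)
    rw [mul_one] at this
    exact this
  have h2 := (((h1 ε hε).sub (h1 ε⁻¹ (inv_pos.2 hε))).sub
    ((hasDerivAt_id s).const_mul (Real.log (1 + ε) - Real.log (1 + ε⁻¹)))).sub_const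
    ((1 + ε) * Real.log (1 + ε) - (1 + ε⁻¹) * Real.log (1 + ε⁻¹) -
      (Real.log (1 + ε) - Real.log (1 + ε⁻¹)))
  have e : Real.log (s + ε) + 1 - (Real.log (s + ε⁻¹) + 1) -
      (Real.log (1 + ε) - Real.log (1 + ε⁻¹)) * 1 = regEntropyDeriv ε s := by
    rw [regEntropyDeriv]; ring
  rw [e] at h2
  exact h2

lemma hasDerivAt_regEntropyDeriv (hε : 0 < ε) (hs : 0 ≤ s) :
    HasDerivAt (regEntropyDeriv ε) (regEntropyDeriv2 ε s) s := by
  have h1 : ∀ a : ℝ, 0 < a → HasDerivAt (fun s => Real.log (s + a)) (s + a)⁻¹ s := fun a ha => by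
    have := (Real.hasDerivAt_log (x := s + a) (by positivity)).comp s
      ((hasDerivAt_id s).add_const a)
    rw [mul_one] at this
    exact this
  exact ((h1 ε hε).sub (h1 ε⁻¹ (inv_pos.2 hε))).sub_const _

lemma regEntropyDeriv2_nonneg (hε : 0 < ε) (hε1 : ε ≤ 1) (hs : 0 ≤ s) :
    0 ≤ regEntropyDeriv2 ε s := by
  have h1 : ε ≤ ε⁻¹ := hε1.trans ((one_le_inv₀ hε).2 hε1)
  exact sub_nonneg.2 (inv_anti₀ (by positivity) (by linarith))

lemma abs_regEntropyDeriv_le (hε : 0 < ε) (hε1 : ε ≤ 1) (hs : 0 ≤ s) :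
    |regEntropyDeriv ε s| ≤ 2 * (Real.log ε⁻¹ - Real.log ε) := by
  have h1 : ε ≤ ε⁻¹ := hε1.trans ((one_le_inv₀ hε).2 hε1)
  have hi : 0 < ε⁻¹ := inv_pos.2 hε
  have key : ∀ r : ℝ, 0 ≤ r → 0 ≤ Real.log (r + ε⁻¹) - Real.log (r + ε) ∧
      Real.log (r + ε⁻¹) - Real.log (r + ε) ≤ Real.log ε⁻¹ - Real.log ε := fun r hr => by
    refine ⟨sub_nonneg.2 (Real.log_le_log (by positivity) (by linarith)), ?_⟩
    rw [← Real.log_div (by positivity) (by positivity),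
      ← Real.log_div (by positivity) (by positivity)]
    refine Real.log_le_log (by positivity) ?_
    rw [div_le_div_iff₀ (by positivity) hε]
    nlinarith
  have h2 := key s hs
  have h3 := key 1 zero_le_one
  rw [regEntropyDeriv, abs_le]
  constructor <;> linarith [h2.1, h2.2, h3.1, h3.2]

lemma regEntropyDeriv_one (ε : ℝ) : regEntropyDeriv ε 1 = 0 := by simp [regEntropyDeriv]

lemma regEntropy_one (ε : ℝ) : regEntropy ε 1 = 0 := by simp [regEntropy]

/-- A function on `[0, ∞)` whose derivative changes sign at `1` has its minimum there. -/
lemma le_of_deriv_sign {D d : ℝ → ℝ} (hc : ContinuousOn D (Ici 0))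
    (hd : ∀ s, 0 < s → HasDerivAt D (d s) s) (h1 : ∀ s, 0 < s → s < 1 → d s ≤ 0)
    (h2 : ∀ s, 1 < s → 0 ≤ d s) (hs : 0 ≤ s) : D 1 ≤ D s := by
  rcases le_total s 1 with h | h
  · have : AntitoneOn D (Icc 0 1) := by
      refine antitoneOn_of_deriv_nonpos (convex_Icc 0 1) (hc.mono fun x hx => hx.1)
        (fun x hx => ?_) (fun x hx => ?_) <;> rw [interior_Icc] at hx
      · exact (hd x hx.1).differentiableAt.differentiableWithinAt
      · rw [(hd x hx.1).deriv]; exact h1 x hx.1 hx.2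
    exact this ⟨hs, h⟩ ⟨zero_le_one, le_rfl⟩ h
  · have : MonotoneOn D (Ici 1) := by
      refine monotoneOn_of_deriv_nonneg (convex_Ici 1)
        (hc.mono fun x hx => mem_Ici.2 (zero_le_one.trans (mem_Ici.1 hx)))
        (fun x hx => ?_) (fun x hx => ?_) <;> rw [interior_Ici] at hx
      · exact (hd x (zero_lt_one.trans hx)).differentiableAt.differentiableWithinAt
      · rw [(hd x (zero_lt_one.trans hx)).deriv]; exact h2 x hx
    exact this (mem_Ici.2 le_rfl) h h

lemma regEntropy_nonneg (hε : 0 < ε) (hε1 : ε ≤ 1) (hs : 0 ≤ s) : 0 ≤ regEntropy ε s := by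
  have hmono : MonotoneOn (regEntropyDeriv ε) (Ici 0) := by
    refine monotoneOn_of_deriv_nonneg (convex_Ici 0)
      (fun x hx => (hasDerivAt_regEntropyDeriv hε hx).continuousAt.continuousWithinAt)
      (fun x hx => ?_) (fun x hx => ?_) <;> rw [interior_Ici] at hx
    · exact (hasDerivAt_regEntropyDeriv hε (le_of_lt hx)).differentiableAt.differentiableWithinAt
    · rw [(hasDerivAt_regEntropyDeriv hε (le_of_lt hx)).deriv]
      exact regEntropyDeriv2_nonneg hε hε1 (le_of_lt hx)
  rw [← regEntropy_one ε]
  refine le_of_deriv_sign (d := regEntropyDeriv ε)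
    (fun x hx => (hasDerivAt_regEntropy hε hx).continuousAt.continuousWithinAt)
    (fun x hx => hasDerivAt_regEntropy hε hx.le) (fun x h0 h1 => ?_) (fun x h1 => ?_) hs
  · rw [← regEntropyDeriv_one ε]; exact hmono (mem_Ici.2 h0.le) (mem_Ici.2 zero_le_one) h1.le
  · rw [← regEntropyDeriv_one ε]
    exact hmono (mem_Ici.2 zero_le_one) (mem_Ici.2 (zero_le_one.trans h1.le)) h1.le

lemma regEntropy_le (hε : 0 < ε) (hs : 0 ≤ s) : regEntropy ε s ≤ Phi s - s + 1 := by
  have hi : 0 < ε⁻¹ := inv_pos.2 hε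
  have key := le_of_deriv_sign (D := fun x => x * Real.log x - x - regEntropy ε x)
    (d := fun x => Real.log x + 1 - 1 - regEntropyDeriv ε x) (s := s) ?_ ?_ ?_ ?_ hs
  · simp only [Real.log_one, mul_zero, regEntropy_one] at key
    rw [Phi]; linarith
  · exact (Real.continuous_mul_log.continuousOn.sub continuousOn_id).sub
      fun x hx => (hasDerivAt_regEntropy hε hx).continuousAt.continuousWithinAt
  · exact fun _ hx => ((Real.hasDerivAt_mul_log hx.ne').sub (hasDerivAt_id _)).sub
      (hasDerivAt_regEntropy hε hx.le)
  · intro x h0 h1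
    have h2 : Real.log x + Real.log (1 + ε) ≤ Real.log (x + ε) := by
      rw [← Real.log_mul h0.ne' (by positivity)]
      exact Real.log_le_log (by positivity) (by nlinarith)
    have h3 : Real.log (x + ε⁻¹) ≤ Real.log (1 + ε⁻¹) :=
      Real.log_le_log (by positivity) (by linarith)
    rw [regEntropyDeriv]; linarith
  · intro x h1
    have h0 : 0 < x := zero_lt_one.trans h1
    have h2 : Real.log (x + ε) ≤ Real.log x + Real.log (1 + ε) := by
      rw [← Real.log_mul h0.ne' (by positivity)]
      exact Real.log_le_log (by positivity) (by nlinarith)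
    have h3 : Real.log (1 + ε⁻¹) ≤ Real.log (x + ε⁻¹) :=
      Real.log_le_log (by positivity) (by linarith)
    rw [regEntropyDeriv]; linarith

lemma abs_regEntropy_sub_le (hε : 0 < ε) (hε1 : ε ≤ 1) {r : ℝ} (hs : 0 ≤ s) (hr : 0 ≤ r) :
    |regEntropy ε s - regEntropy ε r| ≤ 2 * (Real.log ε⁻¹ - Real.log ε) * |s - r| :=
  (convex_Ici 0).norm_image_sub_le_of_norm_hasDerivWithin_le
    (fun _ hx => (hasDerivAt_regEntropy hε hx).hasDerivWithinAt)
    (fun _ hx => abs_regEntropyDeriv_le hε hε1 hx) hr hs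

lemma measurable_regEntropy (ε : ℝ) : Measurable (regEntropy ε) := by
  unfold regEntropy; fun_prop

/-- The regularised entropy has linear growth. -/
lemma abs_regEntropy_le (hε : 0 < ε) (hε1 : ε ≤ 1) (hs : 0 ≤ s) :
    |regEntropy ε s| ≤ 2 * (Real.log ε⁻¹ - Real.log ε) * (s + 1) := by
  have h1 := abs_regEntropy_sub_le hε hε1 hs zero_le_one
  rw [regEntropy_one, sub_zero] at h1
  refine h1.trans (mul_le_mul_of_nonneg_left ?_
    ((abs_nonneg _).trans (abs_regEntropyDeriv_le hε hε1 le_rfl)))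
  rw [abs_le]; constructor <;> linarith

lemma tendsto_regEntropyDeriv2 (hs : 0 < s) :
    Tendsto (fun n : ℕ => regEntropyDeriv2 (1 / ((n : ℝ) + 1)) s) atTop (𝓝 s⁻¹) := by
  have h1 : Tendsto (fun n : ℕ => 1 / ((n : ℝ) + 1)) atTop (𝓝 0) :=
    tendsto_one_div_add_atTop_nhds_zero_nat
  have h2 : Tendsto (fun n : ℕ => (s + 1 / ((n : ℝ) + 1))⁻¹) atTop (𝓝 (s + 0)⁻¹) :=
    (h1.const_add s).inv₀ (by simpa using hs.ne')
  have h3 : Tendsto (fun n : ℕ => (s + (1 / ((n : ℝ) + 1))⁻¹)⁻¹) atTop (𝓝 0) := by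
    refine tendsto_inv_atTop_zero.comp (tendsto_atTop_add_const_left _ _ ?_)
    simp only [one_div, inv_inv]
    exact tendsto_atTop_add_const_right _ _ tendsto_natCast_atTop_atTop
  simpa [regEntropyDeriv2] using h2.sub h3

end Entropy

section EntropyBound

variable {X Y : Type*}
  [NormedAddCommGroup X] [InnerProductSpace ℝ X] [FiniteDimensional ℝ X]
  [MeasurableSpace X] [BorelSpace X]
  [NormedAddCommGroup Y] [InnerProductSpace ℝ Y] [FiniteDimensional ℝ Y]
  [MeasurableSpace Y] [BorelSpace Y]
  {N M : ℕ} {P : X →ₗ[ℝ] Y} {A J : X →ₗ[ℝ] X} {H : X → ℝ} {Hbar : Y → ℝ}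
  {f : ℝ → X → ℝ} {η : ℝ → Y} {κ ρ lam Lam α β γ C₁ C₂ c : ℝ}

namespace IsSystem

variable (hs : IsSystem N M P A J H Hbar f η)
include hs

lemma hasDerivAt_f {t : ℝ} (ht : 0 < t) (x : X) :
    HasDerivAt (fun r => f r x) (divergence (flux A J H (f t)) x * Real.exp (H x)) t := by
  have h1 := (hs.micro_sol.equation t ht x).mul_const (Real.exp (H x))
  have h2 : (fun r => f r x * Real.exp (-H x) * Real.exp (H x)) = fun r => f r x := by
    funext r
    rw [mul_assoc, ← Real.exp_add]; simp
  rw [h2] at h1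
  exact h1

lemma inner_drift (p : X) : inner ℝ p ((A + J) p) = inner ℝ p (A p) := by
  have h := hs.J_antisymm p p
  rw [real_inner_comm] at h
  rw [LinearMap.add_apply, inner_add_right]
  linarith

lemma inner_A_nonneg' (p : X) : 0 ≤ inner ℝ p (A p) := by
  rw [real_inner_comm]; exact hs.inner_A_nonneg p

lemma integrable_norm_gradient {T : ℝ} (hT : 0 < T) :
    Integrable (fun p : ℝ × X => ‖gradient (f p.1) p.2‖) (spaceTime H 0 T) :=
  (hs.micro_sol.integrable_gradient T hT).norm

lemma spaceTime_mono {s t : ℝ} (hs0 : 0 ≤ s) : spaceTime H s t ≤ spaceTime H 0 t := by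
  rw [spaceTime_eq_restrict, spaceTime_eq_restrict]
  exact Measure.restrict_mono (prod_mono (Ioc_subset_Ioc_left hs0) le_rfl) le_rfl

lemma integrable_regEntropy {ε : ℝ} (hε : 0 < ε) (hε1 : ε ≤ 1) {t : ℝ} (ht : 0 ≤ t) :
    Integrable (fun x => regEntropy ε (f t x)) (gibbs H) := by
  have hfi := hs.micro_sol.integrable t ht
  exact ((hfi.add (integrable_const 1)).const_mul (2 * (Real.log ε⁻¹ - Real.log ε))).mono'
    ((measurable_regEntropy ε).comp_aemeasurable hfi.aemeasurable).aestronglyMeasurable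
    (ae_of_all _ fun x => abs_regEntropy_le hε hε1 (hs.micro_sol.nonneg t ht x))

/-- Dissipation of a regularised entropy, with a cutoff in space. -/
lemma regEntropy_dissipation {ε : ℝ} (hε : 0 < ε) (hε1 : ε ≤ 1) {s t : ℝ} (hs0 : 0 < s)
    (hst : s ≤ t) {B : ℝ}
    (hB : ∀ (k : ℕ) (x : X), ‖fderiv ℝ (cutoff (X := X) k) x‖ ≤ B / ((k : ℝ) + 1)) (k : ℕ) :
    ∫⁻ p, ENNReal.ofReal (cutoff k p.2 * regEntropyDeriv2 ε (f p.1 p.2) *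
        inner ℝ (gradient (f p.1) p.2) (A (gradient (f p.1) p.2))) ∂(spaceTime H s t) ≤
      ENNReal.ofReal (∫ x, regEntropy ε (f s x) ∂(gibbs H) +
        2 * (Real.log ε⁻¹ - Real.log ε) * (B / ((k : ℝ) + 1)) *
          ‖(A + J).toContinuousLinearMap‖ *
          ∫ p, ‖gradient (f p.1) p.2‖ ∂(spaceTime H 0 t)) := by
  have hprob := hs.isProbabilityMeasure_gibbs
  have ht0 : 0 < t := hs0.trans_le hst
  have hpos : ∀ τ ∈ Icc s t, 0 < τ := fun τ hτ => hs0.trans_le hτ.1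
  have hsub : Icc s t ×ˢ (univ : Set X) ⊆ Ioi 0 ×ˢ univ :=
    prod_mono (fun τ hτ => hpos τ hτ) le_rfl
  have hfc := hs.continuousOn_f (t := t) hs0
  have hf'c := hs.micro_sol.continuousOn_fderiv.mono hsub
  have hgc := hs.continuousOn_gradient.mono hsub
  have hf0 : ∀ τ ∈ Icc s t, ∀ x, 0 ≤ f τ x := fun τ hτ => hs.micro_sol.nonneg τ (hpos τ hτ).le
  have hAc : Continuous A := A.continuous_of_finiteDimensional
  have hχ : Continuous fun p : ℝ × X => cutoff k p.2 := (cutoff_continuous k).comp continuous_snd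
  have hχ' : Continuous fun p : ℝ × X => fderiv ℝ (cutoff (X := X) k) p.2 :=
    (continuous_fderiv_cutoff k).comp continuous_snd
  have hφc : ∀ {g : ℝ → ℝ}, ContinuousOn g (Ici 0) →
      ContinuousOn (fun p : ℝ × X => g (f p.1 p.2)) (Icc s t ×ˢ univ) := fun hg =>
    hg.comp hfc fun p hp => hf0 p.1 hp.1 p.2
  have hφ1 : ContinuousOn (regEntropyDeriv ε) (Ici 0) := fun x hx =>
    (hasDerivAt_regEntropyDeriv hε hx).continuousAt.continuousWithinAt
  have hφ0 : ContinuousOn (regEntropy ε) (Ici 0) := fun x hx =>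
    (hasDerivAt_regEntropy hε hx).continuousAt.continuousWithinAt
  have hφ2 : ContinuousOn (regEntropyDeriv2 ε) (Ici 0) := fun x hx => by
    have hx0 : (0 : ℝ) ≤ x := hx
    have hi : 0 < ε⁻¹ := inv_pos.2 hε
    have h1 : x + ε ≠ 0 := by positivity
    have h2 : x + ε⁻¹ ≠ 0 := by positivity
    unfold regEntropyDeriv2
    exact (((continuousAt_id.add continuousAt_const).inv₀ h1).sub
      ((continuousAt_id.add continuousAt_const).inv₀ h2)).continuousWithinAt
  set ψ' : ℝ → X → X →L[ℝ] ℝ := fun τ x =>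
    cutoff k x • (regEntropyDeriv2 ε (f τ x) • fderiv ℝ (f τ) x) +
      regEntropyDeriv ε (f τ x) • fderiv ℝ (cutoff (X := X) k) x with hψ'
  obtain ⟨hint, hid⟩ := hs.weak_identity hs0 hst
    (U := fun τ x => cutoff k x * regEntropy ε (f τ x))
    (ψ := fun τ x => cutoff k x * regEntropyDeriv ε (f τ x)) (e := fun _ _ => 0) (ψ' := ψ')
    (isCompact_closedBall (0 : X) (2 * ((k : ℝ) + 1)))
    (fun τ hτ x => by
      have h1 := (hasDerivAt_regEntropy hε (hf0 τ hτ x)).comp τ (hs.hasDerivAt_f (hpos τ hτ) x)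
      have h2 := ((h1.const_mul (cutoff k x)).mul_const (Real.exp (-H x)))
      refine h2.congr_deriv ?_
      have e : Real.exp (H x) * Real.exp (-H x) = 1 := by rw [← Real.exp_add]; simp
      linear_combination (cutoff k x * regEntropyDeriv ε (f τ x) *
        divergence (flux A J H (f τ)) x) * e)
    (fun τ hτ x => by
      have h1 : HasFDerivAt (f τ) (fderiv ℝ (f τ) x) x :=
        ((hs.micro_sol.contDiff τ (hpos τ hτ)).differentiable (by norm_num) x).hasFDerivAt
      have h2 := (hasDerivAt_regEntropyDeriv hε (hf0 τ hτ x)).comp_hasFDerivAt x h1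
      exact (hasFDerivAt_cutoff k x).mul h2)
    (fun τ hτ => by
      have := hs.micro_sol.contDiff τ (hpos τ hτ)
      exact (cutoff_continuous k).mul (hφ0.comp_continuous this.continuous (hf0 τ hτ)))
    (hχ.continuousOn.mul (hφc hφ1))
    ((hχ.continuousOn.smul ((hφc hφ2).smul hf'c)).add ((hφc hφ1).smul hχ'.continuousOn))
    continuousOn_const
    (fun τ x hx => by simp [cutoff_eq_zero hx]) (fun τ x hx => by simp [cutoff_eq_zero hx])
    (fun τ x hx => by simp [hψ', cutoff_eq_zero hx, cutoff_fderiv_eq_zero hx])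
    (fun _ _ _ => rfl)
  set C : ℝ := 2 * (Real.log ε⁻¹ - Real.log ε) with hC
  set g1 : ℝ × X → ℝ := fun p => cutoff k p.2 * regEntropyDeriv2 ε (f p.1 p.2) *
    inner ℝ (gradient (f p.1) p.2) (A (gradient (f p.1) p.2)) with hg1
  set g2 : ℝ × X → ℝ := fun p => regEntropyDeriv ε (f p.1 p.2) *
    fderiv ℝ (cutoff (X := X) k) p.2 ((A + J) (gradient (f p.1) p.2)) with hg2
  have hdec : ∀ p : ℝ × X, ψ' p.1 p.2 ((A + J) (gradient (f p.1) p.2)) = g1 p + g2 p := fun p => by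
    simp only [hψ', hg1, hg2, _root_.add_apply, _root_.smul_apply, smul_eq_mul,
      ← inner_gradient, hs.inner_drift]
    ring
  have hg1i : Integrable g1 (spaceTime H s t) :=
    integrable_prod_of_support (isCompact_closedBall (0 : X) (2 * ((k : ℝ) + 1)))
      ((hχ.continuousOn.mul (hφc hφ2)).mul (hgc.inner (hAc.comp_continuousOn hgc)))
      (fun p hp => by simp [hg1, cutoff_eq_zero hp])
  have hsum : Integrable (fun p => g1 p + g2 p) (spaceTime H s t) := by
    simp only [zero_sub, hdec] at hint
    exact hint.neg.congr (ae_of_all _ fun p => by simp)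
  have hg2i : Integrable g2 (spaceTime H s t) :=
    (hsum.sub hg1i).congr (ae_of_all _ fun p => by simp)
  have hg10 : 0 ≤ᵐ[spaceTime H s t] g1 := by
    filter_upwards [ae_spaceTime H s t] with p hp
    exact mul_nonneg (mul_nonneg (cutoff_nonneg _ _) (regEntropyDeriv2_nonneg hε hε1
      (hf0 _ (Ioc_subset_Icc_self hp) _))) (hs.inner_A_nonneg' _)
  have hC0 : 0 ≤ C := (abs_nonneg _).trans (abs_regEntropyDeriv_le hε hε1 le_rfl)
  have hB0 : 0 ≤ B / ((k : ℝ) + 1) := (norm_nonneg _).trans (hB k 0)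
  have hgi := hs.integrable_norm_gradient ht0
  have hg2le : -∫ p, g2 p ∂(spaceTime H s t) ≤ C * (B / ((k : ℝ) + 1)) *
      ‖(A + J).toContinuousLinearMap‖ * ∫ p, ‖gradient (f p.1) p.2‖ ∂(spaceTime H 0 t) := by
    rw [← integral_neg, ← integral_const_mul]
    calc ∫ p, -g2 p ∂(spaceTime H s t) ≤ ∫ p, C * (B / ((k : ℝ) + 1)) *
          ‖(A + J).toContinuousLinearMap‖ * ‖gradient (f p.1) p.2‖ ∂(spaceTime H s t) := by
          refine integral_mono_ae hg2i.neg
            ((hgi.mono_measure (hs.spaceTime_mono hs0.le)).const_mul _) ?_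
          filter_upwards [ae_spaceTime H s t] with p hp
          have h1 := abs_regEntropyDeriv_le hε hε1 (hf0 _ (Ioc_subset_Icc_self hp) p.2)
          have h2 := (fderiv ℝ (cutoff (X := X) k) p.2).le_opNorm
            ((A + J) (gradient (f p.1) p.2))
          have h3 := (A + J).toContinuousLinearMap.le_opNorm (gradient (f p.1) p.2)
          have h4 := h2.trans (mul_le_mul (hB k p.2) h3 (norm_nonneg _) hB0)
          calc -g2 p ≤ |g2 p| := neg_le_abs _
            _ ≤ C * (B / ((k : ℝ) + 1) * (‖(A + J).toContinuousLinearMap‖ *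
                ‖gradient (f p.1) p.2‖)) := by
                simp only [hg2, abs_mul]
                exact mul_le_mul h1 h4 (abs_nonneg _) hC0
            _ = _ := by ring
      _ ≤ _ := by
          refine integral_mono_measure (hs.spaceTime_mono hs0.le) (ae_of_all _ fun p => ?_)
            (hgi.const_mul _)
          positivity
  rw [← ofReal_integral_eq_lintegral_ofReal hg1i hg10]
  refine ENNReal.ofReal_le_ofReal ?_
  simp only [zero_sub, hdec] at hid
  rw [integral_neg, integral_add hg1i hg2i] at hid
  have hUs0 : ∀ τ ∈ Icc s t, ∀ x, 0 ≤ regEntropy ε (f τ x) := fun τ hτ x =>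
    regEntropy_nonneg hε hε1 (hf0 τ hτ x)
  have h5 : 0 ≤ ∫ x, cutoff k x * regEntropy ε (f t x) ∂(gibbs H) :=
    integral_nonneg fun x => mul_nonneg (cutoff_nonneg _ _) (hUs0 t ⟨hst, le_rfl⟩ x)
  have h6 : ∫ x, cutoff k x * regEntropy ε (f s x) ∂(gibbs H) ≤
      ∫ x, regEntropy ε (f s x) ∂(gibbs H) := by
    have hss : s ∈ Icc s t := ⟨le_rfl, hst⟩
    refine integral_mono_of_nonneg (ae_of_all _ fun x => mul_nonneg (cutoff_nonneg _ _)
      (hUs0 s hss x)) (hs.integrable_regEntropy hε hε1 hs0.le)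
      (ae_of_all _ fun x => mul_le_of_le_one_left (hUs0 s hss x) (cutoff_le_one _ _))
  linarith

end IsSystem
end EntropyBound

section EntropyLimit

variable {X Y : Type*}
  [NormedAddCommGroup X] [InnerProductSpace ℝ X] [FiniteDimensional ℝ X]
  [MeasurableSpace X] [BorelSpace X]
  [NormedAddCommGroup Y] [InnerProductSpace ℝ Y] [FiniteDimensional ℝ Y]
  [MeasurableSpace Y] [BorelSpace Y]
  {N M : ℕ} {P : X →ₗ[ℝ] Y} {A J : X →ₗ[ℝ] X} {H : X → ℝ} {Hbar : Y → ℝ}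
  {f : ℝ → X → ℝ} {η : ℝ → Y} {κ ρ lam Lam α β γ C₁ C₂ c : ℝ}

namespace IsSystem

variable (hs : IsSystem N M P A J H Hbar f η)
include hs

lemma spaceTime_restrict {s t : ℝ} (hs0 : 0 ≤ s) :
    (spaceTime H 0 t).restrict (Ioc s t ×ˢ univ) = spaceTime H s t := by
  rw [spaceTime_eq_restrict, spaceTime_eq_restrict,
    Measure.restrict_restrict (measurableSet_Ioc.prod MeasurableSet.univ)]
  congr 1
  exact inter_eq_left.2 (prod_mono (Ioc_subset_Ioc_left hs0) le_rfl)

lemma continuousOn_f_Ioc (t : ℝ) :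
    ContinuousOn (fun p : ℝ × X => f p.1 p.2) (Ioc 0 t ×ˢ univ) :=
  hs.micro_sol.continuousOn.mono (prod_mono (fun _ h => h.1) le_rfl)

lemma continuousOn_gradient_Ioc (t : ℝ) :
    ContinuousOn (fun p : ℝ × X => gradient (f p.1) p.2) (Ioc 0 t ×ˢ univ) :=
  hs.continuousOn_gradient.mono (prod_mono (fun _ h => h.1) le_rfl)

lemma gradient_eq_zero {t : ℝ} (ht : 0 < t) {x : X} (h : f t x = 0) : gradient (f t) x = 0 := by
  have h1 : IsLocalMin (f t) x := Eventually.of_forall fun z => by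
    rw [h]; exact hs.micro_sol.nonneg t ht.le z
  have h2 := h1.fderiv_eq_zero
  rw [gradient, h2, map_zero]

lemma tendsto_integral_regEntropy {ε : ℝ} (hε : 0 < ε) (hε1 : ε ≤ 1) :
    Tendsto (fun s => ∫ x, regEntropy ε (f s x) ∂(gibbs H)) (𝓝[>] 0)
      (𝓝 (∫ x, regEntropy ε (f 0 x) ∂(gibbs H))) := by
  rw [tendsto_iff_norm_sub_tendsto_zero]
  have h0 : Tendsto (fun s => 2 * (Real.log ε⁻¹ - Real.log ε) *
      ∫ x, |f s x - f 0 x| ∂(gibbs H)) (𝓝[>] 0) (𝓝 0) := by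
    simpa using hs.micro_sol.initial.const_mul (2 * (Real.log ε⁻¹ - Real.log ε))
  refine squeeze_zero' (Eventually.of_forall fun _ => norm_nonneg _) ?_ h0
  filter_upwards [self_mem_nhdsWithin] with s hs0
  have hs0' : (0 : ℝ) ≤ s := le_of_lt hs0
  rw [← integral_sub (hs.integrable_regEntropy hε hε1 hs0')
    (hs.integrable_regEntropy hε hε1 le_rfl), ← integral_const_mul]
  refine (norm_integral_le_integral_norm _).trans ?_
  refine integral_mono ((hs.integrable_regEntropy hε hε1 hs0').sub
    (hs.integrable_regEntropy hε hε1 le_rfl)).norm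
    (((hs.micro_sol.integrable s hs0').sub (hs.micro_sol.integrable 0 le_rfl)).abs.const_mul _)
    fun x => ?_
  exact abs_regEntropy_sub_le hε hε1 (hs.micro_sol.nonneg s hs0' x)
    (hs.micro_sol.nonneg 0 le_rfl x)

lemma aemeasurable_regDissipation (ε : ℝ) (t : ℝ) (k : ℕ) :
    AEMeasurable (fun p : ℝ × X => ENNReal.ofReal (cutoff k p.2 * regEntropyDeriv2 ε (f p.1 p.2) *
      inner ℝ (gradient (f p.1) p.2) (A (gradient (f p.1) p.2)))) (spaceTime H 0 t) := by
  have hAc : Continuous A := A.continuous_of_finiteDimensional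
  have hg := hs.continuousOn_gradient_Ioc t
  have hf := (aestronglyMeasurable_spaceTime (H := H) (hs.continuousOn_f_Ioc t)).aemeasurable
  have h1 := (aestronglyMeasurable_spaceTime (H := H)
    (hg.inner (𝕜 := ℝ) (hAc.comp_continuousOn hg))).aemeasurable
  have h2 : Measurable (regEntropyDeriv2 ε) := by unfold regEntropyDeriv2; fun_prop
  have h3 : Measurable fun p : ℝ × X => cutoff k p.2 :=
    ((cutoff_continuous k).comp continuous_snd).measurable
  exact ((h3.aemeasurable.mul (h2.comp_aemeasurable hf)).mul h1).ennreal_ofReal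

/-- The dissipation of the regularised entropies. -/
lemma lintegral_regDissipation_le {ε : ℝ} (hε : 0 < ε) (hε1 : ε ≤ 1) {t : ℝ} (ht : 0 < t) :
    ∫⁻ p, ENNReal.ofReal (regEntropyDeriv2 ε (f p.1 p.2) *
        inner ℝ (gradient (f p.1) p.2) (A (gradient (f p.1) p.2))) ∂(spaceTime H 0 t) ≤
      ENNReal.ofReal (∫ x, regEntropy ε (f 0 x) ∂(gibbs H)) := by
  obtain ⟨B, hB0, hB, -⟩ := exists_cutoff_bound X
  -- The initial time `s k` tends to `0` while the cutoff is removed; Fatou's lemma suffices because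
  -- the dissipation is nonnegative.
  set s : ℕ → ℝ := fun k => t * (1 / ((k : ℝ) + 1)) with hsdef
  have hspos : ∀ k, 0 < s k := fun k => by positivity
  have hsle : ∀ k, s k ≤ t := fun k =>
    mul_le_of_le_one_right ht.le
      ((div_le_one (by positivity)).2 (by linarith [k.cast_nonneg (α := ℝ)]))
  have hslim0 : Tendsto s atTop (𝓝 0) := by
    have := (tendsto_one_div_add_atTop_nhds_zero_nat (𝕜 := ℝ)).const_mul t
    rw [mul_zero] at this
    exact this
  have hslim : Tendsto s atTop (𝓝[>] 0) :=
    tendsto_nhdsWithin_iff.2 ⟨hslim0, Eventually.of_forall fun k => hspos k⟩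
  set G : ℕ → ℝ × X → ℝ≥0∞ := fun k p => ENNReal.ofReal (cutoff k p.2 *
    regEntropyDeriv2 ε (f p.1 p.2) * inner ℝ (gradient (f p.1) p.2) (A (gradient (f p.1) p.2)))
    with hG
  set R : ℕ → ℝ := fun k => ∫ x, regEntropy ε (f (s k) x) ∂(gibbs H) +
        2 * (Real.log ε⁻¹ - Real.log ε) * (B / ((k : ℝ) + 1)) *
          ‖(A + J).toContinuousLinearMap‖ *
          ∫ p, ‖gradient (f p.1) p.2‖ ∂(spaceTime H 0 t) with hR
  have hRlim : Tendsto R atTop (𝓝 (∫ x, regEntropy ε (f 0 x) ∂(gibbs H))) := by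
    have h1 := (hs.tendsto_integral_regEntropy hε hε1).comp hslim
    have h2 : Tendsto (fun k : ℕ => B / ((k : ℝ) + 1)) atTop (𝓝 0) := by
      have := (tendsto_one_div_add_atTop_nhds_zero_nat (𝕜 := ℝ)).const_mul B
      simpa [div_eq_mul_inv] using this
    have h3 := ((h2.const_mul (2 * (Real.log ε⁻¹ - Real.log ε))).mul_const
      ‖(A + J).toContinuousLinearMap‖).mul_const (∫ p, ‖gradient (f p.1) p.2‖ ∂(spaceTime H 0 t))
    have h4 := h1.add h3
    simp only [mul_zero, zero_mul, add_zero] at h4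
    exact h4
  have hset : ∀ k, MeasurableSet (Ioc (s k) t ×ˢ (univ : Set X)) := fun k =>
    measurableSet_Ioc.prod MeasurableSet.univ
  calc ∫⁻ p, ENNReal.ofReal (regEntropyDeriv2 ε (f p.1 p.2) *
        inner ℝ (gradient (f p.1) p.2) (A (gradient (f p.1) p.2))) ∂(spaceTime H 0 t)
      = ∫⁻ p, liminf (fun k => (Ioc (s k) t ×ˢ univ).indicator (G k) p) atTop
          ∂(spaceTime H 0 t) := by
        refine lintegral_congr_ae ?_
        filter_upwards [ae_spaceTime H 0 t] with p hp
        refine (Tendsto.liminf_eq (tendsto_const_nhds.congr' ?_)).symm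
        filter_upwards [cutoff_eventually_eq_one p.2, hslim0.eventually (gt_mem_nhds hp.1)]
          with k hk1 hk2
        rw [indicator_of_mem (show p ∈ Ioc (s k) t ×ˢ univ from ⟨⟨hk2, hp.2⟩, mem_univ _⟩)]
        simp only [hG, hk1, one_mul]
    _ ≤ liminf (fun k => ∫⁻ p, (Ioc (s k) t ×ˢ univ).indicator (G k) p ∂(spaceTime H 0 t))
          atTop :=
        lintegral_liminf_le' fun k => (hs.aemeasurable_regDissipation ε t k).indicator (hset k)
    _ ≤ liminf (fun k => ENNReal.ofReal (R k)) atTop := by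
        refine liminf_le_liminf (Eventually.of_forall fun k => ?_)
        rw [lintegral_indicator (hset k), hs.spaceTime_restrict (hspos k).le]
        exact hs.regEntropy_dissipation hε hε1 (hspos k) (hsle k) hB k
    _ = _ := ((ENNReal.continuous_ofReal.tendsto _).comp hRlim).liminf_eq

variable (ha : Assumptions N M P A J H Hbar f η κ ρ lam Lam α β γ C₁ C₂ c)
include ha

lemma integral_regEntropy_le {ε : ℝ} (hε : 0 < ε) (hε1 : ε ≤ 1) :
    ∫ x, regEntropy ε (f 0 x) ∂(gibbs H) ≤ C₁ * N := by
  have hprob := hs.isProbabilityMeasure_gibbs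
  have h1 := hs.micro_sol.integrable 0 le_rfl
  have h2 := ha.vii_micro.1
  calc ∫ x, regEntropy ε (f 0 x) ∂(gibbs H) ≤ ∫ x, (Phi (f 0 x) - f 0 x + 1) ∂(gibbs H) :=
        integral_mono (hs.integrable_regEntropy hε hε1 le_rfl)
          ((h2.sub h1).add (integrable_const 1))
          fun x => regEntropy_le hε (hs.micro_sol.nonneg 0 le_rfl x)
    _ = ∫ x, Phi (f 0 x) ∂(gibbs H) := by
        have h3 := integral_add (h2.sub h1) (integrable_const (1 : ℝ))
        have h4 := integral_sub h2 h1
        simp only [Pi.sub_apply] at h3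
        rw [h3, h4, hs.micro_sol.mass 0 le_rfl]
        simp
    _ ≤ _ := ha.vii_micro.2

lemma C₁_mul_nonneg : 0 ≤ C₁ * N :=
  (integral_nonneg fun x => regEntropy_nonneg one_pos le_rfl
    (hs.micro_sol.nonneg 0 le_rfl x)).trans (hs.integral_regEntropy_le ha one_pos le_rfl)

/-- The entropy of the initial datum bounds the dissipation. -/
lemma lintegral_dissipation_le {t : ℝ} (ht : 0 < t) :
    ∫⁻ p, dissipation A (f p.1) p.2 ∂(spaceTime H 0 t) ≤ ENNReal.ofReal (C₁ * N) := by
  set ε : ℕ → ℝ := fun n => 1 / ((n : ℝ) + 1) with hε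
  have hεpos : ∀ n, 0 < ε n := fun n => by positivity
  have hεle : ∀ n, ε n ≤ 1 := fun n => by
    rw [hε]; exact (div_le_one (by positivity)).2 (by linarith [n.cast_nonneg (α := ℝ)])
  have hAc : Continuous A := A.continuous_of_finiteDimensional
  calc ∫⁻ p, dissipation A (f p.1) p.2 ∂(spaceTime H 0 t)
      = ∫⁻ p, liminf (fun n => ENNReal.ofReal (regEntropyDeriv2 (ε n) (f p.1 p.2) *
        inner ℝ (gradient (f p.1) p.2) (A (gradient (f p.1) p.2)))) atTop ∂(spaceTime H 0 t) := by
        refine lintegral_congr_ae ?_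
        filter_upwards [ae_spaceTime H 0 t] with p hp
        refine (Tendsto.liminf_eq ?_).symm
        rcases (hs.micro_sol.nonneg p.1 hp.1.le p.2).eq_or_lt with h0 | h0
        · have h1 := hs.gradient_eq_zero hp.1 h0.symm
          simp [dissipation, h1]
        · have h1 := (tendsto_regEntropyDeriv2 h0).mul_const
            (inner ℝ (gradient (f p.1) p.2) (A (gradient (f p.1) p.2)))
          have h2 := (ENNReal.continuous_ofReal.tendsto _).comp h1
          rw [dissipation, ← ENNReal.ofReal_div_of_pos h0, div_eq_inv_mul]
          exact h2
    _ ≤ liminf (fun n => ∫⁻ p, ENNReal.ofReal (regEntropyDeriv2 (ε n) (f p.1 p.2) *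
        inner ℝ (gradient (f p.1) p.2) (A (gradient (f p.1) p.2))) ∂(spaceTime H 0 t)) atTop := by
        refine lintegral_liminf_le' fun n => ?_
        have hg := hs.continuousOn_gradient_Ioc t
        have hf := (aestronglyMeasurable_spaceTime (H := H) (hs.continuousOn_f_Ioc t)).aemeasurable
        have h1 := (aestronglyMeasurable_spaceTime (H := H)
          (hg.inner (𝕜 := ℝ) (hAc.comp_continuousOn hg))).aemeasurable
        have h2 : Measurable (regEntropyDeriv2 (ε n)) := by unfold regEntropyDeriv2; fun_prop
        exact ((h2.comp_aemeasurable hf).mul h1).ennreal_ofReal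
    _ ≤ liminf (fun _ : ℕ => ENNReal.ofReal (C₁ * N)) atTop :=
        liminf_le_liminf (Eventually.of_forall fun n =>
          (hs.lintegral_regDissipation_le (hεpos n) (hεle n) ht).trans
            (ENNReal.ofReal_le_ofReal (hs.integral_regEntropy_le ha (hεpos n) (hεle n))))
    _ = _ := by simp

end IsSystem
end EntropyLimit

/-! ### Integrability in space and time -/

section SpaceTime

variable {X Y : Type*}
  [NormedAddCommGroup X] [InnerProductSpace ℝ X] [FiniteDimensional ℝ X]
  [MeasurableSpace X] [BorelSpace X]
  [NormedAddCommGroup Y] [InnerProductSpace ℝ Y] [FiniteDimensional ℝ Y]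
  [MeasurableSpace Y] [BorelSpace Y]
  {N M : ℕ} {P : X →ₗ[ℝ] Y} {A J : X →ₗ[ℝ] X} {H : X → ℝ} {Hbar : Y → ℝ}
  {f : ℝ → X → ℝ} {η : ℝ → Y} {κ ρ lam Lam α β γ C₁ C₂ c : ℝ}

lemma integrable_and_integral_le_of_lintegral_le {Ω : Type*} [MeasurableSpace Ω] {ν : Measure Ω}
    {F : Ω → ℝ} {b : ℝ} (hF : AEStronglyMeasurable F ν) (h0 : 0 ≤ᵐ[ν] F) (hb : 0 ≤ b)
    (h : ∫⁻ x, ENNReal.ofReal (F x) ∂ν ≤ ENNReal.ofReal b) :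
    Integrable F ν ∧ ∫ x, F x ∂ν ≤ b := by
  refine ⟨⟨hF, ?_⟩, ?_⟩
  · rw [hasFiniteIntegral_iff_ofReal h0]
    exact h.trans_lt ENNReal.ofReal_lt_top
  · rw [integral_eq_lintegral_of_nonneg_ae h0 hF]
    exact ENNReal.toReal_le_of_le_ofReal hb h

lemma lintegral_spaceTime_le {F : ℝ × X → ℝ≥0∞} {t : ℝ} (hF : AEMeasurable F (spaceTime H 0 t))
    {b : ℝ → ℝ≥0∞} (hb : ∀ τ ∈ Ioc 0 t, ∫⁻ x, F (τ, x) ∂(gibbs H) ≤ b τ) :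
    ∫⁻ p, F p ∂(spaceTime H 0 t) ≤ ∫⁻ τ in Ioc 0 t, b τ := by
  rw [spaceTime, lintegral_prod _ hF]
  exact setLIntegral_mono_ae' measurableSet_Ioc (ae_of_all _ hb)

namespace IsSystem

variable (hs : IsSystem N M P A J H Hbar f η)
include hs

lemma aestronglyMeasurable_f (t : ℝ) :
    AEStronglyMeasurable (fun p : ℝ × X => f p.1 p.2) (spaceTime H 0 t) :=
  aestronglyMeasurable_spaceTime (hs.continuousOn_f_Ioc t)

lemma aestronglyMeasurable_gradient (t : ℝ) :
    AEStronglyMeasurable (fun p : ℝ × X => gradient (f p.1) p.2) (spaceTime H 0 t) :=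
  aestronglyMeasurable_spaceTime (hs.continuousOn_gradient_Ioc t)

lemma aemeasurable_dissipation (t : ℝ) :
    AEMeasurable (fun p : ℝ × X => dissipation A (f p.1) p.2) (spaceTime H 0 t) := by
  have hAc : Continuous A := A.continuous_of_finiteDimensional
  have hg := hs.continuousOn_gradient_Ioc t
  exact (aestronglyMeasurable_spaceTime (H := H)
    (hg.inner (𝕜 := ℝ) (hAc.comp_continuousOn hg))).aemeasurable.ennreal_ofReal.div
    (hs.aestronglyMeasurable_f t).aemeasurable.ennreal_ofReal

lemma lintegral_f {t : ℝ} (ht : 0 ≤ t) : ∫⁻ x, ENNReal.ofReal (f t x) ∂(gibbs H) = 1 := by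
  rw [← ofReal_integral_eq_lintegral_ofReal (hs.micro_sol.integrable t ht)
    (ae_of_all _ (hs.micro_sol.nonneg t ht)), hs.micro_sol.mass t ht, ENNReal.ofReal_one]

lemma ae_nonneg_f (t : ℝ) : ∀ᵐ p ∂(spaceTime H 0 t), 0 ≤ f p.1 p.2 := by
  filter_upwards [ae_spaceTime H 0 t] with p hp
  exact hs.micro_sol.nonneg p.1 hp.1.le p.2

/-- The real-valued dissipation density. -/
lemma inner_gradient_eq {t : ℝ} (ht : 0 < t) (x : X) :
    inner ℝ (gradient (f t) x) (A (gradient (f t) x)) =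
      f t x * (dissipation A (f t) x).toReal := by
  rcases (hs.micro_sol.nonneg t ht.le x).eq_or_lt with h0 | h0
  · rw [hs.gradient_eq_zero ht h0.symm, ← h0]; simp
  · rw [dissipation, ← ENNReal.ofReal_div_of_pos h0, ENNReal.toReal_ofReal
      (div_nonneg (hs.inner_A_nonneg' _) h0.le), mul_div_cancel₀ _ h0.ne']

lemma integral_spaceTime_f {t : ℝ} (ht : 0 ≤ t) :
    Integrable (fun p : ℝ × X => f p.1 p.2) (spaceTime H 0 t) ∧
      ∫ p, f p.1 p.2 ∂(spaceTime H 0 t) ≤ t := by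
  refine integrable_and_integral_le_of_lintegral_le (hs.aestronglyMeasurable_f t)
    (hs.ae_nonneg_f t) ht ?_
  refine (lintegral_spaceTime_le (hs.aestronglyMeasurable_f t).aemeasurable.ennreal_ofReal
    (b := fun _ => 1) fun τ hτ => (hs.lintegral_f hτ.1.le).le).trans ?_
  simp

/-- Weights depending on time only pass through the normalisation of `f`. -/
lemma integral_spaceTime_mul_f {t : ℝ} {g : ℝ → ℝ} (hg : ContinuousOn g (Icc 0 t)) :
    Integrable (fun p : ℝ × X => g p.1 * f p.1 p.2) (spaceTime H 0 t) ∧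
      ∫ p, g p.1 * f p.1 p.2 ∂(spaceTime H 0 t) = ∫ τ in Ioc 0 t, g τ := by
  rcases le_or_gt t 0 with ht | ht
  · simp [spaceTime, Ioc_eq_empty_of_le ht]
  have hi : Integrable (fun p : ℝ × X => g p.1 * f p.1 p.2) (spaceTime H 0 t) := by
    obtain ⟨B, hB⟩ := isCompact_Icc.exists_bound_of_continuousOn hg
    refine (hs.integral_spaceTime_f ht.le).1.bdd_mul (c := B) ?_ ?_
    · exact aestronglyMeasurable_spaceTime ((hg.mono Ioc_subset_Icc_self).comp
        continuous_fst.continuousOn fun p hp => hp.1)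
    · filter_upwards [ae_spaceTime H 0 t] with p hp
      exact hB _ (Ioc_subset_Icc_self hp)
  refine ⟨hi, ?_⟩
  rw [spaceTime] at hi ⊢
  rw [integral_prod _ hi]
  refine setIntegral_congr_fun measurableSet_Ioc fun τ hτ => ?_
  simp only
  rw [integral_const_mul, hs.micro_sol.mass τ hτ.1.le, mul_one]

variable (ha : Assumptions N M P A J H Hbar f η κ ρ lam Lam α β γ C₁ C₂ c)
include ha

lemma integral_dissipation {t : ℝ} (ht : 0 < t) :
    Integrable (fun p : ℝ × X => (dissipation A (f p.1) p.2).toReal) (spaceTime H 0 t) ∧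
      ∫ p, (dissipation A (f p.1) p.2).toReal ∂(spaceTime H 0 t) ≤ C₁ * N := by
  refine integrable_and_integral_le_of_lintegral_le
    (hs.aemeasurable_dissipation t).ennreal_toReal.aestronglyMeasurable
    (ae_of_all _ fun _ => ENNReal.toReal_nonneg) (hs.C₁_mul_nonneg ha) ?_
  exact (lintegral_mono fun p => ENNReal.ofReal_toReal_le).trans (hs.lintegral_dissipation_le ha ht)

lemma integral_norm_sq_mul_f (hα : 0 ≤ α) {t : ℝ} (ht : 0 ≤ t) :
    Integrable (fun p : ℝ × X => ‖p.2‖ ^ 2 * f p.1 p.2) (spaceTime H 0 t) ∧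
      ∫ p, ‖p.2‖ ^ 2 * f p.1 p.2 ∂(spaceTime H 0 t) ≤ α * N * t := by
  have hm : AEStronglyMeasurable (fun p : ℝ × X => ‖p.2‖ ^ 2 * f p.1 p.2) (spaceTime H 0 t) :=
    (continuous_snd.norm.pow 2).aestronglyMeasurable.mul (hs.aestronglyMeasurable_f t)
  refine integrable_and_integral_le_of_lintegral_le hm ?_ (by positivity) ?_
  · filter_upwards [hs.ae_nonneg_f t] with p hp
    exact mul_nonneg (sq_nonneg _) hp
  · refine (lintegral_spaceTime_le hm.aemeasurable.ennreal_ofReal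
      (b := fun _ => ENNReal.ofReal (α * N)) fun τ hτ => ?_).trans ?_
    · have h := ha.iv τ hτ.1.le
      rw [← ofReal_integral_eq_lintegral_ofReal h.1 (ae_of_all _ fun x =>
        mul_nonneg (sq_nonneg _) (hs.micro_sol.nonneg τ hτ.1.le x))]
      exact ENNReal.ofReal_le_ofReal h.2
    · rw [ENNReal.ofReal_mul (q := t) (by positivity)]
      simp

/-- The force fluctuations are small in the mean, by the logarithmic Sobolev inequality on the
fibres and the bound on the dissipation. -/
lemma integral_forceFluct_sq (hκ : 0 < κ) (hρ : 0 < ρ) (hγ : 0 ≤ γ) {t : ℝ} (ht : 0 < t) :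
    Integrable (fun p : ℝ × X => ‖forceFluct N P H Hbar p.2‖ ^ 2 * f p.1 p.2)
        (spaceTime H 0 t) ∧
      ∫ p, ‖forceFluct N P H Hbar p.2‖ ^ 2 * f p.1 p.2 ∂(spaceTime H 0 t) ≤
        M * (4 * (κ ^ 2 * N) / ρ) * (1 / (2 * ρ) * (γ / (M : ℝ) ^ 2) * (C₁ * N) + t) := by
  have hm : AEStronglyMeasurable (fun p : ℝ × X =>
      ‖forceFluct N P H Hbar p.2‖ ^ 2 * f p.1 p.2) (spaceTime H 0 t) :=
    ((hs.continuous_forceFluct.comp continuous_snd).norm.pow 2).aestronglyMeasurable.mul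
      (hs.aestronglyMeasurable_f t)
  have hC := hs.C₁_mul_nonneg ha
  refine integrable_and_integral_le_of_lintegral_le hm ?_ (by positivity) ?_
  · filter_upwards [hs.ae_nonneg_f t] with p hp
    exact mul_nonneg (sq_nonneg _) hp
  · refine (lintegral_spaceTime_le hm.aemeasurable.ennreal_ofReal fun τ hτ =>
      hs.lintegral_forceFluct_le ha hκ hρ hγ ((hs.micro_sol.contDiff τ hτ.1).of_le (by norm_num))
        (hs.micro_sol.nonneg τ hτ.1.le)).trans ?_
    have h1 := hs.lintegral_dissipation_le ha ht
    have hd := hs.aemeasurable_dissipation t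
    rw [spaceTime, lintegral_prod _ hd] at h1
    have hdm : AEMeasurable (fun τ => ∫⁻ x, dissipation A (f τ) x ∂(gibbs H))
        ((volume : Measure ℝ).restrict (Ioc 0 t)) := by
      rw [spaceTime] at hd
      exact hd.lintegral_prod_right'
    have h2 : ∫⁻ τ in Ioc 0 t, ∫⁻ x, ENNReal.ofReal (f τ x) ∂(gibbs H) = ENNReal.ofReal t := by
      rw [setLIntegral_congr_fun measurableSet_Ioc fun τ hτ => hs.lintegral_f (le_of_lt hτ.1)]
      simp
    rw [lintegral_const_mul' _ _ ENNReal.ofReal_ne_top,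
      lintegral_add_left' (hdm.const_mul _), lintegral_const_mul' _ _ ENNReal.ofReal_ne_top, h2,
      ENNReal.ofReal_mul (p := M * (4 * (κ ^ 2 * N) / ρ)) (by positivity),
      ENNReal.ofReal_add (by positivity) ht.le,
      ENNReal.ofReal_mul (p := 1 / (2 * ρ) * (γ / (M : ℝ) ^ 2)) (by positivity)]
    gcongr

lemma integrable_one_add_sq_mul_f (hα : 0 ≤ α) {t : ℝ} (ht : 0 ≤ t) :
    Integrable (fun p : ℝ × X => (1 + ‖p.2‖) ^ 2 * f p.1 p.2) (spaceTime H 0 t) := by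
  have h1 := ((hs.integral_spaceTime_f ht).1.add (hs.integral_norm_sq_mul_f ha hα ht).1).const_mul 2
  refine h1.mono' ?_ ?_
  · exact ((continuous_snd.norm.const_add 1).pow 2).aestronglyMeasurable.mul
      (hs.aestronglyMeasurable_f t)
  · filter_upwards [hs.ae_nonneg_f t] with p hp
    rw [Real.norm_of_nonneg (by positivity)]
    simp only [Pi.add_apply]
    nlinarith [mul_nonneg hp (sq_nonneg (1 - ‖p.2‖))]

lemma integrable_one_add_mul_gradient (hα : 0 ≤ α) {t : ℝ} (ht : 0 < t) :
    Integrable (fun p : ℝ × X => (1 + ‖p.2‖) * ‖gradient (f p.1) p.2‖) (spaceTime H 0 t) := by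
  obtain ⟨τ, hτ, hA⟩ := ha.viii
  refine ((hs.integrable_one_add_sq_mul_f ha hα ht.le).add
    ((hs.integral_dissipation ha ht).1.div_const τ)).mono' ?_ ?_
  · exact (continuous_snd.norm.const_add 1).aestronglyMeasurable.mul
      (hs.aestronglyMeasurable_gradient t).norm
  · filter_upwards [ae_spaceTime H 0 t] with p hp
    have h0 := hs.micro_sol.nonneg p.1 hp.1.le p.2
    have h1 := hA (gradient (f p.1) p.2)
    rw [real_inner_comm, hs.inner_gradient_eq hp.1] at h1
    have hQ : 0 ≤ (dissipation A (f p.1) p.2).toReal := ENNReal.toReal_nonneg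
    rw [Real.norm_of_nonneg (by positivity)]
    simp only [Pi.add_apply]
    -- `|∇f|² ≤ f Q / τ` with `Q` the dissipation density, hence
    -- `(1 + |x|) |∇f| ≤ (1 + |x|)² f + Q / τ`.
    refine abs_le_of_sq_le_sq' ?_ (by positivity) |>.2
    have h2 : ‖gradient (f p.1) p.2‖ ^ 2 ≤
        f p.1 p.2 * ((dissipation A (f p.1) p.2).toReal / τ) := by
      rw [← mul_div_assoc, le_div_iff₀ hτ]; linarith
    calc _ = (1 + ‖p.2‖) ^ 2 * ‖gradient (f p.1) p.2‖ ^ 2 := by ring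
      _ ≤ (1 + ‖p.2‖) ^ 2 * (f p.1 p.2 * ((dissipation A (f p.1) p.2).toReal / τ)) := by gcongr
      _ = ((1 + ‖p.2‖) ^ 2 * f p.1 p.2) * ((dissipation A (f p.1) p.2).toReal / τ) := by ring
      _ ≤ _ := by
        have h3 : 0 ≤ (1 + ‖p.2‖) ^ 2 * f p.1 p.2 := by positivity
        have h4 : 0 ≤ (dissipation A (f p.1) p.2).toReal / τ := by positivity
        nlinarith [mul_nonneg h3 h4, sq_nonneg ((1 + ‖p.2‖) ^ 2 * f p.1 p.2),
          sq_nonneg ((dissipation A (f p.1) p.2).toReal / τ)]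

lemma integrable_one_add_mul_forceFluct (hκ : 0 < κ) (hρ : 0 < ρ) (hα : 0 ≤ α) (hγ : 0 ≤ γ)
    {t : ℝ} (ht : 0 < t) :
    Integrable (fun p : ℝ × X => (1 + ‖p.2‖) * ‖forceFluct N P H Hbar p.2‖ * f p.1 p.2)
      (spaceTime H 0 t) := by
  refine ((hs.integrable_one_add_sq_mul_f ha hα ht.le).add
    (hs.integral_forceFluct_sq ha hκ hρ hγ ht).1).mono' ?_ ?_
  · exact ((continuous_snd.norm.const_add 1).mul
      (hs.continuous_forceFluct.comp continuous_snd).norm).aestronglyMeasurable.mul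
      (hs.aestronglyMeasurable_f t)
  · filter_upwards [hs.ae_nonneg_f t] with p hp
    rw [Real.norm_of_nonneg (by positivity)]
    simp only [Pi.add_apply]
    rw [← add_mul]
    refine mul_le_mul_of_nonneg_right ?_ hp
    nlinarith [sq_nonneg (1 + ‖p.2‖ - ‖forceFluct N P H Hbar p.2‖),
      sq_nonneg (1 + ‖p.2‖), sq_nonneg ‖forceFluct N P H Hbar p.2‖]

end IsSystem
end SpaceTime

/-! ### The evolution of the quadratic distance -/

section Quadratic

variable {X Y : Type*}
  [NormedAddCommGroup X] [InnerProductSpace ℝ X] [FiniteDimensional ℝ X]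
  [MeasurableSpace X] [BorelSpace X]
  [NormedAddCommGroup Y] [InnerProductSpace ℝ Y] [FiniteDimensional ℝ Y]
  [MeasurableSpace Y] [BorelSpace Y]
  {N M : ℕ} {P : X →ₗ[ℝ] Y} {A J : X →ₗ[ℝ] X} {H : X → ℝ} {Hbar : Y → ℝ}
  {f : ℝ → X → ℝ} {η : ℝ → Y} {κ ρ lam Lam α β γ C₁ C₂ c : ℝ}

lemma exists_bound_of_support {E : Type*} [NormedAddCommGroup E] {g : ℝ × X → E} {s t : ℝ}
    {K : Set X} (hK : IsCompact K) (hg : ContinuousOn g (Icc s t ×ˢ univ))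
    (h0 : ∀ p : ℝ × X, p.2 ∉ K → g p = 0) :
    ∃ B, 0 ≤ B ∧ ∀ p : ℝ × X, p.1 ∈ Icc s t → ‖g p‖ ≤ B := by
  obtain ⟨B, hB⟩ := (isCompact_Icc.prod hK).exists_bound_of_continuousOn
    (hg.mono (prod_mono le_rfl (subset_univ _)))
  refine ⟨max B 0, le_max_right _ _, fun p hp => ?_⟩
  by_cases h : p.2 ∈ K
  · exact (hB p ⟨hp, h⟩).trans (le_max_left _ _)
  · rw [h0 p h, norm_zero]; exact le_max_right _ _

namespace IsSystem

variable (hs : IsSystem N M P A J H Hbar f η)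
include hs

/-- Integrals of compactly supported test functions against `f` are continuous at time `0`. -/
lemma tendsto_integral_mul_f {t : ℝ} (ht : 0 < t) {ψ : ℝ → X → ℝ} {K : Set X} (hK : IsCompact K)
    (hψc : ContinuousOn (fun p : ℝ × X => ψ p.1 p.2) (Icc 0 t ×ˢ univ))
    (hψK : ∀ τ x, x ∉ K → ψ τ x = 0) {s : ℕ → ℝ} (hs0 : ∀ n, 0 < s n) (hst : ∀ n, s n ≤ t)
    (hslim : Tendsto s atTop (𝓝 0)) :
    Tendsto (fun n => ∫ x, ψ (s n) x * f (s n) x ∂(gibbs H)) atTop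
      (𝓝 (∫ x, ψ 0 x * f 0 x ∂(gibbs H))) := by
  obtain ⟨B, hB0, hB⟩ := exists_bound_of_support hK hψc fun p hp => hψK p.1 p.2 hp
  have hmem : ∀ n, s n ∈ Icc 0 t := fun n => ⟨(hs0 n).le, hst n⟩
  have h0t : (0 : ℝ) ∈ Icc 0 t := ⟨le_rfl, ht.le⟩
  have hcx : ∀ τ ∈ Icc 0 t, Continuous (ψ τ) := fun τ hτ =>
    hψc.comp_continuous (f := fun x : X => (τ, x)) (by fun_prop) fun x => ⟨hτ, mem_univ _⟩
  have hf0 := hs.micro_sol.integrable 0 le_rfl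
  have hint : ∀ τ ∈ Icc 0 t, ∀ r, 0 ≤ r → Integrable (fun x => ψ τ x * f r x) (gibbs H) :=
    fun τ hτ r hr => (hs.micro_sol.integrable r hr).bdd_mul (c := B)
      (hcx τ hτ).aestronglyMeasurable (ae_of_all _ fun x => hB (τ, x) hτ)
  have h1 : Tendsto (fun n => ∫ x, ψ (s n) x * f 0 x ∂(gibbs H)) atTop
      (𝓝 (∫ x, ψ 0 x * f 0 x ∂(gibbs H))) := by
    refine tendsto_integral_of_dominated_convergence (fun x => B * ‖f 0 x‖)
      (fun n => (hint _ (hmem n) 0 le_rfl).aestronglyMeasurable) (hf0.norm.const_mul B)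
      (fun n => ae_of_all _ fun x => ?_) (ae_of_all _ fun x => ?_)
    · rw [norm_mul]
      exact mul_le_mul_of_nonneg_right (hB (s n, x) (hmem n)) (norm_nonneg _)
    · have h2 : ContinuousOn (fun τ => ψ τ x) (Icc 0 t) :=
        hψc.comp (f := fun τ : ℝ => (τ, x)) (by fun_prop) fun τ hτ => ⟨hτ, mem_univ _⟩
      exact ((h2 0 h0t).tendsto.comp (tendsto_nhdsWithin_iff.2
        ⟨hslim, Eventually.of_forall hmem⟩)).mul_const _
  have h2 : Tendsto (fun n => ∫ x, ψ (s n) x * f (s n) x ∂(gibbs H) -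
      ∫ x, ψ (s n) x * f 0 x ∂(gibbs H)) atTop (𝓝 0) := by
    have h3 : Tendsto (fun n => B * ∫ x, |f (s n) x - f 0 x| ∂(gibbs H)) atTop (𝓝 0) := by
      have h4 := (hs.micro_sol.initial.comp (tendsto_nhdsWithin_iff.2
        ⟨hslim, Eventually.of_forall hs0⟩)).const_mul B
      rw [mul_zero] at h4
      exact h4
    refine squeeze_zero_norm (fun n => ?_) h3
    rw [← integral_sub (hint _ (hmem n) _ (hs0 n).le) (hint _ (hmem n) 0 le_rfl),
      ← integral_const_mul]
    refine norm_integral_le_of_norm_le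
      (((hs.micro_sol.integrable _ (hs0 n).le).sub hf0).abs.const_mul B) (ae_of_all _ fun x => ?_)
    rw [← mul_sub, norm_mul]
    exact mul_le_mul_of_nonneg_right (hB (s n, x) (hmem n)) (norm_nonneg _)
  have h5 := h2.add h1
  simpa using h5

/-- The Fokker-Planck equation tested with `ψ(t, x)` on `(0, t] × X`. -/
lemma weak_identity_zero {t : ℝ} (ht : 0 < t) {ψ e : ℝ → X → ℝ} {ψ' : ℝ → X → X →L[ℝ] ℝ}
    {K : Set X} (hK : IsCompact K)
    (hψt : ∀ τ ∈ Ioc 0 t, ∀ x, HasDerivAt (fun r => ψ r x) (e τ x) τ)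
    (hψd : ∀ τ ∈ Ioc 0 t, ∀ x, HasFDerivAt (ψ τ) (ψ' τ x) x)
    (hψc : ContinuousOn (fun p : ℝ × X => ψ p.1 p.2) (Icc 0 t ×ˢ univ))
    (hψ'c : ContinuousOn (fun p : ℝ × X => ψ' p.1 p.2) (Icc 0 t ×ˢ univ))
    (hec : ContinuousOn (fun p : ℝ × X => e p.1 p.2) (Icc 0 t ×ˢ univ))
    (hψK : ∀ τ x, x ∉ K → ψ τ x = 0)
    (hψ'K : ∀ τ x, x ∉ K → ψ' τ x = 0) (heK : ∀ τ x, x ∉ K → e τ x = 0) :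
    ∫ x, ψ t x * f t x ∂(gibbs H) - ∫ x, ψ 0 x * f 0 x ∂(gibbs H) =
        ∫ p, (e p.1 p.2 * f p.1 p.2 - ψ' p.1 p.2 ((A + J) (gradient (f p.1) p.2)))
          ∂(spaceTime H 0 t) := by
  set F : ℝ × X → ℝ := fun p =>
    e p.1 p.2 * f p.1 p.2 - ψ' p.1 p.2 ((A + J) (gradient (f p.1) p.2)) with hF
  -- The equation holds classically at positive times only, so the identity is first used on
  -- `(s k, t]` with `s k → 0`.
  set s : ℕ → ℝ := fun k => t * (1 / ((k : ℝ) + 1)) with hsdef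
  have hspos : ∀ k, 0 < s k := fun k => by positivity
  have hsle : ∀ k, s k ≤ t := fun k =>
    mul_le_of_le_one_right ht.le
      ((div_le_one (by positivity)).2 (by linarith [k.cast_nonneg (α := ℝ)]))
  have hslim : Tendsto s atTop (𝓝 0) := by
    have := (tendsto_one_div_add_atTop_nhds_zero_nat (𝕜 := ℝ)).const_mul t
    rw [mul_zero] at this
    exact this
  have hAJ : Continuous (A + J) := LinearMap.continuous_of_finiteDimensional _
  have hsub : Ioc 0 t ×ˢ (univ : Set X) ⊆ Icc 0 t ×ˢ univ := prod_mono Ioc_subset_Icc_self le_rfl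
  have hid : ∀ k, ∫ x, ψ t x * f t x ∂(gibbs H) - ∫ x, ψ (s k) x * f (s k) x ∂(gibbs H) =
      ∫ p, (Ioc (s k) t ×ˢ univ).indicator F p ∂(spaceTime H 0 t) := fun k => by
    have hsubI : Icc (s k) t ⊆ Ioc 0 t := fun τ hτ => ⟨(hspos k).trans_le hτ.1, hτ.2⟩
    have hsub2 : Icc (s k) t ×ˢ (univ : Set X) ⊆ Icc 0 t ×ˢ univ :=
      (prod_mono hsubI le_rfl).trans hsub
    have h := hs.weak_identity (hspos k) (hsle k) (U := fun τ x => ψ τ x * f τ x) (ψ := ψ)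
      (e := fun τ x => e τ x * f τ x) (ψ' := ψ') hK
      (fun τ hτ x => by
        have h1 := (hψt τ (hsubI hτ) x).mul (hs.hasDerivAt_f (hsubI hτ).1 x)
        refine (h1.mul_const (Real.exp (-H x))).congr_deriv ?_
        have e' : Real.exp (H x) * Real.exp (-H x) = 1 := by rw [← Real.exp_add]; simp
        linear_combination (ψ τ x * divergence (flux A J H (f τ)) x) * e')
      (fun τ hτ => hψd τ (hsubI hτ))
      (fun τ hτ => (hψc.comp_continuous (f := fun x : X => (τ, x)) (by fun_prop)
        fun x => ⟨Ioc_subset_Icc_self (hsubI hτ), mem_univ _⟩).mul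
        (hs.micro_sol.contDiff τ (hsubI hτ).1).continuous)
      (hψc.mono hsub2) (hψ'c.mono hsub2)
      ((hec.mono hsub2).mul (hs.continuousOn_f (hspos k)))
      (fun τ x hx => by simp [hψK τ x hx]) hψK hψ'K (fun τ x hx => by simp [heK τ x hx])
    rw [h.2, integral_indicator (measurableSet_Ioc.prod MeasurableSet.univ),
      hs.spaceTime_restrict (hspos k).le]
  obtain ⟨B₁, hB₁0, hB₁⟩ := exists_bound_of_support hK hec fun p hp => heK p.1 p.2 hp
  obtain ⟨B₂, hB₂0, hB₂⟩ := exists_bound_of_support hK hψ'c fun p hp => hψ'K p.1 p.2 hp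
  have hFm : AEStronglyMeasurable F (spaceTime H 0 t) := by
    refine aestronglyMeasurable_spaceTime (((hec.mono hsub).mul (hs.continuousOn_f_Ioc t)).sub ?_)
    exact (hψ'c.mono hsub).clm_apply (hAJ.comp_continuousOn (hs.continuousOn_gradient_Ioc t))
  have hlim : Tendsto (fun k => ∫ p, (Ioc (s k) t ×ˢ univ).indicator F p ∂(spaceTime H 0 t)) atTop
      (𝓝 (∫ p, F p ∂(spaceTime H 0 t))) := by
    refine tendsto_integral_of_dominated_convergence
      (fun p => B₁ * ‖f p.1 p.2‖ +
        B₂ * (‖(A + J).toContinuousLinearMap‖ * ‖gradient (f p.1) p.2‖))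
      (fun k => hFm.indicator (measurableSet_Ioc.prod MeasurableSet.univ))
      (((hs.integral_spaceTime_f ht.le).1.norm.const_mul B₁).add
        (((hs.integrable_norm_gradient ht).const_mul _).const_mul B₂)) (fun k => ?_) ?_
    · filter_upwards [ae_spaceTime H 0 t] with p hp
      refine (norm_indicator_le_norm_self _ _).trans ?_
      refine (norm_sub_le _ _).trans (add_le_add ?_ ?_)
      · rw [norm_mul]
        exact mul_le_mul_of_nonneg_right (hB₁ p (Ioc_subset_Icc_self hp)) (norm_nonneg _)
      · refine ((ψ' p.1 p.2).le_opNorm _).trans ?_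
        exact mul_le_mul (hB₂ p (Ioc_subset_Icc_self hp))
          ((A + J).toContinuousLinearMap.le_opNorm _) (norm_nonneg _) hB₂0
    · filter_upwards [ae_spaceTime H 0 t] with p hp
      refine tendsto_const_nhds.congr' ?_
      filter_upwards [hslim.eventually (gt_mem_nhds hp.1)] with k hk
      rw [indicator_of_mem (show p ∈ Ioc (s k) t ×ˢ univ from ⟨⟨hk, hp.2⟩, mem_univ _⟩)]
  refine tendsto_nhds_unique ?_ hlim
  simp_rw [← hid]
  exact tendsto_const_nhds.sub (hs.tendsto_integral_mul_f ht hK hψc hψK hspos hsle hslim)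

end IsSystem
end Quadratic

section Deviation

variable {X Y : Type*}
  [NormedAddCommGroup X] [InnerProductSpace ℝ X] [FiniteDimensional ℝ X]
  [MeasurableSpace X] [BorelSpace X]
  [NormedAddCommGroup Y] [InnerProductSpace ℝ Y] [FiniteDimensional ℝ Y]
  [MeasurableSpace Y] [BorelSpace Y]
  {N M : ℕ} {P : X →ₗ[ℝ] Y} {A J : X →ₗ[ℝ] X} {H : X → ℝ} {Hbar : Y → ℝ}
  {f : ℝ → X → ℝ} {η : ℝ → Y} {κ ρ lam Lam α β γ C₁ C₂ c : ℝ}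

lemma cutoff_fderiv_eventually_eq_zero (x : X) :
    ∀ᶠ k : ℕ in atTop, fderiv ℝ (cutoff (X := X) k) x = 0 := by
  filter_upwards [cutoff_eventually_eq_one x] with k hk
  have : IsLocalMax (cutoff (X := X) k) x := Eventually.of_forall fun z => by
    rw [hk]; exact cutoff_le_one k z
  exact this.fderiv_eq_zero

/-- Removal of the cutoff: terms with a derivative of the cutoff disappear in the limit. -/
lemma tendsto_integral_cutoff {ν : Measure (ℝ × X)} {F g : ℝ × X → ℝ} {R : ℕ → ℝ × X → ℝ}
    (hF : Integrable F ν) (hg : Integrable g ν) (hR : ∀ k, AEStronglyMeasurable (R k) ν)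
    (hRg : ∀ k, ∀ᵐ p ∂ν, ‖R k p‖ ≤ (1 + ‖p.2‖) * ‖fderiv ℝ (cutoff (X := X) k) p.2‖ * g p) :
    (∀ k, Integrable (fun p => cutoff k p.2 * F p + R k p) ν) ∧
      Tendsto (fun k => ∫ p, (cutoff k p.2 * F p + R k p) ∂ν) atTop (𝓝 (∫ p, F p ∂ν)) := by
  obtain ⟨B, hB0, -, hB⟩ := exists_cutoff_bound X
  have hm : ∀ k, AEStronglyMeasurable (fun p => cutoff k p.2 * F p + R k p) ν := fun k =>
    (((cutoff_continuous k).comp continuous_snd).aestronglyMeasurable.mul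
      hF.aestronglyMeasurable).add (hR k)
  have hi : Integrable (fun p => ‖F p‖ + 3 * B * ‖g p‖) ν := hF.norm.add (hg.norm.const_mul _)
  have hle : ∀ k, ∀ᵐ p ∂ν, ‖cutoff k p.2 * F p + R k p‖ ≤ ‖F p‖ + 3 * B * ‖g p‖ := fun k => by
    filter_upwards [hRg k] with p hp
    refine (norm_add_le _ _).trans (add_le_add ?_ (hp.trans ?_))
    · rw [norm_mul, Real.norm_of_nonneg (cutoff_nonneg k p.2)]
      exact mul_le_of_le_one_left (norm_nonneg _) (cutoff_le_one k p.2)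
    · calc _ ≤ (1 + ‖p.2‖) * ‖fderiv ℝ (cutoff (X := X) k) p.2‖ * ‖g p‖ :=
            mul_le_mul_of_nonneg_left (le_abs_self _) (by positivity)
        _ ≤ _ := mul_le_mul_of_nonneg_right (hB k p.2) (norm_nonneg _)
  refine ⟨fun k => hi.mono' (hm k) (hle k), ?_⟩
  refine tendsto_integral_of_dominated_convergence _ hm hi hle ?_
  filter_upwards [ae_all_iff.2 hRg] with p hp
  refine tendsto_const_nhds.congr' ?_
  filter_upwards [cutoff_eventually_eq_one p.2, cutoff_fderiv_eventually_eq_zero p.2] with k h1 h2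
  have h3 := hp k
  rw [h2, norm_zero, mul_zero, zero_mul] at h3
  rw [h1, one_mul, norm_le_zero_iff.1 h3, add_zero]

/-- Half the squared distance, in the metric of `A⁻¹`, of `x` to the lift of a macroscopic
state `e`. -/
noncomputable def microEnergy (N : ℕ) (P : X →ₗ[ℝ] Y) (A : X →ₗ[ℝ] X) (e : Y) (x : X) : ℝ :=
  1 / 2 * inner ℝ (x - lift N P e) (opInv A (x - lift N P e))

/-- The vector `(1 - J A⁻¹) z`, where `z` is the deviation of `x` from the lift of a macroscopic
state `e`. -/
noncomputable def relDrift (N : ℕ) (P : X →ₗ[ℝ] Y) (A J : X →ₗ[ℝ] X) (e : Y) (x : X) : X :=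
  x - lift N P e - J (opInv A (x - lift N P e))

lemma exists_linear_bound {E : Type*} [NormedAddCommGroup E] [NormedSpace ℝ E] (N : ℕ)
    (P : X →ₗ[ℝ] Y) (B : X →ₗ[ℝ] E) (R : ℝ) :
    ∃ C, 0 ≤ C ∧ ∀ e : Y, ‖e‖ ≤ R → ∀ x, ‖B (x - lift N P e)‖ ≤ C * (1 + ‖x‖) := by
  set B' := LinearMap.toContinuousLinearMap B
  set L' := LinearMap.toContinuousLinearMap (lift N P)
  refine ⟨‖B'‖ * (1 + ‖L'‖ * |R|), by positivity, fun e he x => ?_⟩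
  have h1 : ‖lift N P e‖ ≤ ‖L'‖ * |R| := (L'.le_opNorm e).trans
    (mul_le_mul_of_nonneg_left (he.trans (le_abs_self R)) (norm_nonneg _))
  have h2 : ‖x - lift N P e‖ ≤ (1 + ‖L'‖ * |R|) * (1 + ‖x‖) := by
    have := norm_sub_le x (lift N P e)
    have h3 : 0 ≤ ‖L'‖ * |R| := by positivity
    nlinarith [norm_nonneg x]
  calc ‖B (x - lift N P e)‖ ≤ ‖B'‖ * ‖x - lift N P e‖ := B'.le_opNorm _
    _ ≤ ‖B'‖ * ((1 + ‖L'‖ * |R|) * (1 + ‖x‖)) := mul_le_mul_of_nonneg_left h2 (norm_nonneg _)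
    _ = _ := by ring

lemma exists_microEnergy_bound (N : ℕ) (P : X →ₗ[ℝ] Y) (A : X →ₗ[ℝ] X) (R : ℝ) :
    ∃ C, 0 ≤ C ∧ ∀ e : Y, ‖e‖ ≤ R → ∀ x, ‖microEnergy N P A e x‖ ≤ C * (1 + ‖x‖) ^ 2 := by
  obtain ⟨C₁, h10, h1⟩ := exists_linear_bound N P (LinearMap.id : X →ₗ[ℝ] X) R
  obtain ⟨C₂, h20, h2⟩ := exists_linear_bound N P (opInv A) R
  refine ⟨1 / 2 * (C₁ * C₂), by positivity, fun e he x => ?_⟩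
  rw [microEnergy, norm_mul, Real.norm_of_nonneg (by norm_num : (0 : ℝ) ≤ 1 / 2)]
  calc _ ≤ 1 / 2 * (‖x - lift N P e‖ * ‖opInv A (x - lift N P e)‖) :=
        mul_le_mul_of_nonneg_left (norm_inner_le_norm _ _) (by norm_num)
    _ ≤ 1 / 2 * ((C₁ * (1 + ‖x‖)) * (C₂ * (1 + ‖x‖))) := by
        gcongr
        · exact h1 e he x
        · exact h2 e he x
    _ = _ := by ring

lemma continuous_microEnergy (N : ℕ) (P : X →ₗ[ℝ] Y) (A : X →ₗ[ℝ] X) :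
    Continuous fun p : Y × X => microEnergy N P A p.1 p.2 := by
  have h1 : Continuous (lift N P) := LinearMap.continuous_of_finiteDimensional _
  have h2 : Continuous (opInv A) := LinearMap.continuous_of_finiteDimensional _
  unfold microEnergy
  fun_prop

lemma continuous_relDrift (N : ℕ) (P : X →ₗ[ℝ] Y) (A J : X →ₗ[ℝ] X) :
    Continuous fun p : Y × X => relDrift N P A J p.1 p.2 := by
  have h1 : Continuous (lift N P) := LinearMap.continuous_of_finiteDimensional _
  have h2 : Continuous (opInv A) := LinearMap.continuous_of_finiteDimensional _
  have h3 : Continuous J := LinearMap.continuous_of_finiteDimensional _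
  unfold relDrift
  fun_prop

namespace IsSystem

variable (hs : IsSystem N M P A J H Hbar f η)
include hs

lemma hasFDerivAt_microEnergy (e : Y) (x : X) :
    HasFDerivAt (microEnergy N P A e) (innerSL ℝ (opInv A (x - lift N P e))) x := by
  have h1 : HasFDerivAt (fun x : X => x - lift N P e) (ContinuousLinearMap.id ℝ X) x :=
    (hasFDerivAt_id x).sub_const _
  have h2 := (opInv A).toContinuousLinearMap.hasFDerivAt.comp x h1
  refine ((h1.inner ℝ h2).const_mul (1 / 2)).congr_fderiv ?_
  ext v
  have h3 := hs.inner_opInv_comm (x - lift N P e) v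
  have h4 := real_inner_comm v (opInv A (x - lift N P e))
  simp only [_root_.smul_apply, ContinuousLinearMap.comp_apply,
    ContinuousLinearMap.prod_apply, fderivInnerCLM_apply, smul_eq_mul, innerSL_apply_apply,
    ContinuousLinearMap.id_apply, Function.comp_apply, LinearMap.coe_toContinuousLinearMap']
  linarith

lemma hasDerivAt_η {t : ℝ} (ht : 0 < t) :
    HasDerivAt η (-velocity N P A J Hbar (η t)) t :=
  (hs.macro_sol t ht.le).hasDerivAt (Ici_mem_nhds ht)

lemma hasDerivAt_microEnergy {t : ℝ} (ht : 0 < t) (x : X) :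
    HasDerivAt (fun r => microEnergy N P A (η r) x)
      (inner ℝ (opInv A (x - lift N P (η t))) (lift N P (velocity N P A J Hbar (η t)))) t := by
  have h1 : HasDerivAt (fun r => x - lift N P (η r))
      (lift N P (velocity N P A J Hbar (η t))) t := by
    have := ((lift N P).toContinuousLinearMap.hasFDerivAt.comp_hasDerivAt t
      (hs.hasDerivAt_η ht)).const_sub x
    refine this.congr_deriv ?_
    simp
  have h2 := (opInv A).toContinuousLinearMap.hasFDerivAt.comp_hasDerivAt t h1
  refine ((h1.inner ℝ h2).const_mul (1 / 2)).congr_deriv ?_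
  have h3 := hs.inner_opInv_comm (x - lift N P (η t)) (lift N P (velocity N P A J Hbar (η t)))
  have h4 := real_inner_comm (lift N P (velocity N P A J Hbar (η t)))
    (opInv A (x - lift N P (η t)))
  simp only [Function.comp_apply, LinearMap.coe_toContinuousLinearMap']
  linarith

lemma inner_opInv_drift (z p : X) :
    inner ℝ (opInv A z) ((A + J) p) = inner ℝ (z - J (opInv A z)) p := by
  have h1 := hs.A_symm (opInv A z) p
  have h2 := hs.J_antisymm (opInv A z) p
  rw [hs.A_opInv] at h1
  rw [LinearMap.add_apply, inner_add_right, inner_sub_left]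
  linarith

lemma exists_norm_η_le (t : ℝ) : ∃ R, ∀ τ ∈ Icc 0 t, ‖η τ‖ ≤ R :=
  isCompact_Icc.exists_bound_of_continuousOn (hs.continuousOn_η.mono fun _ h => h.1)

lemma continuousOn_η_fst (t : ℝ) :
    ContinuousOn (fun p : ℝ × X => (η p.1, p.2)) (Icc 0 t ×ˢ univ) :=
  (hs.continuousOn_η.comp continuousOn_fst fun _ hp => hp.1.1).prodMk continuousOn_snd

lemma microEnergy_nonneg (e : Y) (x : X) : 0 ≤ microEnergy N P A e x :=
  mul_nonneg (by norm_num) (hs.inner_opInv_nonneg _)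

variable (ha : Assumptions N M P A J H Hbar f η κ ρ lam Lam α β γ C₁ C₂ c)
include ha

lemma integrable_microEnergy (e : Y) {t : ℝ} (ht : 0 ≤ t) :
    Integrable (fun x => microEnergy N P A e x * f t x) (gibbs H) := by
  obtain ⟨C, hC0, hC⟩ := exists_microEnergy_bound N P A ‖e‖
  refine (((hs.micro_sol.integrable t ht).add (ha.iv t ht).1).const_mul (C * 2)).mono' ?_
    (ae_of_all _ fun x => ?_)
  · exact ((continuous_microEnergy N P A).comp
      (by fun_prop : Continuous fun x : X => (e, x))).aestronglyMeasurable.mul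
      (hs.micro_sol.integrable t ht).aestronglyMeasurable
  · have h0 := hs.micro_sol.nonneg t ht x
    rw [norm_mul, Real.norm_of_nonneg h0]
    calc _ ≤ C * (1 + ‖x‖) ^ 2 * f t x := mul_le_mul_of_nonneg_right (hC e le_rfl x) h0
      _ ≤ C * (2 * (1 + ‖x‖ ^ 2)) * f t x := by
          gcongr
          nlinarith [sq_nonneg (1 - ‖x‖)]
      _ = _ := by simp only [Pi.add_apply]; ring

end IsSystem
end Deviation

section QuadraticIdentity

variable {X Y : Type*}
  [NormedAddCommGroup X] [InnerProductSpace ℝ X] [FiniteDimensional ℝ X]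
  [MeasurableSpace X] [BorelSpace X]
  [NormedAddCommGroup Y] [InnerProductSpace ℝ Y] [FiniteDimensional ℝ Y]
  [MeasurableSpace Y] [BorelSpace Y]
  {N M : ℕ} {P : X →ₗ[ℝ] Y} {A J : X →ₗ[ℝ] X} {H : X → ℝ} {Hbar : Y → ℝ}
  {f : ℝ → X → ℝ} {η : ℝ → Y} {κ ρ lam Lam α β γ C₁ C₂ c : ℝ}

/-- The weighted density of the time derivative of `e ^ (-Ct) ∫ microEnergy f dμ`. -/
noncomputable def energyRate (N : ℕ) (P : X →ₗ[ℝ] Y) (A J : X →ₗ[ℝ] X) (Hbar : Y → ℝ)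
    (f : ℝ → X → ℝ) (η : ℝ → Y) (C : ℝ) (p : ℝ × X) : ℝ :=
  Real.exp (-(C * p.1)) *
    ((inner ℝ (opInv A (p.2 - lift N P (η p.1))) (lift N P (velocity N P A J Hbar (η p.1))) -
        C * microEnergy N P A (η p.1) p.2) * f p.1 p.2 -
      inner ℝ (relDrift N P A J (η p.1) p.2) (gradient (f p.1) p.2))

/-- The weighted density of the term that is integrated by parts. -/
noncomputable def exchangeRate (N : ℕ) (P : X →ₗ[ℝ] Y) (A J : X →ₗ[ℝ] X) (H : X → ℝ)
    (f : ℝ → X → ℝ) (η : ℝ → Y) (C : ℝ) (p : ℝ × X) : ℝ :=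
  Real.exp (-(C * p.1)) *
    ((Module.finrank ℝ Y -
        inner ℝ (lift N P (P (relDrift N P A J (η p.1) p.2))) (gradient H p.2)) * f p.1 p.2 +
      inner ℝ (lift N P (P (relDrift N P A J (η p.1) p.2))) (gradient (f p.1) p.2))

namespace IsSystem

variable (hs : IsSystem N M P A J H Hbar f η)
include hs

lemma hasDerivAt_exp_mul_microEnergy (C : ℝ) {t : ℝ} (ht : 0 < t) (x : X) :
    HasDerivAt (fun r => Real.exp (-(C * r)) * microEnergy N P A (η r) x)
      (Real.exp (-(C * t)) * (inner ℝ (opInv A (x - lift N P (η t)))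
        (lift N P (velocity N P A J Hbar (η t))) - C * microEnergy N P A (η t) x)) t := by
  have h1 : HasDerivAt (fun r : ℝ => Real.exp (-(C * r))) (Real.exp (-(C * t)) * (-(C * 1))) t :=
    (((hasDerivAt_id t).const_mul C).neg).exp
  refine (h1.mul (hs.hasDerivAt_microEnergy ht x)).congr_deriv ?_
  ring

lemma continuousOn_velocity_fst (t : ℝ) :
    ContinuousOn (fun p : ℝ × X => velocity N P A J Hbar (η p.1)) (Icc 0 t ×ˢ univ) :=
  hs.continuous_velocity.comp_continuousOn
    (hs.continuousOn_η.comp continuousOn_fst fun _ hp => hp.1.1)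

lemma continuousOn_deviation (t : ℝ) :
    ContinuousOn (fun p : ℝ × X => p.2 - lift N P (η p.1)) (Icc 0 t ×ˢ univ) := by
  have h1 : Continuous (lift N P) := LinearMap.continuous_of_finiteDimensional _
  exact continuousOn_snd.sub (h1.comp_continuousOn
    (hs.continuousOn_η.comp continuousOn_fst fun _ hp => hp.1.1))

lemma continuousOn_microEnergy (t : ℝ) :
    ContinuousOn (fun p : ℝ × X => microEnergy N P A (η p.1) p.2) (Icc 0 t ×ˢ univ) :=
  (continuous_microEnergy N P A).comp_continuousOn (hs.continuousOn_η_fst t)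

lemma continuousOn_relDrift (t : ℝ) :
    ContinuousOn (fun p : ℝ × X => relDrift N P A J (η p.1) p.2) (Icc 0 t ×ˢ univ) :=
  (continuous_relDrift N P A J).comp_continuousOn (hs.continuousOn_η_fst t)

lemma continuousOn_energyWeight (C t : ℝ) :
    ContinuousOn (fun p : ℝ × X => inner ℝ (opInv A (p.2 - lift N P (η p.1)))
        (lift N P (velocity N P A J Hbar (η p.1))) -
      C * microEnergy N P A (η p.1) p.2) (Icc 0 t ×ˢ univ) := by
  have h1 : Continuous (lift N P) := LinearMap.continuous_of_finiteDimensional _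
  have h2 : Continuous (opInv A) := LinearMap.continuous_of_finiteDimensional _
  exact ((h2.comp_continuousOn (hs.continuousOn_deviation t)).inner
    (h1.comp_continuousOn (hs.continuousOn_velocity_fst t))).sub
    ((hs.continuousOn_microEnergy t).const_smul C)

lemma continuousOn_energyRate (C t : ℝ) :
    ContinuousOn (energyRate N P A J Hbar f η C) (Ioc 0 t ×ˢ univ) := by
  have hsub : Ioc 0 t ×ˢ (univ : Set X) ⊆ Icc 0 t ×ˢ univ := prod_mono Ioc_subset_Icc_self le_rfl
  have h0 : Continuous fun p : ℝ × X => Real.exp (-(C * p.1)) := by fun_prop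
  exact h0.continuousOn.mul ((((hs.continuousOn_energyWeight C t).mono hsub).mul
    (hs.continuousOn_f_Ioc t)).sub (((hs.continuousOn_relDrift t).mono hsub).inner
      (hs.continuousOn_gradient_Ioc t)))

/-- The test function of the quadratic functional, with a cutoff in space. -/
lemma integral_energyRate_cutoff (C : ℝ) {t : ℝ} (ht : 0 < t) (k : ℕ) :
    ∫ x, cutoff k x * (Real.exp (-(C * t)) * microEnergy N P A (η t) x) * f t x ∂(gibbs H) -
        ∫ x, cutoff k x * (Real.exp (-(C * 0)) * microEnergy N P A (η 0) x) * f 0 x ∂(gibbs H) =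
      ∫ p, (cutoff k p.2 * energyRate N P A J Hbar f η C p +
        -(Real.exp (-(C * p.1)) * microEnergy N P A (η p.1) p.2 *
          fderiv ℝ (cutoff (X := X) k) p.2 ((A + J) (gradient (f p.1) p.2))))
        ∂(spaceTime H 0 t) := by
  have h2 : Continuous (opInv A) := LinearMap.continuous_of_finiteDimensional _
  have hχ : Continuous fun p : ℝ × X => cutoff k p.2 := (cutoff_continuous k).comp continuous_snd
  have hχ' : Continuous fun p : ℝ × X => fderiv ℝ (cutoff (X := X) k) p.2 :=
    (continuous_fderiv_cutoff k).comp continuous_snd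
  have h0 : Continuous fun p : ℝ × X => Real.exp (-(C * p.1)) := by fun_prop
  have hw : ContinuousOn (fun p : ℝ × X => Real.exp (-(C * p.1)) *
      microEnergy N P A (η p.1) p.2) (Icc 0 t ×ˢ univ) :=
    h0.continuousOn.mul (hs.continuousOn_microEnergy t)
  have h := hs.weak_identity_zero ht
    (ψ := fun τ x => cutoff k x * (Real.exp (-(C * τ)) * microEnergy N P A (η τ) x))
    (e := fun τ x => cutoff k x * (Real.exp (-(C * τ)) *
      (inner ℝ (opInv A (x - lift N P (η τ))) (lift N P (velocity N P A J Hbar (η τ))) -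
        C * microEnergy N P A (η τ) x)))
    (ψ' := fun τ x => cutoff k x • (Real.exp (-(C * τ)) •
        innerSL ℝ (opInv A (x - lift N P (η τ)))) +
      (Real.exp (-(C * τ)) * microEnergy N P A (η τ) x) • fderiv ℝ (cutoff (X := X) k) x)
    (isCompact_closedBall (0 : X) (2 * ((k : ℝ) + 1)))
    (fun τ hτ x => (hs.hasDerivAt_exp_mul_microEnergy C hτ.1 x).const_mul _)
    (fun τ _ x => (hasFDerivAt_cutoff k x).mul
      ((hs.hasFDerivAt_microEnergy (η τ) x).const_mul _))
    (hχ.continuousOn.mul hw)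
    ((hχ.continuousOn.smul (h0.continuousOn.smul ((innerSL ℝ).continuous.comp_continuousOn
      (h2.comp_continuousOn (hs.continuousOn_deviation t))))).add (hw.smul hχ'.continuousOn))
    (hχ.continuousOn.mul (h0.continuousOn.mul (hs.continuousOn_energyWeight C t)))
    (fun τ x hx => by simp [cutoff_eq_zero hx])
    (fun τ x hx => by simp [cutoff_eq_zero hx, cutoff_fderiv_eq_zero hx])
    (fun τ x hx => by simp [cutoff_eq_zero hx])
  rw [h]
  refine integral_congr_ae (ae_of_all _ fun p => ?_)
  have h3 := hs.inner_opInv_drift (p.2 - lift N P (η p.1)) (gradient (f p.1) p.2)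
  simp only [_root_.add_apply, _root_.smul_apply, smul_eq_mul,
    innerSL_apply_apply, h3, energyRate, relDrift]
  ring

/-- Integration by parts of the macroscopic part of the drift, with a cutoff in space. -/
lemma integral_exchangeRate_cutoff_slice
    (ha : Assumptions N M P A J H Hbar f η κ ρ lam Lam α β γ C₁ C₂ c) (C : ℝ) {t : ℝ} (ht : 0 < t)
    (k : ℕ) :
    ∫ x, (cutoff k x * exchangeRate N P A J H f η C (t, x) +
        Real.exp (-(C * t)) * f t x * fderiv ℝ (cutoff (X := X) k) x
          (lift N P (P (relDrift N P A J (η t) x)))) ∂(gibbs H) = 0 := by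
  obtain ⟨D, hD⟩ : ∃ D : X →ₗ[ℝ] X, D = lift N P ∘ₗ P ∘ₗ (LinearMap.id - J ∘ₗ opInv A) := ⟨_, rfl⟩
  have hDr : ∀ x, lift N P (P (relDrift N P A J (η t) x)) = D (x - lift N P (η t)) := fun x => by
    rw [hD]; rfl
  have htr := hs.trace_drift ha
  rw [← hD] at htr
  set V : X → X := fun x => Real.exp (-H x) • D (x - lift N P (η t)) with hV
  have hVd : ∀ x, HasFDerivAt V (Real.exp (-H x) • D.toContinuousLinearMap +
      (Real.exp (-H x) • -fderiv ℝ H x).smulRight (D (x - lift N P (η t)))) x := fun x => by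
    have h1 : HasFDerivAt (fun x => D (x - lift N P (η t))) D.toContinuousLinearMap x :=
      D.toContinuousLinearMap.hasFDerivAt.comp x ((hasFDerivAt_id x).sub_const _)
    have h2 : HasFDerivAt (fun x => Real.exp (-H x)) (Real.exp (-H x) • -fderiv ℝ H x) x :=
      ((hs.H_contDiff.differentiable (by norm_num) x).hasFDerivAt.neg).exp
    exact h2.smul h1
  have hVc : ContDiff ℝ 1 V := by
    have h1 : ContDiff ℝ 1 H := hs.H_contDiff.of_le (by norm_num)
    have h2 : ContDiff ℝ 1 D := D.toContinuousLinearMap.contDiff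
    exact (h1.neg.exp).smul (h2.comp (contDiff_id.sub contDiff_const))
  have hdiv : ∀ x, divergence V x = (Module.finrank ℝ Y -
      inner ℝ (D (x - lift N P (η t))) (gradient H x)) * Real.exp (-H x) := fun x => by
    have h1 : ((Real.exp (-H x) • D.toContinuousLinearMap +
      (Real.exp (-H x) • -fderiv ℝ H x).smulRight (D (x - lift N P (η t))) : X →L[ℝ] X) :
        X →ₗ[ℝ] X) = Real.exp (-H x) • D + (((Real.exp (-H x) • -fderiv ℝ H x : X →L[ℝ] ℝ) :
        X →ₗ[ℝ] ℝ)).smulRight (D (x - lift N P (η t))) := rfl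
    rw [divergence, (hVd x).fderiv, h1, map_add, map_smul, htr, LinearMap.trace_smulRight,
      real_inner_comm, inner_gradient]
    simp
    ring
  have hfc := hs.micro_sol.contDiff t ht
  set ψ' : X → X →L[ℝ] ℝ := fun x =>
    cutoff k x • fderiv ℝ (f t) x + f t x • fderiv ℝ (cutoff (X := X) k) x with hψ'
  have hψ'c : Continuous ψ' :=
    ((cutoff_continuous k).smul (hfc.continuous_fderiv (by norm_num))).add
      (hfc.continuous.smul (continuous_fderiv_cutoff k))
  have hK := isCompact_closedBall (0 : X) (2 * ((k : ℝ) + 1))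
  have hψs : HasCompactSupport fun x => cutoff k x * f t x :=
    HasCompactSupport.intro hK fun x hx => by rw [cutoff_eq_zero hx, zero_mul]
  have hibp := integral_mul_divergence (ψ := fun x => cutoff k x * f t x) (ψ' := ψ')
    (fun x => (hasFDerivAt_cutoff k x).mul (hfc.differentiable (by norm_num) x).hasFDerivAt)
    hψ'c hψs hVc
  have hdivc : Continuous (divergence V) := by
    have h1 : Continuous D := LinearMap.continuous_of_finiteDimensional _
    have h2 := continuous_gradient hs.H_contDiff
    have h3 := hs.continuous_H
    rw [show divergence V = _ from funext hdiv]
    fun_prop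
  have h1 : Integrable fun x => cutoff k x * f t x * divergence V x :=
    Continuous.integrable_of_hasCompactSupport
      (((cutoff_continuous k).mul hfc.continuous).mul hdivc) hψs.mul_right
  have h2 : Integrable fun x => ψ' x (V x) :=
    Continuous.integrable_of_hasCompactSupport (hψ'c.clm_apply hVc.continuous)
      (HasCompactSupport.intro hK fun x hx => by
        simp [hψ', cutoff_eq_zero hx, cutoff_fderiv_eq_zero hx])
  have h3 : ∫ x, (cutoff k x * f t x * divergence V x + ψ' x (V x)) = 0 := by
    rw [integral_add h1 h2, hibp, neg_add_cancel]
  rw [hs.integral_gibbs]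
  refine mul_eq_zero_of_right _ ?_
  rw [← mul_zero (Real.exp (-(C * t))), ← h3, ← integral_const_mul]
  refine integral_congr_ae (ae_of_all _ fun x => ?_)
  have h4 := inner_gradient (Hbar := f t) x (D (x - lift N P (η t)))
  rw [real_inner_comm] at h4
  simp only [hdiv]
  simp only [hψ', hV, exchangeRate, hDr, _root_.add_apply, _root_.smul_apply, map_smul,
    smul_eq_mul, h4]
  ring

end IsSystem
end QuadraticIdentity

section QuadraticLimit

variable {X Y : Type*}
  [NormedAddCommGroup X] [InnerProductSpace ℝ X] [FiniteDimensional ℝ X]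
  [MeasurableSpace X] [BorelSpace X]
  [NormedAddCommGroup Y] [InnerProductSpace ℝ Y] [FiniteDimensional ℝ Y]
  [MeasurableSpace Y] [BorelSpace Y]
  {N M : ℕ} {P : X →ₗ[ℝ] Y} {A J : X →ₗ[ℝ] X} {H : X → ℝ} {Hbar : Y → ℝ}
  {f : ℝ → X → ℝ} {η : ℝ → Y} {κ ρ lam Lam α β γ C₁ C₂ c : ℝ}

lemma norm_exp_neg_le_one {C τ : ℝ} (hC : 0 ≤ C) (hτ : 0 ≤ τ) : ‖Real.exp (-(C * τ))‖ ≤ 1 := by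
  rw [Real.norm_of_nonneg (Real.exp_pos _).le]
  exact Real.exp_le_one_iff.2 (neg_nonpos.2 (mul_nonneg hC hτ))

namespace IsSystem

variable (hs : IsSystem N M P A J H Hbar f η)
include hs

lemma continuousOn_exchangeRate (C t : ℝ) :
    ContinuousOn (exchangeRate N P A J H f η C) (Ioc 0 t ×ˢ univ) := by
  have hsub : Ioc 0 t ×ˢ (univ : Set X) ⊆ Icc 0 t ×ˢ univ := prod_mono Ioc_subset_Icc_self le_rfl
  have h0 : Continuous fun p : ℝ × X => Real.exp (-(C * p.1)) := by fun_prop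
  have h1 : Continuous (lift N P) := LinearMap.continuous_of_finiteDimensional _
  have h2 : Continuous P := LinearMap.continuous_of_finiteDimensional _
  have h3 := h1.comp_continuousOn (h2.comp_continuousOn ((hs.continuousOn_relDrift t).mono hsub))
  have h4 : Continuous fun p : ℝ × X => gradient H p.2 :=
    (continuous_gradient hs.H_contDiff).comp continuous_snd
  exact h0.continuousOn.mul (((continuousOn_const.sub (h3.inner h4.continuousOn)).mul
    (hs.continuousOn_f_Ioc t)).add (h3.inner (hs.continuousOn_gradient_Ioc t)))

lemma exists_gradient_bound (hLam : 0 ≤ Lam)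
    (hlow : ∀ y v, 0 ≤ hess Hbar y v v) (hup : ∀ y v, hess Hbar y v v ≤ Lam * ‖v‖ ^ 2) :
    ∃ C, 0 ≤ C ∧ ∀ x : X, ‖gradient Hbar (P x)‖ ≤ C * (1 + ‖x‖) := by
  set P' := LinearMap.toContinuousLinearMap P
  refine ⟨‖gradient Hbar 0‖ + Lam * ‖P'‖, by positivity, fun x => ?_⟩
  have h1 := norm_gradient_sub_le hs.Hbar_contDiff hLam hlow hup (P x) 0
  have h2 : ‖P x‖ ≤ ‖P'‖ * ‖x‖ := P'.le_opNorm x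
  have h3 := norm_le_norm_add_norm_sub' (gradient Hbar (P x)) (gradient Hbar 0)
  rw [sub_zero] at h1
  have h4 := mul_le_mul_of_nonneg_left h2 hLam
  have h5 : 0 ≤ Lam * ‖P'‖ := by positivity
  have h6 : 0 ≤ ‖gradient Hbar 0‖ * ‖x‖ := by positivity
  nlinarith [norm_nonneg x]

variable (ha : Assumptions N M P A J H Hbar f η κ ρ lam Lam α β γ C₁ C₂ c)
include ha

lemma tendsto_integral_cutoff_microEnergy (a : ℝ) (e : Y) {t : ℝ} (ht : 0 ≤ t) :
    Tendsto (fun k => ∫ x, cutoff k x * (a * microEnergy N P A e x) * f t x ∂(gibbs H)) atTop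
      (𝓝 (a * ∫ x, microEnergy N P A e x * f t x ∂(gibbs H))) := by
  have hi := (hs.integrable_microEnergy ha e ht).const_mul a
  rw [← integral_const_mul]
  simp only [mul_assoc]
  refine tendsto_integral_of_dominated_convergence
    (fun x => ‖a * (microEnergy N P A e x * f t x)‖)
    (fun k => (cutoff_continuous k).aestronglyMeasurable.mul hi.aestronglyMeasurable) hi.norm
    (fun k => ae_of_all _ fun x => ?_) (ae_of_all _ fun x => ?_)
  · rw [norm_mul, Real.norm_of_nonneg (cutoff_nonneg k x)]
    exact mul_le_of_le_one_left (norm_nonneg _) (cutoff_le_one k x)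
  · refine tendsto_const_nhds.congr' ?_
    filter_upwards [cutoff_eventually_eq_one x] with k hk
    rw [hk, one_mul]

/-- The evolution of the quadratic functional. -/
lemma integral_energyRate (hα : 0 ≤ α) {C : ℝ} (hC : 0 ≤ C) {t : ℝ} (ht : 0 < t) :
    Integrable (energyRate N P A J Hbar f η C) (spaceTime H 0 t) ∧
      Real.exp (-(C * t)) * ∫ x, microEnergy N P A (η t) x * f t x ∂(gibbs H) -
          ∫ x, microEnergy N P A (η 0) x * f 0 x ∂(gibbs H) =
        ∫ p, energyRate N P A J Hbar f η C p ∂(spaceTime H 0 t) := by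
  obtain ⟨R, hR⟩ := hs.exists_norm_η_le t
  obtain ⟨Cq, hCq0, hCq⟩ := exists_microEnergy_bound N P A R
  obtain ⟨Ca, hCa0, hCa⟩ := exists_linear_bound N P (opInv A) R
  obtain ⟨Cd, hCd0, hCd⟩ := exists_linear_bound N P (LinearMap.id - J ∘ₗ opInv A : X →ₗ[ℝ] X) R
  obtain ⟨W, hW⟩ := isCompact_Icc.exists_bound_of_continuousOn
    ((LinearMap.continuous_of_finiteDimensional (lift N P)).comp_continuousOn
      (hs.continuous_velocity.comp_continuousOn
        (hs.continuousOn_η.mono (fun (_ : ℝ) (h : _ ∈ Icc 0 t) => h.1))))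
  have hgi := hs.integrable_one_add_mul_gradient ha hα ht
  have hfi := hs.integrable_one_add_sq_mul_f ha hα ht.le
  have hF : Integrable (energyRate N P A J Hbar f η C) (spaceTime H 0 t) := by
    refine ((hfi.const_mul (Ca * |W| + C * Cq)).add (hgi.const_mul Cd)).mono'
      (aestronglyMeasurable_spaceTime (hs.continuousOn_energyRate C t)) ?_
    filter_upwards [ae_spaceTime H 0 t] with p hp
    have hp' := Ioc_subset_Icc_self hp
    have hf0 := hs.micro_sol.nonneg p.1 hp.1.le p.2
    have h1 : 1 + ‖p.2‖ ≤ (1 + ‖p.2‖) ^ 2 := by nlinarith [norm_nonneg p.2]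
    have h2 : ‖inner ℝ (opInv A (p.2 - lift N P (η p.1)))
        (lift N P (velocity N P A J Hbar (η p.1)))‖ ≤ Ca * |W| * (1 + ‖p.2‖) ^ 2 :=
      calc _ ≤ ‖opInv A (p.2 - lift N P (η p.1))‖ *
            ‖lift N P (velocity N P A J Hbar (η p.1))‖ := norm_inner_le_norm _ _
        _ ≤ (Ca * (1 + ‖p.2‖)) * |W| :=
            mul_le_mul (hCa _ (hR _ hp') _) ((hW _ hp').trans (le_abs_self W)) (norm_nonneg _)
              (by positivity)
        _ = Ca * |W| * (1 + ‖p.2‖) := by ring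
        _ ≤ _ := mul_le_mul_of_nonneg_left h1 (by positivity)
    have h3 : ‖C * microEnergy N P A (η p.1) p.2‖ ≤ C * Cq * (1 + ‖p.2‖) ^ 2 := by
      rw [norm_mul, Real.norm_of_nonneg hC, mul_assoc]
      exact mul_le_mul_of_nonneg_left (hCq _ (hR _ hp') _) hC
    have h4 : ‖inner ℝ (relDrift N P A J (η p.1) p.2) (gradient (f p.1) p.2)‖ ≤
        Cd * ((1 + ‖p.2‖) * ‖gradient (f p.1) p.2‖) := by
      rw [← mul_assoc]
      exact (norm_inner_le_norm _ _).trans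
        (mul_le_mul_of_nonneg_right (hCd _ (hR _ hp') _) (norm_nonneg _))
    rw [energyRate, norm_mul]
    refine (mul_le_of_le_one_left (norm_nonneg _) (norm_exp_neg_le_one hC hp.1.le)).trans ?_
    refine (norm_sub_le _ _).trans (add_le_add ?_ h4)
    rw [norm_mul, Real.norm_of_nonneg hf0]
    calc _ ≤ (Ca * |W| * (1 + ‖p.2‖) ^ 2 + C * Cq * (1 + ‖p.2‖) ^ 2) * f p.1 p.2 :=
          mul_le_mul_of_nonneg_right ((norm_sub_le _ _).trans (add_le_add h2 h3)) hf0
      _ = _ := by ring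
  refine ⟨hF, ?_⟩
  set D := (A + J).toContinuousLinearMap with hD
  have hAJ : Continuous (A + J) := LinearMap.continuous_of_finiteDimensional _
  have h0 : Continuous fun p : ℝ × X => Real.exp (-(C * p.1)) := by fun_prop
  have hsub : Ioc 0 t ×ˢ (univ : Set X) ⊆ Icc 0 t ×ˢ univ := prod_mono Ioc_subset_Icc_self le_rfl
  have hlim := (tendsto_integral_cutoff hF (hgi.const_mul (Cq * ‖D‖))
    (R := fun k p => -(Real.exp (-(C * p.1)) * microEnergy N P A (η p.1) p.2 *
          fderiv ℝ (cutoff (X := X) k) p.2 ((A + J) (gradient (f p.1) p.2))))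
    (fun k => aestronglyMeasurable_spaceTime
      (((h0.continuousOn.mul ((hs.continuousOn_microEnergy t).mono hsub)).mul
        (((continuous_fderiv_cutoff k).comp continuous_snd).continuousOn.clm_apply
          (hAJ.comp_continuousOn (hs.continuousOn_gradient_Ioc t)))).neg))
    (fun k => by
      filter_upwards [ae_spaceTime H 0 t] with p hp
      have h1 := (fderiv ℝ (cutoff (X := X) k) p.2).le_opNorm ((A + J) (gradient (f p.1) p.2))
      have h2 : ‖(A + J) (gradient (f p.1) p.2)‖ ≤ ‖D‖ * ‖gradient (f p.1) p.2‖ :=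
        D.le_opNorm _
      have h3 := h1.trans (mul_le_mul_of_nonneg_left h2 (norm_nonneg _))
      rw [norm_neg, norm_mul, norm_mul]
      calc _ ≤ (1 * (Cq * (1 + ‖p.2‖) ^ 2)) * (‖fderiv ℝ (cutoff (X := X) k) p.2‖ *
            (‖D‖ * ‖gradient (f p.1) p.2‖)) := by
            refine mul_le_mul (mul_le_mul (norm_exp_neg_le_one hC hp.1.le)
              (hCq _ (hR _ (Ioc_subset_Icc_self hp)) _) (norm_nonneg _) zero_le_one) h3
              (norm_nonneg _) (by positivity)
        _ = _ := by ring)).2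
  refine tendsto_nhds_unique ?_ hlim
  simp_rw [← hs.integral_energyRate_cutoff C ht]
  have h5 := (hs.tendsto_integral_cutoff_microEnergy ha (Real.exp (-(C * t))) (η t) ht.le).sub
    (hs.tendsto_integral_cutoff_microEnergy ha (Real.exp (-(C * 0))) (η 0) le_rfl)
  simpa using h5

/-- Integration by parts of the macroscopic part of the drift. -/
lemma integral_exchangeRate (hκ : 0 < κ) (hρ : 0 < ρ) (hlam : 0 < lam) (hLam : 0 < Lam)
    (hα : 0 ≤ α) (hγ : 0 ≤ γ) {C : ℝ} (hC : 0 ≤ C) {t : ℝ} (ht : 0 < t) :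
    Integrable (exchangeRate N P A J H f η C) (spaceTime H 0 t) ∧
      ∫ p, exchangeRate N P A J H f η C p ∂(spaceTime H 0 t) = 0 := by
  obtain ⟨R, hR⟩ := hs.exists_norm_η_le t
  obtain ⟨Cd, hCd0, hCd⟩ := exists_linear_bound N P
    (P ∘ₗ (LinearMap.id - J ∘ₗ opInv A : X →ₗ[ℝ] X)) R
  obtain ⟨Cl, hCl0, hCl⟩ := exists_linear_bound N P
    (lift N P ∘ₗ P ∘ₗ (LinearMap.id - J ∘ₗ opInv A : X →ₗ[ℝ] X)) R
  obtain ⟨Cg, hCg0, hCg⟩ := hs.exists_gradient_bound hLam.le (hs.hess_nonneg ha hlam)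
    (fun y v => (ha.iii y v).2)
  have hN := hs.N_pos'
  have hgi := hs.integrable_one_add_mul_gradient ha hα ht
  have hfi := hs.integrable_one_add_sq_mul_f ha hα ht.le
  have hGi := hs.integrable_one_add_mul_forceFluct ha hκ hρ hα hγ ht
  have hF : Integrable (exchangeRate N P A J H f η C) (spaceTime H 0 t) := by
    refine (((hfi.const_mul (Module.finrank ℝ Y + N * (Cg * Cd))).add (hGi.const_mul Cd)).add
      (hgi.const_mul Cl)).mono'
      (aestronglyMeasurable_spaceTime (hs.continuousOn_exchangeRate C t)) ?_
    filter_upwards [ae_spaceTime H 0 t] with p hp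
    have hp' := Ioc_subset_Icc_self hp
    have hf0 := hs.micro_sol.nonneg p.1 hp.1.le p.2
    have h1 : 1 ≤ (1 + ‖p.2‖) ^ 2 := by nlinarith [norm_nonneg p.2]
    set v := P (relDrift N P A J (η p.1) p.2) with hv
    have hvle : ‖v‖ ≤ Cd * (1 + ‖p.2‖) := hCd _ (hR _ hp') _
    have h2 : inner ℝ (lift N P v) (gradient H p.2) =
        inner ℝ (forceFluct N P H Hbar p.2) v + N * inner ℝ (gradient Hbar (P p.2)) v := by
      rw [hs.inner_forceFluct, real_inner_comm, inner_gradient]; ring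
    have h3 : ‖inner ℝ (forceFluct N P H Hbar p.2) v‖ ≤
        Cd * ((1 + ‖p.2‖) * ‖forceFluct N P H Hbar p.2‖) :=
      (norm_inner_le_norm _ _).trans ((mul_le_mul_of_nonneg_left hvle (norm_nonneg _)).trans_eq
        (by ring))
    have h4 : ‖N * inner ℝ (gradient Hbar (P p.2)) v‖ ≤ N * (Cg * Cd) * (1 + ‖p.2‖) ^ 2 := by
      rw [norm_mul, Real.norm_of_nonneg hN.le]
      calc _ ≤ N * (‖gradient Hbar (P p.2)‖ * ‖v‖) :=
            mul_le_mul_of_nonneg_left (norm_inner_le_norm _ _) hN.le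
        _ ≤ N * ((Cg * (1 + ‖p.2‖)) * (Cd * (1 + ‖p.2‖))) :=
            mul_le_mul_of_nonneg_left (mul_le_mul (hCg _) hvle (norm_nonneg _) (by positivity))
              hN.le
        _ = _ := by ring
    have h5 : ‖inner ℝ (lift N P v) (gradient (f p.1) p.2)‖ ≤
        Cl * ((1 + ‖p.2‖) * ‖gradient (f p.1) p.2‖) := by
      rw [← mul_assoc]
      exact (norm_inner_le_norm _ _).trans
        (mul_le_mul_of_nonneg_right (hCl _ (hR _ hp') _) (norm_nonneg _))
    have h6 : ‖(Module.finrank ℝ Y : ℝ)‖ ≤ Module.finrank ℝ Y * (1 + ‖p.2‖) ^ 2 := by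
      rw [Real.norm_of_nonneg (by positivity)]
      exact le_mul_of_one_le_right (by positivity) h1
    rw [exchangeRate, norm_mul]
    refine (mul_le_of_le_one_left (norm_nonneg _) (norm_exp_neg_le_one hC hp.1.le)).trans ?_
    refine (norm_add_le _ _).trans (add_le_add ?_ h5)
    rw [norm_mul, Real.norm_of_nonneg hf0, h2]
    calc _ ≤ (Module.finrank ℝ Y * (1 + ‖p.2‖) ^ 2 +
          (Cd * ((1 + ‖p.2‖) * ‖forceFluct N P H Hbar p.2‖) +
            N * (Cg * Cd) * (1 + ‖p.2‖) ^ 2)) * f p.1 p.2 :=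
          mul_le_mul_of_nonneg_right ((norm_sub_le _ _).trans
            (add_le_add h6 ((norm_add_le _ _).trans (add_le_add h3 h4)))) hf0
      _ = _ := by simp only [Pi.add_apply]; ring
  refine ⟨hF, ?_⟩
  have h0 : Continuous fun p : ℝ × X => Real.exp (-(C * p.1)) := by fun_prop
  have hsub : Ioc 0 t ×ˢ (univ : Set X) ⊆ Icc 0 t ×ˢ univ := prod_mono Ioc_subset_Icc_self le_rfl
  have hl : Continuous (lift N P) := LinearMap.continuous_of_finiteDimensional _
  have hPc : Continuous P := LinearMap.continuous_of_finiteDimensional _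
  obtain ⟨hint, hlim⟩ := tendsto_integral_cutoff hF ((hs.integral_spaceTime_f ht.le).1.const_mul Cl)
    (R := fun k p => Real.exp (-(C * p.1)) * f p.1 p.2 * fderiv ℝ (cutoff (X := X) k) p.2
          (lift N P (P (relDrift N P A J (η p.1) p.2))))
    (fun k => aestronglyMeasurable_spaceTime
      ((h0.continuousOn.mul (hs.continuousOn_f_Ioc t)).mul
        (((continuous_fderiv_cutoff k).comp continuous_snd).continuousOn.clm_apply
          (hl.comp_continuousOn (hPc.comp_continuousOn ((hs.continuousOn_relDrift t).mono hsub))))))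
    (fun k => by
      filter_upwards [ae_spaceTime H 0 t] with p hp
      have hf0 := hs.micro_sol.nonneg p.1 hp.1.le p.2
      have h1 := (fderiv ℝ (cutoff (X := X) k) p.2).le_opNorm
        (lift N P (P (relDrift N P A J (η p.1) p.2)))
      have h2 : ‖lift N P (P (relDrift N P A J (η p.1) p.2))‖ ≤ Cl * (1 + ‖p.2‖) :=
        hCl _ (hR _ (Ioc_subset_Icc_self hp)) _
      have h3 := h1.trans (mul_le_mul_of_nonneg_left h2 (norm_nonneg _))
      rw [norm_mul, norm_mul, Real.norm_of_nonneg hf0]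
      calc _ ≤ (1 * f p.1 p.2) * (‖fderiv ℝ (cutoff (X := X) k) p.2‖ * (Cl * (1 + ‖p.2‖))) :=
            mul_le_mul (mul_le_mul_of_nonneg_right (norm_exp_neg_le_one hC hp.1.le) hf0) h3
              (norm_nonneg _) (by positivity)
        _ = _ := by ring)
  refine tendsto_nhds_unique hlim (tendsto_const_nhds.congr fun k => ?_)
  have hk := hint k
  rw [spaceTime] at hk ⊢
  rw [integral_prod _ hk, setIntegral_congr_fun measurableSet_Ioc fun τ hτ =>
    hs.integral_exchangeRate_cutoff_slice ha C hτ.1 k]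
  simp

end IsSystem
end QuadraticLimit

/-! ### The quantitative estimate -/

section Estimate

variable {X Y : Type*}
  [NormedAddCommGroup X] [InnerProductSpace ℝ X] [FiniteDimensional ℝ X]
  [MeasurableSpace X] [BorelSpace X]
  [NormedAddCommGroup Y] [InnerProductSpace ℝ Y] [FiniteDimensional ℝ Y]
  [MeasurableSpace Y] [BorelSpace Y]
  {N M : ℕ} {P : X →ₗ[ℝ] Y} {A J : X →ₗ[ℝ] X} {H : X → ℝ} {Hbar : Y → ℝ}
  {f : ℝ → X → ℝ} {η : ℝ → Y} {κ ρ lam Lam α β γ C₁ C₂ c : ℝ}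

/-- Half the exponential rate at which the quadratic distance may grow. -/
noncomputable def growthRate (lam Lam γ c : ℝ) : ℝ :=
  c * √γ / 2 + lam * c / 4 + c * Lam ^ 2 / lam

/-- A bound, uniform in `0 < t ≤ T`, for everything that drives the quadratic distance away from
zero; it is small compared with `N` when `M` and `N / M` are large. -/
noncomputable def errorBound (N M : ℕ) (κ ρ lam Lam α β γ C₁ C₂ c T : ℝ) : ℝ :=
  M * T + 2 / (lam * N) * (M * (4 * (κ ^ 2 * N) / ρ) *
      (1 / (2 * ρ) * (γ / (M : ℝ) ^ 2) * (C₁ * N) + T)) +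
    3 * (√γ / M) / 2 * (α * N * T) + √γ / M / 2 * N * dissipationBound Lam β C₂ c T +
    √γ / M * (C₁ * N)

/-- The density of the driving terms collected in `errorBound`. -/
noncomputable def errorRate (N M : ℕ) (P : X →ₗ[ℝ] Y) (A J : X →ₗ[ℝ] X) (H : X → ℝ) (Hbar : Y → ℝ)
    (f : ℝ → X → ℝ) (η : ℝ → Y) (lam γ c : ℝ) (p : ℝ × X) : ℝ :=
  M * f p.1 p.2 + 2 / (lam * N) * (‖forceFluct N P H Hbar p.2‖ ^ 2 * f p.1 p.2) +
    3 * (√γ / M) / 2 * (‖p.2‖ ^ 2 * f p.1 p.2) +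
    √γ / M / 2 * N * (macroDissipation N P A J Hbar c (η p.1) * f p.1 p.2) +
    √γ / M * (dissipation A (f p.1) p.2).toReal

namespace IsSystem

variable (hs : IsSystem N M P A J H Hbar f η)
include hs

lemma integrable_dist_sq (ha : Assumptions N M P A J H Hbar f η κ ρ lam Lam α β γ C₁ C₂ c)
    (hα : 0 ≤ α) {t : ℝ} (ht : 0 ≤ t) :
    Integrable (fun p : ℝ × X => ‖P p.2 - η p.1‖ ^ 2 * f p.1 p.2) (spaceTime H 0 t) := by
  obtain ⟨R, hR⟩ := hs.exists_norm_η_le t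
  obtain ⟨C, hC0, hC⟩ := exists_linear_bound N P P R
  have hsub : Ioc 0 t ×ˢ (univ : Set X) ⊆ Icc 0 t ×ˢ univ := prod_mono Ioc_subset_Icc_self le_rfl
  have hPc : Continuous P := LinearMap.continuous_of_finiteDimensional _
  have h1 : ContinuousOn (fun p : ℝ × X => P p.2 - η p.1) (Ioc 0 t ×ˢ univ) :=
    (hPc.comp continuous_snd).continuousOn.sub
      (hs.continuousOn_η.comp continuousOn_fst fun _ hp => hp.1.1.le)
  refine ((hs.integrable_one_add_sq_mul_f ha hα ht).const_mul (C ^ 2)).mono'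
    (aestronglyMeasurable_spaceTime ((h1.norm.pow 2).mul (hs.continuousOn_f_Ioc t))) ?_
  filter_upwards [ae_spaceTime H 0 t] with p hp
  have hf0 := hs.micro_sol.nonneg p.1 hp.1.le p.2
  have h2 := hC _ (hR _ (Ioc_subset_Icc_self hp)) p.2
  rw [map_sub, hs.P_lift] at h2
  rw [Real.norm_of_nonneg (by positivity), ← mul_assoc, ← mul_pow]
  gcongr

variable (ha : Assumptions N M P A J H Hbar f η κ ρ lam Lam α β γ C₁ C₂ c)
include ha

lemma growthRate_nonneg (hc : 0 ≤ c) (hlam : 0 < lam) : 0 ≤ growthRate lam Lam γ c := by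
  unfold growthRate; positivity

/-- The pointwise inequality behind the estimate: the rates of change are dominated by the
contraction of the macroscopic flow and the driving terms. -/
lemma energyRate_add_exchangeRate_le (hc : 0 ≤ c) (hlam : 0 < lam) (hLam : 0 < Lam) (hγ : 0 ≤ γ)
    {p : ℝ × X} (hp : 0 < p.1) :
    energyRate N P A J Hbar f η (2 * growthRate lam Lam γ c) p +
        exchangeRate N P A J H f η (2 * growthRate lam Lam γ c) p ≤
      -(N * lam / 2) * (Real.exp (-(2 * growthRate lam Lam γ c * p.1)) *
        (‖P p.2 - η p.1‖ ^ 2 * f p.1 p.2)) +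
      errorRate N M P A J H Hbar f η lam γ c p := by
  have hN := hs.N_pos'
  have hφ := hs.micro_sol.nonneg p.1 hp.le p.2
  have hQ0 : 0 ≤ (dissipation A (f p.1) p.2).toReal := ENNReal.toReal_nonneg
  have hC := hs.growthRate_nonneg ha hc hlam (Lam := Lam) (γ := γ)
  have hD := hs.macroDissipation_nonneg (c := c) hc (η p.1)
  have key := hs.drift_le ha hc hγ hlam p.2 (η p.1) (gradient Hbar (η p.1))
    (gradient Hbar (P p.2)) (gradient H p.2) (gradient (f p.1) p.2) hφ hQ0
    (hs.inner_gradient_eq hp p.2)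
    (le_inner_gradient_sub hs.Hbar_contDiff (fun y v => (ha.iii y v).1) _ _)
    (norm_gradient_sub_le hs.Hbar_contDiff hLam.le (hs.hess_nonneg ha hlam)
      (fun y v => (ha.iii y v).2) _ _)
  have hE : 0 ≤ errorRate N M P A J H Hbar f η lam γ c p := by
    unfold errorRate
    positivity
  set ω := Real.exp (-(2 * growthRate lam Lam γ c * p.1)) with hω
  have hω0 : 0 ≤ ω := (Real.exp_pos _).le
  have hω1 : ω ≤ 1 :=
    Real.exp_le_one_iff.2 (neg_nonpos.2 (mul_nonneg (mul_nonneg two_pos.le hC) hp.le))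
  set d := relDrift N P A J (η p.1) p.2 with hd
  have hadj : inner ℝ d (gradient (f p.1) p.2 - lift N P (P (gradient (f p.1) p.2))) =
      inner ℝ d (gradient (f p.1) p.2) - inner ℝ (lift N P (P d)) (gradient (f p.1) p.2) := by
    rw [inner_sub_right, inner_lift_right, inner_lift]
  have hsum : energyRate N P A J Hbar f η (2 * growthRate lam Lam γ c) p +
      exchangeRate N P A J H f η (2 * growthRate lam Lam γ c) p =
      ω * (-inner ℝ d (gradient (f p.1) p.2 - lift N P (P (gradient (f p.1) p.2))) +
        f p.1 p.2 * (Module.finrank ℝ Y - inner ℝ (lift N P (P d)) (gradient H p.2)) +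
        f p.1 p.2 * inner ℝ (opInv A (p.2 - lift N P (η p.1)))
          (lift N P (velocity N P A J Hbar (η p.1))) -
        2 * growthRate lam Lam γ c * microEnergy N P A (η p.1) p.2 * f p.1 p.2) := by
    rw [energyRate, exchangeRate, hadj]
    ring
  -- Since `microEnergy` carries the factor `1 / 2`, the weight contributes exactly `growthRate`
  -- times `⟨z, A⁻¹ z⟩` and cancels that term of `drift_le`.
  have hle : -inner ℝ d (gradient (f p.1) p.2 - lift N P (P (gradient (f p.1) p.2))) +
        f p.1 p.2 * (Module.finrank ℝ Y - inner ℝ (lift N P (P d)) (gradient H p.2)) +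
        f p.1 p.2 * inner ℝ (opInv A (p.2 - lift N P (η p.1)))
          (lift N P (velocity N P A J Hbar (η p.1))) -
        2 * growthRate lam Lam γ c * microEnergy N P A (η p.1) p.2 * f p.1 p.2 ≤
      -(N * lam / 2) * (‖P p.2 - η p.1‖ ^ 2 * f p.1 p.2) +
        errorRate N M P A J H Hbar f η lam γ c p := by
    refine (sub_le_sub_right key _).trans_eq ?_
    rw [errorRate, macroDissipation, microEnergy, growthRate, forceFluct, velocity]
    ring
  rw [hsum]
  calc _ ≤ ω * (-(N * lam / 2) * (‖P p.2 - η p.1‖ ^ 2 * f p.1 p.2) +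
        errorRate N M P A J H Hbar f η lam γ c p) := mul_le_mul_of_nonneg_left hle hω0
    _ = -(N * lam / 2) * (ω * (‖P p.2 - η p.1‖ ^ 2 * f p.1 p.2)) +
        ω * errorRate N M P A J H Hbar f η lam γ c p := by ring
    _ ≤ _ := add_le_add_right (mul_le_of_le_one_left hE hω1) _

lemma integral_errorRate_le (hc : 0 ≤ c) (hκ : 0 < κ) (hρ : 0 < ρ) (hlam : 0 < lam)
    (hLam : 0 < Lam) (hα : 0 ≤ α) (hγ : 0 ≤ γ) {t T : ℝ} (ht : 0 < t) (htT : t ≤ T) :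
    Integrable (errorRate N M P A J H Hbar f η lam γ c) (spaceTime H 0 t) ∧
      ∫ p, errorRate N M P A J H Hbar f η lam γ c p ∂(spaceTime H 0 t) ≤
        errorBound N M κ ρ lam Lam α β γ C₁ C₂ c T := by
  have hN := hs.N_pos'
  have hC := hs.C₁_mul_nonneg ha
  obtain ⟨i1, b1⟩ := hs.integral_spaceTime_f ht.le
  obtain ⟨i2, b2⟩ := hs.integral_forceFluct_sq ha hκ hρ hγ ht
  obtain ⟨i3, b3⟩ := hs.integral_norm_sq_mul_f ha hα ht.le
  obtain ⟨i4, b4⟩ := hs.integral_spaceTime_mul_f (t := t)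
    (g := fun τ => macroDissipation N P A J Hbar c (η τ))
    ((hs.continuous_macroDissipation c).comp_continuousOn
      (hs.continuousOn_η.mono fun _ h => h.1))
  obtain ⟨i5, b5⟩ := hs.integral_dissipation ha ht
  have b4' := b4.trans_le (hs.macro_energy ha hc hlam hLam ht.le htT)
  have j1 := i1.const_mul (M : ℝ)
  have j2 := i2.const_mul (2 / (lam * N))
  have j3 := i3.const_mul (3 * (√γ / M) / 2)
  have j4 := i4.const_mul (√γ / M / 2 * N)
  have j5 := i5.const_mul (√γ / M)
  refine ⟨(((j1.add j2).add j3).add j4).add j5, ?_⟩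
  have e : ∫ p, errorRate N M P A J H Hbar f η lam γ c p ∂(spaceTime H 0 t) = _ :=
    (integral_add (((j1.add j2).add j3).add j4) j5).trans (congrArg (· + _)
      ((integral_add ((j1.add j2).add j3) j4).trans (congrArg (· + _)
        ((integral_add (j1.add j2) j3).trans (congrArg (· + _) (integral_add j1 j2))))))
  rw [e]
  simp only [integral_const_mul]
  rw [errorBound]
  gcongr
  · exact b1.trans htT
  · refine b2.trans ?_
    gcongr
  · refine b3.trans ?_
    gcongr

/-- The quantitative estimate at a fixed size of the system. -/
lemma microEnergy_evolution_le (hc : 0 ≤ c) (hκ : 0 < κ) (hρ : 0 < ρ) (hlam : 0 < lam)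
    (hLam : 0 < Lam) (hα : 0 ≤ α) (hγ : 0 ≤ γ) {t T : ℝ} (ht : 0 < t) (htT : t ≤ T) :
    Real.exp (-(2 * growthRate lam Lam γ c * T)) *
        (∫ x, microEnergy N P A (η t) x * f t x ∂(gibbs H) +
          N * lam / 2 * ∫ p, ‖P p.2 - η p.1‖ ^ 2 * f p.1 p.2 ∂(spaceTime H 0 t)) ≤
      ∫ x, microEnergy N P A (η 0) x * f 0 x ∂(gibbs H) +
        errorBound N M κ ρ lam Lam α β γ C₁ C₂ c T := by
  have hN := hs.N_pos'
  set C := 2 * growthRate lam Lam γ c with hCdef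
  have hC : 0 ≤ C := mul_nonneg two_pos.le (hs.growthRate_nonneg ha hc hlam)
  obtain ⟨i1, e1⟩ := hs.integral_energyRate ha hα hC ht
  obtain ⟨i2, e2⟩ := hs.integral_exchangeRate ha hκ hρ hlam hLam hα hγ hC ht
  obtain ⟨i3, b3⟩ := hs.integral_errorRate_le ha hc hκ hρ hlam hLam hα hγ ht htT
  have i4 := hs.integrable_dist_sq ha hα ht.le
  have hexp : ∀ τ, τ ≤ T → Real.exp (-(C * T)) ≤ Real.exp (-(C * τ)) := fun τ hτ =>
    Real.exp_le_exp.2 (neg_le_neg (mul_le_mul_of_nonneg_left hτ hC))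
  have hpt : ∀ᵐ p ∂(spaceTime H 0 t), energyRate N P A J Hbar f η C p +
      exchangeRate N P A J H f η C p ≤
      -(N * lam / 2 * Real.exp (-(C * T))) * (‖P p.2 - η p.1‖ ^ 2 * f p.1 p.2) +
        errorRate N M P A J H Hbar f η lam γ c p := by
    filter_upwards [ae_spaceTime H 0 t] with p hp
    have hφ := hs.micro_sol.nonneg p.1 hp.1.le p.2
    refine (hs.energyRate_add_exchangeRate_le ha hc hlam hLam hγ hp.1).trans
      (add_le_add_left ?_ _)
    have h1 := mul_le_mul_of_nonneg_right (hexp p.1 (hp.2.trans htT))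
      (mul_nonneg (sq_nonneg ‖P p.2 - η p.1‖) hφ)
    have h2 := mul_le_mul_of_nonneg_left h1 (show 0 ≤ N * lam / 2 by positivity)
    linarith
  have hint := integral_mono_ae (i1.add i2) ((i4.const_mul _).add i3) hpt
  have h3 := integral_add i1 i2
  have h4 := integral_add (i4.const_mul (-(N * lam / 2 * Real.exp (-(C * T))))) i3
  simp only [Pi.add_apply] at hint h3 h4
  rw [h3, h4, integral_const_mul, e2] at hint
  have h5 : 0 ≤ ∫ x, microEnergy N P A (η t) x * f t x ∂(gibbs H) := integral_nonneg fun x =>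
    mul_nonneg (hs.microEnergy_nonneg _ _) (hs.micro_sol.nonneg t ht.le x)
  have h6 := mul_le_mul_of_nonneg_right (hexp t htT) h5
  linarith

end IsSystem
end Estimate

/-! ### The limit of large systems -/

section Limit

variable {X Y : Type*}
  [NormedAddCommGroup X] [InnerProductSpace ℝ X] [FiniteDimensional ℝ X]
  [MeasurableSpace X] [BorelSpace X]
  [NormedAddCommGroup Y] [InnerProductSpace ℝ Y] [FiniteDimensional ℝ Y]
  [MeasurableSpace Y] [BorelSpace Y]
  {N M : ℕ} {P : X →ₗ[ℝ] Y} {A J : X →ₗ[ℝ] X} {H : X → ℝ} {Hbar : Y → ℝ}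
  {f : ℝ → X → ℝ} {η : ℝ → Y} {κ ρ lam Lam α β γ C₁ C₂ c : ℝ}

namespace IsSystem

variable (hs : IsSystem N M P A J H Hbar f η)
include hs

lemma macroDistance_le {t : ℝ} (ht : 0 < t) (e : Y) :
    macroDistance P H (f t) e ≤ ∫⁻ x, ENNReal.ofReal (‖P x - e‖ ^ 2 * f t x) ∂(gibbs H) := by
  have hfc := (hs.micro_sol.contDiff t ht).continuous
  have hf0 := hs.micro_sol.nonneg t ht.le
  rw [← lintegral_condMeasure (F := fun p : Y × X => ENNReal.ofReal (‖p.1 - e‖ ^ 2 * f t p.2)) P H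
    (by fun_prop)]
  refine lintegral_mono fun y => ?_
  rw [macroDensity, ← integral_const_mul, integral_eq_lintegral_of_nonneg_ae
    (ae_of_all _ fun x => mul_nonneg (sq_nonneg _) (hf0 x))
    (hfc.const_smul (‖y - e‖ ^ 2)).aestronglyMeasurable]
  exact ENNReal.ofReal_toReal_le

variable (ha : Assumptions N M P A J H Hbar f η κ ρ lam Lam α β γ C₁ C₂ c)
include ha

lemma microDistance_eq (e : Y) {t : ℝ} (ht : 0 ≤ t) :
    microDistance N P A H (f t) e =
      ENNReal.ofReal (2 / N * ∫ x, microEnergy N P A e x * f t x ∂(gibbs H)) := by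
  have hN := hs.N_pos'
  have hi := (hs.integrable_microEnergy ha e ht).const_mul 2
  have h1 : ∀ x, inner ℝ (x - lift N P e) (opInv A (x - lift N P e)) * f t x =
      2 * (microEnergy N P A e x * f t x) := fun x => by rw [microEnergy]; ring
  rw [microDistance]
  simp_rw [h1]
  rw [← ofReal_integral_eq_lintegral_ofReal hi (ae_of_all _ fun x => mul_nonneg two_pos.le
    (mul_nonneg (hs.microEnergy_nonneg e x) (hs.micro_sol.nonneg t ht x))), integral_const_mul,
    ← ENNReal.ofReal_natCast N, ← ENNReal.ofReal_div_of_pos hN]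
  congr 1
  ring

lemma lintegral_macroDistance_le (hα : 0 ≤ α) {T : ℝ} (hT : 0 < T) :
    ∫⁻ t in Icc 0 T, macroDistance P H (f t) (η t) ≤
      ENNReal.ofReal (∫ p, ‖P p.2 - η p.1‖ ^ 2 * f p.1 p.2 ∂(spaceTime H 0 T)) := by
  have hi := hs.integrable_dist_sq ha hα hT.le
  have h0 : ∀ᵐ p ∂(spaceTime H 0 T), 0 ≤ ‖P p.2 - η p.1‖ ^ 2 * f p.1 p.2 := by
    filter_upwards [hs.ae_nonneg_f T] with p hp
    exact mul_nonneg (sq_nonneg _) hp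
  rw [ofReal_integral_eq_lintegral_ofReal hi h0]
  have hm := hi.aestronglyMeasurable.aemeasurable.ennreal_ofReal
  rw [spaceTime] at hm ⊢
  rw [lintegral_prod _ hm, ← restrict_Ioc_eq_restrict_Icc]
  exact setLIntegral_mono_ae' measurableSet_Ioc (ae_of_all _ fun τ hτ =>
    hs.macroDistance_le hτ.1 (η τ))

/-- The two distances are controlled by the initial distance and the error bound. -/
lemma distance_le (hc : 0 ≤ c) (hκ : 0 < κ) (hρ : 0 < ρ) (hlam : 0 < lam)
    (hLam : 0 < Lam) (hα : 0 ≤ α) (hγ : 0 ≤ γ) {T : ℝ} (hT : 0 < T) {a : ℝ}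
    (ha0 : a = 2 / N * ∫ x, microEnergy N P A (η 0) x * f 0 x ∂(gibbs H)) :
    (⨆ t ∈ Icc (0 : ℝ) T, microDistance N P A H (f t) (η t)) ≤
        ENNReal.ofReal a + ENNReal.ofReal (Real.exp (2 * growthRate lam Lam γ c * T) *
          (a + 2 * (errorBound N M κ ρ lam Lam α β γ C₁ C₂ c T / N))) ∧
      ∫⁻ t in Icc 0 T, macroDistance P H (f t) (η t) ≤
        ENNReal.ofReal (Real.exp (2 * growthRate lam Lam γ c * T) / lam *
          (a + 2 * (errorBound N M κ ρ lam Lam α β γ C₁ C₂ c T / N))) := by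
  have hN := hs.N_pos'
  set E := errorBound N M κ ρ lam Lam α β γ C₁ C₂ c T with hE
  set G := 2 * growthRate lam Lam γ c * T with hG
  have hmicro : ∀ t, 0 ≤ t → 0 ≤ ∫ x, microEnergy N P A (η t) x * f t x ∂(gibbs H) :=
    fun t ht => integral_nonneg fun x =>
      mul_nonneg (hs.microEnergy_nonneg _ _) (hs.micro_sol.nonneg t ht x)
  have hdist : ∀ t, 0 ≤ ∫ p, ‖P p.2 - η p.1‖ ^ 2 * f p.1 p.2 ∂(spaceTime H 0 t) := fun t =>
    integral_nonneg_of_ae (by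
      filter_upwards [hs.ae_nonneg_f t] with p hp
      exact mul_nonneg (sq_nonneg _) hp)
  have key : ∀ t, 0 < t → t ≤ T → ∫ x, microEnergy N P A (η t) x * f t x ∂(gibbs H) +
      N * lam / 2 * ∫ p, ‖P p.2 - η p.1‖ ^ 2 * f p.1 p.2 ∂(spaceTime H 0 t) ≤
      Real.exp G * (N / 2 * (a + 2 * (E / N))) := fun t ht htT => by
    have h1 := hs.microEnergy_evolution_le ha hc hκ hρ hlam hLam hα hγ ht htT
    have h2 : ∫ x, microEnergy N P A (η 0) x * f 0 x ∂(gibbs H) + E =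
        N / 2 * (a + 2 * (E / N)) := by
      rw [ha0]; field_simp
    rw [← hE, h2, Real.exp_neg, inv_mul_le_iff₀ (Real.exp_pos _)] at h1
    exact h1
  constructor
  · refine iSup₂_le fun t ht => ?_
    rw [hs.microDistance_eq ha _ ht.1]
    rcases ht.1.eq_or_lt with rfl | h0
    · rw [← ha0]; exact le_self_add
    · refine le_add_left (ENNReal.ofReal_le_ofReal ?_)
      have h1 := (le_add_of_nonneg_right (mul_nonneg (by positivity) (hdist t))).trans
        (key t h0 ht.2)
      calc _ ≤ 2 / N * (Real.exp G * (N / 2 * (a + 2 * (E / N)))) :=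
            mul_le_mul_of_nonneg_left h1 (by positivity)
        _ = _ := by field_simp
  · refine (hs.lintegral_macroDistance_le ha hα hT).trans (ENNReal.ofReal_le_ofReal ?_)
    have h1 := (le_add_of_nonneg_left (hmicro T hT.le)).trans (key T hT le_rfl)
    calc _ = 2 / (N * lam) * (N * lam / 2 *
          ∫ p, ‖P p.2 - η p.1‖ ^ 2 * f p.1 p.2 ∂(spaceTime H 0 T)) := by field_simp
      _ ≤ 2 / (N * lam) * (Real.exp G * (N / 2 * (a + 2 * (E / N)))) :=
          mul_le_mul_of_nonneg_left h1 (by positivity)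
      _ = _ := by field_simp

end IsSystem

/-- The error per unit of system size is of order `1 / M + M / N`. -/
lemma tendsto_errorBound_div {N M : ℕ → ℕ} (hN0 : ∀ l, 0 < N l) (hM0 : ∀ l, 0 < M l)
    (hM : Tendsto M atTop atTop) (hMN : Tendsto (fun l => (M l : ℝ) / (N l : ℝ)) atTop (𝓝 0))
    (hρ : 0 < ρ) (hlam : 0 < lam) (T : ℝ) :
    Tendsto (fun l => errorBound (N l) (M l) κ ρ lam Lam α β γ C₁ C₂ c T / N l) atTop (𝓝 0) := by
  have h1 : Tendsto (fun l => 1 / (M l : ℝ)) atTop (𝓝 0) :=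
    tendsto_one_div_atTop_nhds_zero_nat.comp hM
  have h2 := (hMN.mul_const (T + 2 / lam * (4 * κ ^ 2 / ρ) * T)).add
    (h1.mul_const (2 / lam * (4 * κ ^ 2 / ρ) * (1 / (2 * ρ) * γ * C₁) + 3 * √γ / 2 * α * T +
      √γ / 2 * dissipationBound Lam β C₂ c T + √γ * C₁))
  rw [zero_mul, zero_mul, add_zero] at h2
  refine h2.congr fun l => ?_
  have hN' : (N l : ℝ) ≠ 0 := by exact_mod_cast (hN0 l).ne'
  have hM' : (M l : ℝ) ≠ 0 := by exact_mod_cast (hM0 l).ne'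
  rw [errorBound]
  field_simp
  ring

end Limit

end TwoScale

theorem mainTheorem4
    {X Y : ℕ → Type*}
    [∀ l, NormedAddCommGroup (X l)] [∀ l, InnerProductSpace ℝ (X l)]
    [∀ l, FiniteDimensional ℝ (X l)] [∀ l, MeasurableSpace (X l)] [∀ l, BorelSpace (X l)]
    [∀ l, NormedAddCommGroup (Y l)] [∀ l, InnerProductSpace ℝ (Y l)]
    [∀ l, FiniteDimensional ℝ (Y l)] [∀ l, MeasurableSpace (Y l)] [∀ l, BorelSpace (Y l)]
    (N M : ℕ → ℕ)
    (P : ∀ l, X l →ₗ[ℝ] Y l) (A J : ∀ l, X l →ₗ[ℝ] X l)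
    (H : ∀ l, X l → ℝ) (Hbar : ∀ l, Y l → ℝ)
    (f : ∀ l, ℝ → X l → ℝ) (η : ∀ l, ℝ → Y l)
    (hsys : ∀ l, TwoScale.IsSystem (N l) (M l) (P l) (A l) (J l) (H l) (Hbar l) (f l) (η l))
    (κ ρ lam Lam α β γ C₁ C₂ c : ℝ)
    (hρ : 0 < ρ) (hlam : 0 < lam) (hLam : 0 < Lam) (hα : 0 < α) (hβ : 0 < β) (hγ : 0 < γ)
    (hass : ∀ l, TwoScale.Assumptions (N l) (M l) (P l) (A l) (J l) (H l) (Hbar l) (f l) (η l)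
      κ ρ lam Lam α β γ C₁ C₂ c)
    (hN : Filter.Tendsto N Filter.atTop Filter.atTop)
    (hM : Filter.Tendsto M Filter.atTop Filter.atTop)
    (hMN : Filter.Tendsto (fun l => (M l : ℝ) / (N l : ℝ)) Filter.atTop (nhds 0))
    (hinit : Filter.Tendsto
      (fun l => TwoScale.microDistance (N l) (P l) (A l) (H l) (f l 0) (η l 0))
      Filter.atTop (nhds 0)) :
    ∀ T : ℝ, 0 < T →
      Filter.Tendsto
        (fun l => ⨆ t ∈ Set.Icc (0 : ℝ) T,
          TwoScale.microDistance (N l) (P l) (A l) (H l) (f l t) (η l t))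
        Filter.atTop (nhds 0) ∧
      Filter.Tendsto
        (fun l => ∫⁻ t in Set.Icc (0 : ℝ) T,
          TwoScale.macroDistance (P l) (H l) (f l t) (η l t))
        Filter.atTop (nhds 0) := by
  intro T hT
  -- The constants `κ` and `c` may be enlarged, so that `κ` is positive and `c` nonnegative.
  have hass' := fun l => (hass l).mono (hsys l) (le_max_left κ 1) (le_max_left c 0)
  have hκ : 0 < max κ 1 := lt_max_of_lt_right one_pos
  have hc : 0 ≤ max c 0 := le_max_right _ _
  set a : ℕ → ℝ := fun l => 2 / N l * ∫ x, TwoScale.microEnergy (N l) (P l) (A l) (η l 0) x *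
    f l 0 x ∂(TwoScale.gibbs (H l)) with hadef
  set E : ℕ → ℝ := fun l => TwoScale.errorBound (N l) (M l) (max κ 1) ρ lam Lam α β γ C₁ C₂
    (max c 0) T / N l with hEdef
  have ha : Tendsto a atTop (𝓝 0) := by
    have h1 := (ENNReal.tendsto_toReal ENNReal.zero_ne_top).comp hinit
    rw [ENNReal.toReal_zero] at h1
    refine h1.congr fun l => ?_
    have h2 : 0 ≤ a l := mul_nonneg (by positivity) (integral_nonneg fun x => mul_nonneg
      ((hsys l).microEnergy_nonneg _ _) ((hsys l).micro_sol.nonneg 0 le_rfl x))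
    rw [Function.comp_apply, (hsys l).microDistance_eq (hass l) _ le_rfl, ENNReal.toReal_ofReal h2]
  have hE : Tendsto E atTop (𝓝 0) :=
    TwoScale.tendsto_errorBound_div (fun l => (hsys l).N_pos) (fun l => (hsys l).M_pos) hM hMN hρ
      hlam T
  have hlim : ∀ r : ℝ, Tendsto (fun l => ENNReal.ofReal (r * (a l + 2 * E l))) atTop (𝓝 0) :=
    fun r => by
      have h1 := ENNReal.tendsto_ofReal ((ha.add (hE.const_mul 2)).const_mul r)
      simpa using h1
  have ha' : Tendsto (fun l => ENNReal.ofReal (a l)) atTop (𝓝 0) := by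
    simpa using ENNReal.tendsto_ofReal ha
  have hb := fun l => (hsys l).distance_le (hass' l) hc hκ hρ hlam hLam hα.le hγ.le hT
    (a := a l) rfl
  refine ⟨tendsto_of_tendsto_of_tendsto_of_le_of_le tendsto_const_nhds ?_
    (fun _ => zero_le) fun l => (hb l).1, tendsto_of_tendsto_of_tendsto_of_le_of_le
    tendsto_const_nhds (hlim _) (fun _ => zero_le) fun l => (hb l).2⟩
  simpa using ha'.add (hlim (Real.exp (2 * TwoScale.growthRate lam Lam γ (max c 0) * T)))
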